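/- **Theorem.** There is a single randomized MapReduce algorithm for the maximum weight matching problem with the following guarantees. The input is a graph $G=(V,E)$ with $n$ vertices and a weight function $w\colon E\to\mathbb{R}$; put $S=\lceil n^{1+\mu}\rceil$, where $\mu$ is the memory exponent. The edges with their weights are distributed arbitrarily over $\lfloor |E|/S\rfloor+1$ machines, at most $S$ edges on each machine. The computation proceeds in rounds: in each round every machine performs, in time polynomial in $n$, a randomized computation on the key-value pairs that it has received, using $O(n^{1+\mu})$ words of space (this includes its input and its output messages), and emits key-value pairs, which are delivered at the start of the next round to the machines named by their keys. A word is either an integer bounded by a fixed power of $n$, or an integer linear combination of the edge weights whose coefficients have absolute values with sum at most a fixed power of $n$; weights can be added, subtracted and compared. The program executed by the machines does not depend on $n$ or on the input; it may use $n$, $S$, the number of machines, the number of the machine and the number of the round. A matching $M\subseteq E$ is a 2-approximate maximum weight matching if $\sum_{e\in M'}w_e\le 2\sum_{e\in M}w_e$ for every matching $M'$ of $G$. 1. Let $\mu=\mu(n)$ satisfy $\mu=\omega(\log\log n/\log n)$. For every $a\in\mathbb{N}$, all $n\ge n_0(\mu(\cdot),a)$, all $c>\mu$, and all weighted graphs with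 $n$ vertices and at most $n^{1+c}$ edges, with probability at least $1-n^{-a}$ the algorithm respects these resource bounds, stops within $O(c/\mu)$ rounds and outputs a 2-approximate maximum weight matching. 2. Let $\mu=0$. For all $n\ge 2$ and all weighted graphs with $n$ vertices, with probability at least $1-1/n$ the algorithm respects these resource bounds (so each machine uses $O(n)$ words of space), stops within $O(\log n)$ rounds and outputs a 2-approximate maximum weight matching. The constants in the $O(\cdot)$ and the exponents of the polynomial bounds are absolute. -/

import Mathlib

/-!
A MapReduce model over a random access machine with explicit word size, memory and step count,
and the maximum weight matching problem in that model.

Since the model is used for an existence claim only, its instruction set is kept small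
(bounded loops instead of general ones, no multiplication of weights, ...).
-/

namespace MapReduce

/-- The value of a key-value pair: four integer words and one weight word. -/
structure Packet where
  field : Fin 4 → ℕ
  weight : ℝ

/-- The public data that a machine may read besides its memory and its inbox: the number of
vertices, the memory parameter `S`, the number of machines, its own number (counted from `0`),
the number of the current round (counted from `0`), and the number of packets in its inbox. -/
inductive Param
  | vertices | capacity | machines | self | round | inboxLength

/-- Integer expressions. `load` reads the integer memory, `inbox j i` is the `j`-th integer word
of the `i`-th packet of the inbox. -/
inductive IExp
  | lit (c : ℕ)
  | param (p : Param)
  | load (addr : IExp)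
  | inbox (j : Fin 4) (i : IExp)
  | add (a b : IExp)
  | sub (a b : IExp)
  | mul (a b : IExp)
  | div (a b : IExp)
  | mod (a b : IExp)

/-- Weight expressions. Weights can only be copied, added, subtracted (and compared). -/
inductive WExp
  | zero
  | load (addr : IExp)
  | inbox (i : IExp)
  | add (a b : WExp)
  | sub (a b : WExp)

/-- Tests. -/
inductive Test
  | ilt (a b : IExp)
  | ieq (a b : IExp)
  | wlt (a b : WExp)
  | not (a : Test)
  | and (a b : Test)

/-- Programs.
* `istore a e`, `wstore a e`: store the value of `e` at address `a` of the integer memory,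
  respectively the weight memory;
* `draw a e`: store at address `a` a fresh uniformly random element of `{0, …, e}`;
* `loop a e body`: for `t = 0, …, e - 1` (with `e` evaluated once, at the start), store `t` at
  the integer address `a` and execute `body`;
* `send d f x`: emit the packet with words `f`, `x` and with key `d`, the number of the receiving
  machine;
* `output a b`: append the pair `(a, b)` to the result;
* `halt`: announce that the whole computation is over at the end of the current round. -/
inductive Cmd
  | skip
  | istore (addr e : IExp)
  | wstore (addr : IExp) (e : WExp)
  | draw (addr range : IExp)
  | seq (p q : Cmd)
  | ite (b : Test) (p q : Cmd)
  | loop (addr bound : IExp) (body : Cmd)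
  | send (dest : IExp) (f : Fin 4 → IExp) (x : WExp)
  | output (a b : IExp)
  | halt

/-- What a machine can read but not change during a round. -/
structure Env where
  param : Param → ℕ
  inbox : List Packet

/-- The state of a machine during a round. -/
structure Machine where
  ints : ℕ → ℕ
  weights : ℕ → ℝ
  outbox : List (ℕ × Packet)
  result : List (ℕ × ℕ)
  halted : Bool
  steps : ℕ

/-- The state of a machine at the start of each round: nothing survives from one round to the next
but the packets that are sent (a machine may send packets to itself). -/
def Machine.init : Machine where
  ints := fun _ => 0
  weights := fun _ => 0
  outbox := []
  result := []
  halted := false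
  steps := 0

/-- The resources of a machine. Each of the integer memory and the weight memory has `cells`
cells, and each of the inbox, the outbox and the result holds at most `cells` entries; as an
entry consists of at most six words, a machine uses `O(cells)` words in total. An integer word is
at most `maxInt`, a weight word lies in `words`, and a machine executes at most `maxSteps` steps
per round. -/
structure Limits where
  cells : ℕ
  maxInt : ℕ
  words : Set ℝ
  maxSteps : ℕ

def IExp.eval (env : Env) (s : Machine) : IExp → ℕ
  | .lit c => c
  | .param p => env.param p
  | .load a => s.ints (a.eval env s)
  | .inbox j i => (env.inbox[i.eval env s]?).elim 0 fun p => p.field j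
  | .add a b => a.eval env s + b.eval env s
  | .sub a b => a.eval env s - b.eval env s
  | .mul a b => a.eval env s * b.eval env s
  | .div a b => a.eval env s / b.eval env s
  | .mod a b => a.eval env s % b.eval env s

noncomputable def WExp.eval (env : Env) (s : Machine) : WExp → ℝ
  | .zero => 0
  | .load a => s.weights (a.eval env s)
  | .inbox i => (env.inbox[i.eval env s]?).elim 0 fun p => p.weight
  | .add a b => a.eval env s + b.eval env s
  | .sub a b => a.eval env s - b.eval env s

def Test.eval (env : Env) (s : Machine) : Test → Prop
  | .ilt a b => a.eval env s < b.eval env s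
  | .ieq a b => a.eval env s = b.eval env s
  | .wlt a b => a.eval env s < b.eval env s
  | .not a => ¬ a.eval env s
  | .and a b => a.eval env s ∧ b.eval env s

/-- Randomized computations that may crash (`none`), in sequence. -/
noncomputable def andThen {α β : Type} (p : PMF (Option α)) (f : α → PMF (Option β)) :
    PMF (Option β) :=
  p.bind fun o => o.elim (PMF.pure none) f

/-- The composition `f 0`, then `f 1`, …, then `f (N - 1)`. -/
noncomputable def iter {α : Type} (f : ℕ → α → PMF (Option α)) : ℕ → α → PMF (Option α)
  | 0, s => PMF.pure (some s)
  | N + 1, s => andThen (iter f N s) (f N)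

open Classical in
/-- Continue with `s` if `b` holds, crash otherwise. -/
noncomputable def check {α : Type} (b : Prop) (s : α) : PMF (Option α) :=
  PMF.pure (if b then some s else none)

def Machine.tick (s : Machine) : Machine := { s with steps := s.steps + 1 }

/-- Store an integer word and count one step; crash if the address is not in the memory or the
value is no integer word. -/
noncomputable def Machine.istore (L : Limits) (s : Machine) (a v : ℕ) : PMF (Option Machine) :=
  check (a < L.cells ∧ v ≤ L.maxInt) { s.tick with ints := Function.update s.ints a v }

/-- Store a weight word and count one step; crash if the address is not in the memory or the
value is no weight word. -/
noncomputable def Machine.wstore (L : Limits) (s : Machine) (a : ℕ) (v : ℝ) :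
    PMF (Option Machine) :=
  check (a < L.cells ∧ v ∈ L.words) { s.tick with weights := Function.update s.weights a v }

open Classical in
/-- The distribution of the state after the execution of a program. Each executed instruction and
each pass through a loop is one step. A violation of the memory bound or of the word size is a
crash. (Reading an address outside of the memory gives `0`.) -/
noncomputable def exec (L : Limits) (env : Env) : Cmd → Machine → PMF (Option Machine)
  | .skip, s => PMF.pure (some s.tick)
  | .istore a e, s => s.istore L (a.eval env s) (e.eval env s)
  | .wstore a e, s => s.wstore L (a.eval env s) (e.eval env s)
  | .draw a e, s =>
      (PMF.uniformOfFintype (Fin (e.eval env s + 1))).bind fun r => s.istore L (a.eval env s) r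
  | .seq p q, s => andThen (exec L env p s) (exec L env q)
  | .ite b p q, s => if b.eval env s then exec L env p s.tick else exec L env q s.tick
  | .loop a e body, s =>
      iter (fun t s' => andThen (s'.istore L (a.eval env s) t) (exec L env body))
        (e.eval env s) s.tick
  | .send d f x, s =>
      check ((∀ j, (f j).eval env s ≤ L.maxInt) ∧ x.eval env s ∈ L.words)
        { s.tick with
          outbox := s.outbox ++ [(d.eval env s, ⟨fun j => (f j).eval env s, x.eval env s⟩)] }
  | .output a b, s =>
      check (a.eval env s ≤ L.maxInt ∧ b.eval env s ≤ L.maxInt)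
        { s.tick with result := s.result ++ [(a.eval env s, b.eval env s)] }
  | .halt, s => PMF.pure (some { s.tick with halted := true })

/-- One round of one machine: the machine crashes if it takes too many steps, or if its inbox,
its outbox or its result is too long. -/
noncomputable def work (L : Limits) (A : Cmd) (env : Env) : PMF (Option Machine) :=
  andThen (exec L env A Machine.init) fun s =>
    check (s.steps ≤ L.maxSteps ∧ env.inbox.length ≤ L.cells ∧ s.outbox.length ≤ L.cells ∧
      s.result.length ≤ L.cells) s

/-- Independent computations of `M` machines; it crashes if one of them does. -/
noncomputable def parallel {α : Type} : {M : ℕ} → (Fin M → PMF (Option α)) →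
    PMF (Option (Fin M → α))
  | 0, _ => PMF.pure (some Fin.elim0)
  | _ + 1, p =>
      andThen (p 0) fun a =>
        andThen (parallel fun i => p i.succ) fun f => PMF.pure (some (Fin.cons a f))

/-- The shuffle: machine `j` receives all packets with key `j`, ordered by sender and by time. -/
def deliver {M : ℕ} (s : Fin M → Machine) (j : Fin M) : List Packet :=
  (List.finRange M).flatMap fun i =>
    ((s i).outbox.filter fun q => q.1 = (j : ℕ)).map fun q => q.2

/-- The values of the public data for a machine. -/
def publicData (n S M self round len : ℕ) : Param → ℕ
  | .vertices => n
  | .capacity => S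
  | .machines => M
  | .self => self
  | .round => round
  | .inboxLength => len

open Classical in
/-- The distribution of the result of the MapReduce algorithm in which each of `M` machines
executes the program `A` in each round, when round number `r` begins with the inboxes `inb`.
The algorithm stops after the first round in which a machine announces so, and its result consists
of the pairs that the machines output in that round. It is `none` if a machine crashes, or if the
algorithm does not stop within `R` rounds. -/
noncomputable def run (L : Limits) (A : Cmd) (n S : ℕ) {M : ℕ} :
    (R r : ℕ) → (inb : Fin M → List Packet) → PMF (Option (List (ℕ × ℕ)))
  | 0, _, _ => PMF.pure none
  | R + 1, r, inb =>
      andThen (parallel fun i => work L A ⟨publicData n S M i r (inb i).length, inb i⟩) fun s =>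
        if ∃ i, (s i).halted = true then
          PMF.pure (some ((List.finRange M).flatMap fun i => (s i).result))
        else run L A n S R (r + 1) (deliver s)

/-- `D` distributes the edges of `G` (each written with its end points in either order) over `M`
machines, at most `S` edges to a machine. -/
structure IsDistribution {n M : ℕ} (G : SimpleGraph (Fin n)) (S : ℕ)
    (D : Fin M → List (Fin n × Fin n)) : Prop where
  length_le : ∀ i, (D i).length ≤ S
  nodup : (((List.finRange M).flatMap D).map fun q => s(q.1, q.2)).Nodup
  mem_iff : ∀ e, e ∈ ((List.finRange M).flatMap D).map (fun q => s(q.1, q.2)) ↔ e ∈ G.edgeSet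

/-- The packet that describes an edge and its weight. -/
def edgePacket {n : ℕ} (w : Sym2 (Fin n) → ℝ) (q : Fin n × Fin n) : Packet where
  field := ![q.1, q.2, 0, 0]
  weight := w s(q.1, q.2)

/-- A matching: a set of edges of `G`, no two of which have a common end point. -/
def IsMatching {n : ℕ} (G : SimpleGraph (Fin n)) (T : Finset (Sym2 (Fin n))) : Prop :=
  (∀ e ∈ T, e ∈ G.edgeSet) ∧ ∀ e ∈ T, ∀ f ∈ T, e ≠ f → ∀ v, v ∈ e → v ∉ f

/-- The list of pairs `out` lists the edges of a matching whose weight is at least half the weight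
of every matching. -/
def IsTwoApprox {n : ℕ} (G : SimpleGraph (Fin n)) (w : Sym2 (Fin n) → ℝ)
    (out : List (ℕ × ℕ)) : Prop :=
  ∃ T : Finset (Sym2 (Fin n)),
    (∀ x : Sym2 ℕ, x ∈ out.map (fun q => s(q.1, q.2)) ↔ ∃ e ∈ T, e.map (fun v : Fin n => (v : ℕ)) = x) ∧
    IsMatching G T ∧
    ∀ T', IsMatching G T' → ∑ e ∈ T', w e ≤ 2 * ∑ e ∈ T, w e

open Classical in
/-- The weight words of size `W`: the integer combinations of the weights of the edges in which
the absolute values of the coefficients sum up to at most `W`. (Such a word holds an edge weight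
exactly, but arithmetic on words cannot pack arbitrarily much information into it; if all weights
are `1`, then the weight words are just the integers of absolute value at most `W`.) -/
noncomputable def weightWords {n : ℕ} (G : SimpleGraph (Fin n)) (w : Sym2 (Fin n) → ℝ) (W : ℕ) :
    Set ℝ :=
  {x | ∃ a : Sym2 (Fin n) → ℤ, ∑ e ∈ G.edgeFinset, |a e| ≤ (W : ℤ) ∧
    x = ∑ e ∈ G.edgeFinset, (a e : ℝ) * w e}

/-- The memory parameter `⌈n ^ (1 + μ)⌉`. -/
noncomputable def capacity (n : ℕ) (μ : ℝ) : ℕ := ⌈(n : ℝ) ^ (1 + μ)⌉₊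

/-- The number of machines for `m` edges, with at most `capacity n μ` of them on a machine. -/
noncomputable def machineCount (n m : ℕ) (μ : ℝ) : ℕ := m / capacity n μ + 1

/-- The resources of a machine: `O(n ^ (1 + μ))` memory, words of `O(log n)` bits, polynomially
many steps per round. -/
noncomputable def limits {n : ℕ} (G : SimpleGraph (Fin n)) (w : Sym2 (Fin n) → ℝ) (C k : ℕ)
    (μ : ℝ) : Limits where
  cells := ⌊(C : ℝ) * (n : ℝ) ^ (1 + μ)⌋₊
  maxInt := n ^ k
  words := weightWords G w (n ^ k)
  maxSteps := n ^ k

/-- For every distribution of the edges over the machines, the algorithm given by the program `A`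
does, with probability at least `1 - δ`, respect the limits, stop within `R` rounds and
output a 2-approximate maximum weight matching. -/
def ComputesTwoApprox (A : Cmd) (C k : ℕ) {n : ℕ} (G : SimpleGraph (Fin n))
    (w : Sym2 (Fin n) → ℝ) (μ : ℝ) (R : ℕ) (δ : ENNReal) : Prop :=
  ∀ D : Fin (machineCount n G.edgeSet.ncard μ) → List (Fin n × Fin n),
    IsDistribution G (capacity n μ) D →
    1 - δ ≤ (run (limits G w C k μ) A n (capacity n μ) R 0
      fun i => (D i).map (edgePacket w)).toOuterMeasure
        {o | ∃ out, o = some out ∧ IsTwoApprox G w out}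

end MapReduce

open scoped ENNReal


namespace MapReduce

/-! ### Expected losses -/

/-! The algorithm is a randomized local ratio method. Every vertex carries a potential, and the
residual weight of an edge is its weight minus the potentials of its end points. Pushing an edge of
positive residual weight on a stack raises both potentials by that residual. Once no edge has
positive residual weight, the potentials are a fractional vertex cover, so by LP duality their sum
bounds the weight of every matching (`sum_matching_le`). Each push contributes twice its residual to
that sum (`sum_push`), and unwinding the stack greedily gives a matching at least as heavy as the
sum of the pushed residuals (`pushWeight_le`). Hence the ratio 2, whatever the order of the pushes
(`isTwoApprox_unwind`).

The free order allows sampling. In a phase with `N` edges of positive residual weight, each of the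
`2 N` arcs is kept with probability `p = min 1 (64 S / N)` and sent to one central machine, which
goes through the vertices and pushes the best sampled arc leaving each of them. An edge survives the
phase only if, at the turn of its tail, it beats all sampled arcs with this tail. The number of such
arcs at one vertex has a geometric tail with parameter about `p`. The ranking of the arcs at a
vertex is settled by the samples at earlier vertices, so the exponential moments of the `n` counts
can be multiplied (`expSub_prod_le`). Markov's inequality then shows that, up to probability `2 / 32
^ n`, the sample has at most `256 S` arcs and the number of edges shrinks by the factor `n / (2 S)`;
if `N ≤ 64 S`, everything is sampled and no edge survives (`expSub_not_goodSample_le`).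

So `T + 1` phases of four rounds suffice as soon as `|E| n ^ T ≤ 64 S (2 S) ^ T`. For positive `μ`
take `T = ⌈c / μ⌉` (`edges_mul_pow_le`); for `μ = 0` the factor `1 / 2` per phase remains, and `T =
⌈log₂ n⌉` works (`edges_mul_pow_clog_le`). The pushes of phase `t` form layer `t` of the stack, kept
on machine `t`. Afterwards the layers are unwound one per round, the matching travelling from
machine to machine down to machine `0`. The induction over the phases is `Setting.loss_run_phases`.

For the program itself, `Runs` describes deterministic execution and `Sim` relates an execution to a
random sublist, over which `expSub` takes expectations. Crashes, late termination and wrong outputs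
all enter one expected loss, to be bounded by `δ`. -/

/-- The expectation of `f`, where a crash costs `1`. -/
noncomputable def loss {β : Type} (P : PMF (Option β)) (f : β → ℝ≥0∞) : ℝ≥0∞ :=
  ∑' o, P o * o.elim 1 f

lemma loss_pure {β : Type} (b : β) (f : β → ℝ≥0∞) : loss (PMF.pure (some b)) f = f b := by
  unfold loss
  rw [tsum_eq_single (some b)]
  · simp
  · intro o ho
    simp [ho]

lemma loss_crash {β : Type} (f : β → ℝ≥0∞) : loss (PMF.pure none) f = 1 := by
  unfold loss
  rw [tsum_eq_single none]
  · simp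
  · intro o ho
    simp [ho]

lemma loss_bind {α β : Type} (P : PMF α) (g : α → PMF (Option β)) (f : β → ℝ≥0∞) :
    loss (P.bind g) f = ∑' a, P a * loss (g a) f := by
  unfold loss
  simp only [PMF.bind_apply, ← ENNReal.tsum_mul_right, ← ENNReal.tsum_mul_left, mul_assoc]
  rw [ENNReal.tsum_comm]

lemma loss_andThen {α β : Type} (P : PMF (Option α)) (g : α → PMF (Option β)) (f : β → ℝ≥0∞) :
    loss (andThen P g) f = loss P fun a => loss (g a) f := by
  unfold andThen
  rw [loss_bind]
  unfold loss
  congr 1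
  ext o
  cases o with
  | none => exact congrArg (P none * ·) (loss_crash f)
  | some a => rfl

lemma loss_congr {β : Type} {P : PMF (Option β)} {f g : β → ℝ≥0∞}
    (h : ∀ b, P (some b) ≠ 0 → f b = g b) : loss P f = loss P g := by
  unfold loss
  congr 1
  ext o
  cases o with
  | none => rfl
  | some b =>
    by_cases hb : P (some b) = 0
    · simp [hb]
    · simp [h b hb]

lemma loss_mono {β : Type} {P : PMF (Option β)} {f g : β → ℝ≥0∞} (h : ∀ b, f b ≤ g b) :
    loss P f ≤ loss P g := by
  unfold loss
  refine ENNReal.tsum_le_tsum fun o => ?_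
  cases o with
  | none => exact le_rfl
  | some b => exact mul_le_mul_right (h b) _

lemma loss_le_one {β : Type} {P : PMF (Option β)} {f : β → ℝ≥0∞} (h : ∀ b, f b ≤ 1) :
    loss P f ≤ 1 := by
  refine (loss_mono h).trans ?_
  unfold loss
  calc ∑' o, P o * o.elim 1 (fun _ => (1 : ℝ≥0∞)) = ∑' o, P o := by
        congr 1
        ext o
        cases o <;> simp
    _ = 1 := P.tsum_coe
    _ ≤ 1 := le_rfl

-- The mass of the good outputs and the loss of the indicator of the bad ones add up to the total
-- mass `1`, since a crash also costs `1`. From here on a success probability is an upper bound for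
-- a loss.
open Classical in
lemma one_sub_le_of_loss_le {β : Type} {P : PMF (Option β)} {Q : β → Prop} {δ : ℝ≥0∞}
    (h : loss P (fun b => if Q b then 0 else 1) ≤ δ) :
    1 - δ ≤ P.toOuterMeasure {o | ∃ b, o = some b ∧ Q b} := by
  rw [tsub_le_iff_right]
  calc (1 : ℝ≥0∞) = ∑' o, P o := P.tsum_coe.symm
    _ = P.toOuterMeasure {o | ∃ b, o = some b ∧ Q b}
          + loss P (fun b => if Q b then 0 else 1) := by
        rw [PMF.toOuterMeasure_apply, loss, ← ENNReal.tsum_add]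
        congr 1
        ext o
        cases o with
        | none => simp
        | some b => by_cases hb : Q b <;> simp [hb]
    _ ≤ _ := by gcongr

/-! ### Random sublists -/

/-- The expectation of `F` over the sublists of a list whose elements are kept independently,
with weight `p`, or dropped, with weight `q`. -/
noncomputable def expSub {α : Type} (p q : ℝ≥0∞) : List α → (List α → ℝ≥0∞) → ℝ≥0∞
  | [], F => F []
  | a :: l, F => p * expSub p q l (fun s => F (a :: s)) + q * expSub p q l F

/-- The outcomes of `P` can be coupled with the random sublists of `l` such that `Q` holds. -/
def Sim {α β : Type} (p q : ℝ≥0∞) (P : PMF (Option β)) (l : List α)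
    (Q : List α → β → Prop) : Prop :=
  ∀ (f : β → ℝ≥0∞) (F : List α → ℝ≥0∞), (∀ s b, Q s b → f b ≤ F s) → loss P f ≤ expSub p q l F

/-- `P` is deterministic, and its outcome satisfies `Q`. -/
def Runs {β : Type} (P : PMF (Option β)) (Q : β → Prop) : Prop :=
  ∃ b, P = PMF.pure (some b) ∧ Q b

lemma expSub_mono {α : Type} {p q : ℝ≥0∞} {l : List α} {F G : List α → ℝ≥0∞}
    (h : ∀ s, s.Sublist l → F s ≤ G s) : expSub p q l F ≤ expSub p q l G := by
  induction l generalizing F G with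
  | nil => exact h [] (List.Sublist.refl _)
  | cons a l ih =>
    simp only [expSub]
    gcongr
    · exact ih fun s hs => h _ (hs.cons_cons a)
    · exact ih fun s hs => h _ (hs.cons a)

lemma expSub_append {α : Type} {p q : ℝ≥0∞} (l₁ l₂ : List α) (F : List α → ℝ≥0∞) :
    expSub p q (l₁ ++ l₂) F = expSub p q l₁ fun s₁ => expSub p q l₂ fun s₂ => F (s₁ ++ s₂) := by
  induction l₁ generalizing F with
  | nil => rfl
  | cons a l ih => simp only [List.cons_append, expSub, ih]

lemma Runs.mono {β : Type} {P : PMF (Option β)} {Q Q' : β → Prop} (h : Runs P Q)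
    (hQ : ∀ b, Q b → Q' b) : Runs P Q' := by
  obtain ⟨b, hb, h⟩ := h
  exact ⟨b, hb, hQ b h⟩

lemma Runs.pure {β : Type} {b : β} {Q : β → Prop} (h : Q b) : Runs (PMF.pure (some b)) Q :=
  ⟨b, rfl, h⟩

lemma Runs.andThen {α β : Type} {P : PMF (Option α)} {g : α → PMF (Option β)} {Q : β → Prop}
    (h : Runs P fun a => Runs (g a) Q) : Runs (andThen P g) Q := by
  obtain ⟨a, rfl, b, hb, hQ⟩ := h
  refine ⟨b, ?_, hQ⟩
  simp [MapReduce.andThen, PMF.pure_bind, hb]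

lemma Runs.check {β : Type} {c : Prop} {b : β} {Q : β → Prop} (hc : c) (h : Q b) :
    Runs (check c b) Q := by
  refine ⟨b, ?_, h⟩
  simp [MapReduce.check, hc]

lemma Runs.iter {β : Type} {g : ℕ → β → PMF (Option β)} {N : ℕ} {s : β} {I : ℕ → β → Prop}
    (h0 : I 0 s) (hs : ∀ t < N, ∀ b, I t b → Runs (g t b) (I (t + 1))) :
    Runs (iter g N s) (I N) := by
  induction N with
  | zero => exact Runs.pure h0
  | succ N ih =>
    refine Runs.andThen ?_
    refine (ih fun t ht => hs t (ht.trans (Nat.lt_succ_self N))).mono fun b hb => ?_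
    exact hs N (Nat.lt_succ_self N) b hb

lemma Sim.mono {α β : Type} {p q : ℝ≥0∞} {P : PMF (Option β)} {l : List α}
    {Q Q' : List α → β → Prop} (h : Sim p q P l Q) (hQ : ∀ s b, Q s b → Q' s b) :
    Sim p q P l Q' :=
  fun f F hF => h f F fun s b hb => hF s b (hQ s b hb)

lemma Runs.sim {α β : Type} {p q : ℝ≥0∞} {P : PMF (Option β)} {Q : List α → β → Prop}
    (h : Runs P (Q [])) : Sim p q P [] Q := by
  intro f F hF
  obtain ⟨b, rfl, hb⟩ := h
  rw [loss_pure]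
  exact hF [] b hb

/-- The choices of the second computation are independent of the earlier ones, so the lists are
concatenated. Having a `Sim` as postcondition lets the second computation depend on the outcome of
the first, as long as its list `l₂` is known in advance. -/
lemma Sim.andThen {α β γ : Type} {p q : ℝ≥0∞} {P : PMF (Option β)} {g : β → PMF (Option γ)}
    {l₁ l₂ : List α} {Q : List α → γ → Prop}
    (h : Sim p q P l₁ fun s₁ b => Sim p q (g b) l₂ fun s₂ c => Q (s₁ ++ s₂) c) :
    Sim p q (andThen P g) (l₁ ++ l₂) Q := by
  intro f F hF
  rw [loss_andThen, expSub_append]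
  exact h _ _ fun s₁ b hb => hb _ _ fun s₂ c hc => hF _ _ hc

lemma Sim.andThen_runs {α β γ : Type} {p q : ℝ≥0∞} {P : PMF (Option β)} {g : β → PMF (Option γ)}
    {l : List α} {Q : List α → γ → Prop}
    (h : Sim p q P l fun s b => Runs (g b) (Q s)) : Sim p q (MapReduce.andThen P g) l Q := by
  have := Sim.andThen (l₂ := []) (Q := Q) (h.mono fun s b hb => Runs.sim (by simpa using hb))
  simpa using this

lemma Runs.andThen_sim {α β γ : Type} {p q : ℝ≥0∞} {P : PMF (Option β)} {g : β → PMF (Option γ)}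
    {l : List α} {Q : List α → γ → Prop}
    (h : Runs P fun b => Sim p q (g b) l Q) : Sim p q (MapReduce.andThen P g) l Q := by
  have := Sim.andThen (l₁ := []) (Q := Q) (Runs.sim (α := α) (p := p) (q := q)
    (Q := fun s₁ b => Sim p q (g b) l fun s₂ c => Q (s₁ ++ s₂) c) h)
  simpa using this

/-- As `Sim` quantifies over all `f`, one may change `f` to `0` off `K`: this does not affect the
loss and makes the hypothesis on `F` trivial there. -/
lemma Sim.and_support {α β : Type} {p q : ℝ≥0∞} {P : PMF (Option β)} {l : List α}
    {Q : List α → β → Prop} {K : β → Prop} (h : Sim p q P l Q)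
    (hK : ∀ b, P (some b) ≠ 0 → K b) : Sim p q P l fun s b => Q s b ∧ K b := by
  classical
  intro f F hF
  rw [loss_congr (g := fun b => if K b then f b else 0) fun b hb => by simp [hK b hb]]
  refine h _ _ fun s b hb => ?_
  by_cases hKb : K b
  · simpa [hKb] using hF s b ⟨hb, hKb⟩
  · simp [hKb]

/-- The list over which a loop makes its random choices. -/
lemma Sim.iter {α β : Type} {p q : ℝ≥0∞} {g : ℕ → β → PMF (Option β)} {N : ℕ} {s : β}
    {l : ℕ → List α} {I : ℕ → List α → β → Prop} (h0 : I 0 [] s)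
    (hs : ∀ t < N, ∀ r b, I t r b → Sim p q (g t b) (l t) fun r' => I (t + 1) (r ++ r')) :
    Sim p q (iter g N s) ((List.range N).flatMap l) (I N) := by
  induction N with
  | zero => exact Runs.sim (Runs.pure h0)
  | succ N ih =>
    rw [List.range_succ, List.flatMap_append, List.flatMap_singleton]
    refine Sim.andThen ?_
    refine (ih fun t ht => hs t (ht.trans (Nat.lt_succ_self N))).mono fun r b hb => ?_
    exact hs N (Nat.lt_succ_self N) r b hb

/-- Independent machines make independent choices. The concatenated list turns the choices of all
machines into one random sublist, to which the concentration bounds apply. -/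
lemma Sim.parallel {α β : Type} {p q : ℝ≥0∞} {M : ℕ} {P : Fin M → PMF (Option β)}
    {l : Fin M → List α} {Q : Fin M → List α → β → Prop} (h : ∀ i, Sim p q (P i) (l i) (Q i)) :
    Sim p q (parallel P) ((List.finRange M).flatMap l) fun s b =>
      ∃ r : Fin M → List α, s = (List.finRange M).flatMap r ∧ ∀ i, Q i (r i) (b i) := by
  induction M with
  | zero => exact Runs.sim (Runs.pure ⟨fun _ => [], by simp, fun i => i.elim0⟩)
  | succ M ih =>
    rw [List.finRange_succ, List.flatMap_cons, List.flatMap_map]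
    refine Sim.andThen ((h 0).mono fun s₁ b hb => ?_)
    refine Sim.andThen_runs ((ih fun i => h i.succ).mono ?_)
    rintro s₂ f ⟨r, rfl, hr⟩
    refine Runs.pure ⟨Fin.cons s₁ r, ?_, ?_⟩
    · simp [List.flatMap_map]
    · intro i
      refine Fin.cases ?_ (fun j => ?_) i
      · simpa using hb
      · simpa using hr j

/-- A fresh random number that is compared with a threshold. -/
lemma loss_draw_le {β : Type} {N H : ℕ} {g : Fin (N + 1) → PMF (Option β)}
    {f : β → ℝ≥0∞} {F₁ F₀ : ℝ≥0∞} (h1 : ∀ r : Fin (N + 1), (r : ℕ) < H → loss (g r) f ≤ F₁)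
    (h0 : ∀ r : Fin (N + 1), ¬ (r : ℕ) < H → loss (g r) f ≤ F₀) :
    loss ((PMF.uniformOfFintype (Fin (N + 1))).bind g) f ≤
      (min (N + 1) H : ℕ) / (N + 1 : ℕ) * F₁ + ((N + 1 - H : ℕ) : ℝ≥0∞) / (N + 1 : ℕ) * F₀ := by
  classical
  rw [loss_bind]
  have key : ∀ r : Fin (N + 1), loss (g r) f ≤ if (r : ℕ) < H then F₁ else F₀ := by
    intro r
    split_ifs with hr
    · exact h1 r hr
    · exact h0 r hr
  -- The threshold `H` may exceed the range of the random number, which explains the minimum and the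
  -- truncated difference.
  have c1 : (Finset.univ.filter fun r : Fin (N + 1) => (r : ℕ) < H).card = min (N + 1) H := by
    simpa [min_comm] using Fin.card_filter_val_lt (n := N + 1) (m := H)
  have c0 : (Finset.univ.filter fun r : Fin (N + 1) => ¬ (r : ℕ) < H).card = N + 1 - H := by
    have := Finset.card_filter_add_card_filter_not (s := (Finset.univ : Finset (Fin (N + 1))))
      (fun r : Fin (N + 1) => (r : ℕ) < H)
    simp only [Finset.card_univ, Fintype.card_fin] at this
    omega
  rw [tsum_fintype]
  calc ∑ r, PMF.uniformOfFintype (Fin (N + 1)) r * loss (g r) f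
      ≤ ∑ r : Fin (N + 1), ((N + 1 : ℕ) : ℝ≥0∞)⁻¹ * if (r : ℕ) < H then F₁ else F₀ := by
        refine Finset.sum_le_sum fun r _ => ?_
        rw [PMF.uniformOfFintype_apply, Fintype.card_fin]
        exact mul_le_mul_right (key r) _
    _ = _ := by
        rw [← Finset.mul_sum, Finset.sum_ite, Finset.sum_const, Finset.sum_const, c1, c0]
        simp only [nsmul_eq_mul, div_eq_mul_inv]
        ring

end MapReduce


namespace MapReduce

/-! ### Rules for programs -/

section Rules

variable {L : Limits} {env : Env} {s : Machine} {Q : Machine → Prop}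

lemma runs_skip (h : Q { s with steps := s.steps + 1 }) : Runs (exec L env .skip s) Q :=
  Runs.pure h

lemma runs_istore {a e : IExp} (ha : a.eval env s < L.cells) (he : e.eval env s ≤ L.maxInt)
    (h : Q { s with
      steps := s.steps + 1
      ints := Function.update s.ints (a.eval env s) (e.eval env s) }) :
    Runs (exec L env (.istore a e) s) Q :=
  Runs.check ⟨ha, he⟩ h

lemma runs_wstore {a : IExp} {e : WExp} (ha : a.eval env s < L.cells)
    (he : e.eval env s ∈ L.words)
    (h : Q { s with
      steps := s.steps + 1
      weights := Function.update s.weights (a.eval env s) (e.eval env s) }) :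
    Runs (exec L env (.wstore a e) s) Q :=
  Runs.check ⟨ha, he⟩ h

/-- The rules have weakest precondition form: the rest of the program is the postcondition of its
first command, so a proof executes the program symbolically. -/
lemma runs_seq {c d : Cmd} (h : Runs (exec L env c s) fun s' => Runs (exec L env d s') Q) :
    Runs (exec L env (.seq c d) s) Q := by
  rw [exec]
  exact Runs.andThen h

lemma runs_ite {b : Test} {c d : Cmd}
    (ht : b.eval env s → Runs (exec L env c { s with steps := s.steps + 1 }) Q)
    (hf : ¬ b.eval env s → Runs (exec L env d { s with steps := s.steps + 1 }) Q) :
    Runs (exec L env (.ite b c d) s) Q := by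
  rw [exec]
  split_ifs with hb
  · exact ht hb
  · exact hf hb

lemma runs_send {d : IExp} {f : Fin 4 → IExp} {x : WExp}
    (hf : ∀ j, (f j).eval env s ≤ L.maxInt) (hx : x.eval env s ∈ L.words)
    (h : Q { s with
      steps := s.steps + 1
      outbox := s.outbox ++ [(d.eval env s, ⟨fun j => (f j).eval env s, x.eval env s⟩)] }) :
    Runs (exec L env (.send d f x) s) Q :=
  Runs.check ⟨hf, hx⟩ h

lemma runs_output {a b : IExp} (ha : a.eval env s ≤ L.maxInt) (hb : b.eval env s ≤ L.maxInt)
    (h : Q { s with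
      steps := s.steps + 1
      result := s.result ++ [(a.eval env s, b.eval env s)] }) :
    Runs (exec L env (.output a b) s) Q :=
  Runs.check ⟨ha, hb⟩ h

lemma runs_halt (h : Q { s with steps := s.steps + 1, halted := true }) :
    Runs (exec L env .halt s) Q :=
  Runs.pure h

/-- The number of passes and the pass number do not live in the memory, so the body may overwrite
cell `k`; the invariant need not mention that cell. -/
lemma runs_loop {k N : ℕ} {e : IExp} {body : Cmd} (I : ℕ → Machine → Prop)
    (hk : k < L.cells) (hN : e.eval env s = N) (hN' : N ≤ L.maxInt)
    (h0 : I 0 { s with steps := s.steps + 1 })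
    (hs : ∀ t < N, ∀ s' : Machine, I t s' → Runs (exec L env body { s' with
      steps := s'.steps + 1
      ints := Function.update s'.ints k t }) (I (t + 1)))
    (hQ : ∀ s', I N s' → Q s') : Runs (exec L env (.loop (.lit k) e body) s) Q := by
  rw [exec, hN]
  refine (Runs.iter (I := I) h0 fun t ht b hb => Runs.andThen (Runs.check ⟨hk, by omega⟩ ?_)).mono hQ
  exact hs t ht b hb

variable {α : Type} {p q : ℝ≥0∞}

lemma sim_seq {c d : Cmd} {l₁ l₂ : List α} {Q : List α → Machine → Prop}
    (h : Sim p q (exec L env c s) l₁ fun r s' =>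
      Sim p q (exec L env d s') l₂ fun r' => Q (r ++ r')) :
    Sim p q (exec L env (.seq c d) s) (l₁ ++ l₂) Q := by
  rw [exec]
  exact Sim.andThen h

lemma runs_seq_sim {c d : Cmd} {l : List α} {Q : List α → Machine → Prop}
    (h : Runs (exec L env c s) fun s' => Sim p q (exec L env d s') l Q) :
    Sim p q (exec L env (.seq c d) s) l Q := by
  rw [exec]
  exact Runs.andThen_sim h

lemma sim_seq_runs {c d : Cmd} {l : List α} {Q : List α → Machine → Prop}
    (h : Sim p q (exec L env c s) l fun r s' => Runs (exec L env d s') (Q r)) :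
    Sim p q (exec L env (.seq c d) s) l Q := by
  rw [exec]
  exact Sim.andThen_runs h

lemma sim_ite {b : Test} {c d : Cmd} {l : List α} {Q : List α → Machine → Prop}
    (ht : b.eval env s → Sim p q (exec L env c { s with steps := s.steps + 1 }) l Q)
    (hf : ¬ b.eval env s → Sim p q (exec L env d { s with steps := s.steps + 1 }) l Q) :
    Sim p q (exec L env (.ite b c d) s) l Q := by
  rw [exec]
  split_ifs with hb
  · exact ht hb
  · exact hf hb

lemma sim_loop {k N : ℕ} {e : IExp} {body : Cmd} {l : ℕ → List α}
    {Q : List α → Machine → Prop} (I : ℕ → List α → Machine → Prop)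
    (hk : k < L.cells) (hN : e.eval env s = N) (hN' : N ≤ L.maxInt)
    (h0 : I 0 [] { s with steps := s.steps + 1 })
    (hs : ∀ t < N, ∀ r, ∀ s' : Machine, I t r s' → Sim p q (exec L env body { s' with
      steps := s'.steps + 1
      ints := Function.update s'.ints k t }) (l t) fun r' => I (t + 1) (r ++ r'))
    (hQ : ∀ r s', I N r s' → Q r s') :
    Sim p q (exec L env (.loop (.lit k) e body) s) ((List.range N).flatMap l) Q := by
  rw [exec, hN]
  refine (Sim.iter (I := I) h0 fun t ht r b hb =>
    Runs.andThen_sim (Runs.check ⟨hk, by omega⟩ ?_)).mono hQ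
  exact hs t ht r b hb

/-- A single random choice, made by comparing a random number with a threshold. -/
lemma sim_draw {k N H : ℕ} {e h : IExp} {c d : Cmd} {a : α} {Q : List α → Machine → Prop}
    (hk : k < L.cells) (hN : e.eval env s + 1 = N) (hN' : N ≤ L.maxInt)
    (hH : ∀ r, h.eval env { s with
      steps := s.steps + 1
      ints := Function.update s.ints k r } = H)
    (hp : p = (min N H : ℕ) / (N : ℕ)) (hq : q = ((N - H : ℕ) : ℝ≥0∞) / (N : ℕ))
    (hc : ∀ r, Runs (exec L env c { s with
      steps := s.steps + 1 + 1
      ints := Function.update s.ints k r }) (Q [a]))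
    (hd : ∀ r, Runs (exec L env d { s with
      steps := s.steps + 1 + 1
      ints := Function.update s.ints k r }) (Q [])) :
    Sim p q (exec L env (.seq (.draw (.lit k) e) (.ite (.ilt (.load (.lit k)) h) c d)) s)
      [a] Q := by
  intro f F hF
  rw [exec, exec, loss_andThen]
  subst hN
  have hbody : ∀ r : ℕ, loss (exec L env (.ite (.ilt (.load (.lit k)) h) c d) { s with
      steps := s.steps + 1
      ints := Function.update s.ints k r }) f ≤ if r < H then F [a] else F [] := by
    intro r
    have hev : Test.eval env { s with
      steps := s.steps + 1
      ints := Function.update s.ints k r } (.ilt (.load (.lit k)) h) ↔ r < H := by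
      simp [Test.eval, hH, IExp.eval]
    rw [exec]
    by_cases hr : r < H
    · rw [if_pos (hev.2 hr), if_pos hr]
      obtain ⟨b, hb, hQ⟩ := hc r
      simp only [Machine.tick]
      rw [hb, loss_pure]
      exact hF _ _ hQ
    · rw [if_neg (fun h => hr (hev.1 h)), if_neg hr]
      obtain ⟨b, hb, hQ⟩ := hd r
      simp only [Machine.tick]
      rw [hb, loss_pure]
      exact hF _ _ hQ
  have hst : ∀ r : Fin (e.eval env s + 1), loss (s.istore L ((IExp.lit k).eval env s) r)
      (fun a => loss (exec L env (.ite (.ilt (.load (.lit k)) h) c d) a) f) ≤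
        if (r : ℕ) < H then F [a] else F [] := by
    intro r
    have := r.2
    rw [Machine.istore, check, if_pos ⟨hk, by omega⟩, loss_pure]
    exact hbody r
  refine (loss_draw_le (H := H) (F₁ := F [a]) (F₀ := F []) ?_ ?_).trans ?_
  · intro r hr
    simpa [hr] using hst r
  · intro r hr
    simpa [hr] using hst r
  · simp only [expSub, hp, hq]
    exact le_rfl

end Rules

/-! ### Step counts and the words in packets -/

/-- All possible outcomes of `P` other than a crash satisfy `K`. -/
def Ensures {β : Type} (P : PMF (Option β)) (K : β → Prop) : Prop := ∀ b, P (some b) ≠ 0 → K b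

lemma Ensures.bind {α β : Type} {P : PMF α} {g : α → PMF (Option β)} {K : β → Prop}
    (h : ∀ a, Ensures (g a) K) : Ensures (P.bind g) K := by
  intro b hb
  rw [← PMF.mem_support_iff, PMF.mem_support_bind_iff] at hb
  obtain ⟨a, -, ha⟩ := hb
  exact h a b ((PMF.mem_support_iff _ _).1 ha)

lemma Ensures.mono {β : Type} {P : PMF (Option β)} {K K' : β → Prop} (h : Ensures P K)
    (hK : ∀ b, K b → K' b) : Ensures P K' :=
  fun b hb => hK b (h b hb)

lemma Ensures.check {β : Type} {c : Prop} {b : β} {K : β → Prop} (h : c → K b) :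
    Ensures (check c b) K := by
  intro b' hb
  rw [← PMF.mem_support_iff, MapReduce.check, PMF.mem_support_pure_iff] at hb
  split_ifs at hb with hc
  cases hb
  exact h hc

lemma Ensures.pure {β : Type} {b : β} {K : β → Prop} (h : K b) :
    Ensures (PMF.pure (some b)) K := by
  intro b' hb
  rw [← PMF.mem_support_iff, PMF.mem_support_pure_iff] at hb
  cases hb
  exact h

lemma Ensures.andThen {α β : Type} {P : PMF (Option α)} {g : α → PMF (Option β)} {K : β → Prop}
    (h : Ensures P fun a => Ensures (g a) K) : Ensures (andThen P g) K := by
  intro b hb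
  rw [← PMF.mem_support_iff, MapReduce.andThen, PMF.mem_support_bind_iff] at hb
  obtain ⟨o, ho, ha⟩ := hb
  cases o with
  | none => simp at ha
  | some a => exact h a ((PMF.mem_support_iff _ _).1 ho) b ((PMF.mem_support_iff _ _).1 ha)

lemma Ensures.iter {β : Type} {g : ℕ → β → PMF (Option β)} {N : ℕ} {s : β} {I : ℕ → β → Prop}
    (h0 : I 0 s) (hs : ∀ t b, I t b → Ensures (g t b) (I (t + 1))) :
    Ensures (iter g N s) (I N) := by
  induction N with
  | zero => exact Ensures.pure h0
  | succ N ih => exact Ensures.andThen (ih.mono fun b hb => hs N b hb)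

/-- The integer words of a packet are at most `maxInt`, and its weight is a weight word. -/
def Limits.Valid (L : Limits) (x : Packet) : Prop := (∀ j, x.field j ≤ L.maxInt) ∧ x.weight ∈ L.words

/-- The bounds of all loops are public data. -/
def Cmd.Bounded : Cmd → Prop
  | .seq c d => c.Bounded ∧ d.Bounded
  | .ite _ c d => c.Bounded ∧ d.Bounded
  | .loop _ e body => (∃ x, e = .param x) ∧ body.Bounded
  | _ => True

/-- A bound for the number of steps of a program. -/
def Cmd.cost (env : Env) : Cmd → ℕ
  | .seq c d => c.cost env + d.cost env
  | .ite _ c d => 1 + (c.cost env + d.cost env)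
  | .loop _ e body => 1 + e.eval env Machine.init * (1 + body.cost env)
  | _ => 1

/-- Neither step counts nor the sizes of sent words need the semantics of a particular program. The
loop bounds are public data, hence independent of the state, and a packet with an oversized word
crashes when it is sent. This is proved once for all commands and joined to the correctness proofs
by `Sim.and_support`. -/
lemma exec_ensures {L : Limits} {env : Env} {c : Cmd} (hc : c.Bounded) {s : Machine}
    (hs : ∀ x ∈ s.outbox, L.Valid x.2) :
    Ensures (exec L env c s) fun s' =>
      s'.steps ≤ s.steps + c.cost env ∧ ∀ x ∈ s'.outbox, L.Valid x.2 := by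
  induction c generalizing s with
  | skip => exact Ensures.pure ⟨le_rfl, hs⟩
  | istore a e => exact Ensures.check fun _ => ⟨le_rfl, hs⟩
  | wstore a e => exact Ensures.check fun _ => ⟨le_rfl, hs⟩
  | draw a e => exact Ensures.bind fun r => Ensures.check fun _ => ⟨le_rfl, hs⟩
  | seq c d ihc ihd =>
    rw [exec]
    refine Ensures.andThen ((ihc hc.1 hs).mono fun s' hs' => (ihd hc.2 hs'.2).mono fun s'' h'' => ?_)
    refine ⟨?_, h''.2⟩
    have := hs'.1
    have := h''.1
    simp only [Cmd.cost]
    omega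
  | ite b c d ihc ihd =>
    rw [exec]
    split_ifs
    · refine (ihc hc.1 (s := s.tick) hs).mono fun s' hs' => ⟨?_, hs'.2⟩
      have := hs'.1
      simp only [Cmd.cost, Machine.tick] at *
      omega
    · refine (ihd hc.2 (s := s.tick) hs).mono fun s' hs' => ⟨?_, hs'.2⟩
      have := hs'.1
      simp only [Cmd.cost, Machine.tick] at *
      omega
  | loop a e body ih =>
    obtain ⟨⟨x, rfl⟩, hb⟩ := hc
    rw [exec]
    refine (Ensures.iter (I := fun t s' => s'.steps ≤ s.steps + 1 + t * (1 + body.cost env) ∧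
      ∀ x ∈ s'.outbox, L.Valid x.2) ⟨?_, hs⟩ ?_).mono ?_
    · simp [Machine.tick]
    · rintro t s' ⟨h1, h2⟩
      refine Ensures.andThen (Ensures.check fun _ => ?_)
      refine (ih hb (by exact h2)).mono fun s'' h'' => ⟨?_, h''.2⟩
      have := h''.1
      simp only [Machine.tick] at this
      rw [Nat.add_mul]
      omega
    · rintro s' ⟨h1, h2⟩
      refine ⟨?_, h2⟩
      simp only [Cmd.cost, IExp.eval] at *
      omega
  | send d f x =>
    refine Ensures.check fun h => ⟨le_rfl, fun y hy => ?_⟩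
    rcases List.mem_append.1 hy with hy | hy
    · exact hs y hy
    · rw [List.mem_singleton.1 hy]
      exact h
  | output a b => exact Ensures.check fun _ => ⟨le_rfl, hs⟩
  | halt => exact Ensures.pure ⟨le_rfl, hs⟩

/-- The round of one machine, from the execution of its program. -/
lemma sim_work {α : Type} {p q : ℝ≥0∞} {L : Limits} {A : Cmd} {env : Env} {l : List α}
    {Q : List α → Machine → Prop} (hA : A.Bounded) (hcost : A.cost env ≤ L.maxSteps)
    (hin : env.inbox.length ≤ L.cells)
    (h : Sim p q (exec L env A Machine.init) l fun r s =>
      Q r s ∧ s.outbox.length ≤ L.cells ∧ s.result.length ≤ L.cells) :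
    Sim p q (work L A env) l fun r s => Q r s ∧ ∀ x ∈ s.outbox, L.Valid x.2 := by
  rw [work]
  refine Sim.andThen_runs ((h.and_support (exec_ensures hA (by simp [Machine.init]))).mono ?_)
  rintro r s ⟨⟨hQ, ho, hr⟩, hst, hv⟩
  refine Runs.check ⟨?_, hin, ho, hr⟩ ⟨hQ, hv⟩
  simp only [Machine.init] at hst
  omega

end MapReduce


namespace MapReduce

/-! ### Concentration for random sublists -/

section Random

variable {α : Type} {p q : ℝ≥0∞}

lemma expSub_const (h : p + q = 1) (l : List α) (c : ℝ≥0∞) : expSub p q l (fun _ => c) = c := by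
  induction l with
  | nil => rfl
  | cons a l ih => rw [expSub, ih, ← add_mul, h, one_mul]

lemma expSub_mul_right (l : List α) (F : List α → ℝ≥0∞) (c : ℝ≥0∞) :
    expSub p q l (fun s => F s * c) = expSub p q l F * c := by
  induction l generalizing F with
  | nil => rfl
  | cons a l ih =>
    rw [expSub, expSub, ih F, ih fun s => F (a :: s)]
    ring

lemma expSub_add (l : List α) (F G : List α → ℝ≥0∞) :
    expSub p q l (fun s => F s + G s) = expSub p q l F + expSub p q l G := by
  induction l generalizing F G with
  | nil => rfl
  | cons a l ih =>
    rw [expSub, expSub, expSub, ih F G, ih (fun s => F (a :: s)) fun s => G (a :: s)]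
    ring

/-- The elements with and without a property are chosen independently. -/
lemma expSub_split (P : α → Bool) (l : List α) (F : List α → List α → ℝ≥0∞) :
    expSub p q l (fun s => F (s.filter P) (s.filter fun a => !P a)) =
      expSub p q (l.filter fun a => !P a) fun s₂ =>
        expSub p q (l.filter P) fun s₁ => F s₁ s₂ := by
  induction l generalizing F with
  | nil => rfl
  | cons a l ih =>
    by_cases ha : P a = true
    · simp only [expSub, ha, List.filter_cons, Bool.not_true, if_true]
      simp only [Bool.false_eq_true, if_false]
      rw [ih F, ih fun s₁ s₂ => F (a :: s₁) s₂, expSub_add]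
      simp only [mul_comm p, mul_comm q, expSub_mul_right]
    · simp only [Bool.not_eq_true] at ha
      simp only [expSub, ha, List.filter_cons, Bool.not_false, if_true, Bool.false_eq_true,
        if_false]
      rw [ih F, ih fun s₁ s₂ => F s₁ (a :: s₂)]

lemma expSub_perm {l l' : List α} (h : l.Perm l') {F : List α → ℝ≥0∞}
    (hF : ∀ s s' : List α, s.Perm s' → F s = F s') : expSub p q l F = expSub p q l' F := by
  induction h generalizing F with
  | nil => rfl
  | cons a _ ih =>
    rw [expSub, expSub, ih hF, ih fun s s' hs => hF _ _ (hs.cons a)]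
  | swap a b l =>
    simp only [expSub]
    have : (fun s => F (a :: b :: s)) = fun s => F (b :: a :: s) := by
      ext s
      exact hF _ _ (List.Perm.swap _ _ _)
    rw [this]
    ring
  | trans _ _ ih₁ ih₂ => rw [ih₁ hF, ih₂ hF]

/-- This closes the induction in `expSub_pow_countP_le`: a chosen maximum contributes `p`, and a
dropped one contributes `q` times one extra factor `1 + p / 2`. The sum is `2 q + q p + p ≤ 2 (p +
q)`. -/
lemma two_mul_mul_add_le (h : p + q = 1) : q * ((1 + p / 2) * 2) + p ≤ 2 := by
  have h2 : (1 + p / 2) * 2 = 2 + p := by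
    rw [add_mul, ENNReal.div_mul_cancel (by norm_num) (by norm_num), one_mul]
  have hq : q ≤ 1 := h ▸ le_add_self
  calc q * ((1 + p / 2) * 2) + p = q * 2 + q * p + p := by rw [h2, mul_add]
    _ ≤ q * 2 + 1 * p + p := by gcongr
    _ = (p + q) * 2 := by ring
    _ = 2 := by rw [h, one_mul]

open Classical in
/-- The number of elements that are larger than all chosen elements has a geometric tail. -/
lemma expSub_pow_countP_le (h : p + q = 1) (g : α → ℝ) (l : List α) :
    expSub p q l (fun s => (1 + p / 2) ^ l.countP (fun a => ∀ b ∈ s, g b < g a)) ≤ 2 := by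
  -- The count does not depend on the order of the list, so sort it by decreasing `g`. If the first
  -- element is chosen, nothing exceeds it and the count is `0`; if it is dropped, the count is at
  -- most one more than that of the remaining list.
  have hperm := List.mergeSort_perm l (fun a b => decide (g b ≤ g a))
  have hsort := List.pairwise_mergeSort (le := fun a b => decide (g b ≤ g a))
    (by intro a b c; simpa using fun h1 h2 => le_trans h2 h1)
    (by intro a b; simpa using le_total (g b) (g a)) l
  rw [← expSub_perm hperm]
  · rw [show (fun s => (1 + p / 2) ^ l.countP (fun a => decide (∀ b ∈ s, g b < g a))) = fun s =>
      (1 + p / 2) ^ (l.mergeSort (fun a b => decide (g b ≤ g a))).countP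
        (fun a => decide (∀ b ∈ s, g b < g a)) from funext fun s => by rw [hperm.countP_eq]]
    generalize l.mergeSort (fun a b => decide (g b ≤ g a)) = l' at hsort
    induction l' with
    | nil => simp [expSub]
    | cons a l ih =>
      rw [List.pairwise_cons] at hsort
      have ha : ∀ b ∈ l, g b ≤ g a := fun b hb => by simpa using hsort.1 b hb
      have h0 : ∀ s : List α, (a :: l).countP (fun x => ∀ b ∈ a :: s, g b < g x) = 0 := by
        intro s
        rw [List.countP_eq_zero]
        intro x hx
        simp only [decide_eq_true_eq]
        intro hall
        have h1 := hall a List.mem_cons_self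
        rcases List.mem_cons.1 hx with rfl | hx
        · exact lt_irrefl _ h1
        · exact absurd (ha x hx) (not_le.2 h1)
      rw [expSub]
      simp only [h0, pow_zero, expSub_const h]
      have h1 : expSub p q l (fun s => (1 + p / 2) ^ (a :: l).countP (fun x => ∀ b ∈ s, g b < g x))
          ≤ (1 + p / 2) * 2 := by
        calc _ ≤ expSub p q l (fun s =>
              (1 + p / 2) ^ l.countP (fun x => ∀ b ∈ s, g b < g x) * (1 + p / 2)) := by
              refine expSub_mono fun s _ => ?_
              rw [← pow_succ]
              refine pow_le_pow_right₀ le_self_add ?_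
              rw [List.countP_cons]
              split_ifs <;> omega
          _ ≤ 2 * (1 + p / 2) := by
              rw [expSub_mul_right]
              gcongr
              exact ih hsort.2
          _ = _ := mul_comm _ _
      calc p * 1 + q * _ ≤ p * 1 + q * ((1 + p / 2) * 2) := by gcongr
        _ = q * ((1 + p / 2) * 2) + p := by ring
        _ ≤ 2 := two_mul_mul_add_le h
  · intro s s' hs
    congr 1
    refine List.countP_congr fun a _ => ?_
    simp [hs.mem_iff]

open Classical in
/-- For every class of elements, in order, count the elements that are larger than the chosen
elements of the class, when the order of each class depends on the choices in earlier classes. -/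
lemma expSub_prod_le (h : p + q = 1) (tail : α → ℕ) (g : ℕ → List α → α → ℝ)
    (hg : ∀ v s s', s.filter (fun a => tail a < v) = s'.filter (fun a => tail a < v) →
      g v s = g v s') (l : List α) (v : ℕ) :
    expSub p q l (fun s => (1 + p / 2) ^ ∑ u ∈ Finset.range v,
      (l.filter fun a => tail a = u).countP
        (fun a => ∀ b ∈ s.filter (fun a => tail a = u), g u s b < g u s a)) ≤ 2 ^ v := by
  induction v with
  | zero => simp [expSub_const h]
  | succ v ih =>
    set X : ℕ → List α → ℕ := fun u s => (l.filter fun a => tail a = u).countP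
        (fun a => ∀ b ∈ s.filter (fun a => tail a = u), g u s b < g u s a) with hX
    -- The ranking of a class `u ≤ v` ignores the choices in class `v`, by `hg`. Therefore the
    -- counts of the earlier classes are constant once the choices outside class `v` are fixed.
    have hgs : ∀ u ≤ v, ∀ s, g u s = g u (s.filter fun a => !decide (tail a = v)) := by
      intro u hu s
      apply hg
      rw [List.filter_filter]
      refine List.filter_congr fun a _ => ?_
      have : tail a < u → tail a ≠ v := by omega
      by_cases ha : tail a < u <;> simp [ha, this]
    have hXs : ∀ u < v, ∀ s, X u s = X u (s.filter fun a => !decide (tail a = v)) := by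
      intro u hu s
      simp only [hX]
      rw [← hgs u hu.le]
      refine List.countP_congr fun a _ => ?_
      simp only [List.mem_filter, decide_eq_true_eq, Bool.not_eq_true', decide_eq_false_iff_not]
      constructor
      · exact fun h b hb => h b ⟨hb.1.1, hb.2⟩
      · exact fun h b hb => h b ⟨⟨hb.1, by omega⟩, hb.2⟩
    have hsum : ∀ s, ∑ u ∈ Finset.range v, X u s =
        ∑ u ∈ Finset.range v, X u (s.filter fun a => !decide (tail a = v)) := fun s =>
      Finset.sum_congr rfl fun u hu => hXs u (Finset.mem_range.1 hu) s
    -- Condition on the choices outside class `v`. Then `g v` is a fixed function and the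
    -- single-class bound applies to the inner expectation, giving one more factor `2`.
    calc expSub p q l (fun s => (1 + p / 2) ^ ∑ u ∈ Finset.range (v + 1), X u s)
        = expSub p q l (fun s => (fun s₁ s₂ => (1 + p / 2) ^ (l.filter fun a => tail a = v).countP
            (fun a => ∀ b ∈ s₁, g v s₂ b < g v s₂ a) *
            (1 + p / 2) ^ ∑ u ∈ Finset.range v, X u s₂) (s.filter fun a => tail a = v)
              (s.filter fun a => !decide (tail a = v))) := by
          congr 1
          ext s
          rw [Finset.sum_range_succ, pow_add, mul_comm, hsum s]
          simp only [hX, ← hgs v le_rfl]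
      _ = expSub p q (l.filter fun a => !decide (tail a = v)) fun s₂ =>
            expSub p q (l.filter fun a => tail a = v) (fun s₁ =>
              (1 + p / 2) ^ (l.filter fun a => tail a = v).countP
              (fun a => ∀ b ∈ s₁, g v s₂ b < g v s₂ a)) *
              (1 + p / 2) ^ ∑ u ∈ Finset.range v, X u s₂ := by
          rw [expSub_split (fun a => decide (tail a = v)) l fun s₁ s₂ =>
            (1 + p / 2) ^ (l.filter fun a => tail a = v).countP
            (fun a => ∀ b ∈ s₁, g v s₂ b < g v s₂ a) * (1 + p / 2) ^ ∑ u ∈ Finset.range v, X u s₂]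
          simp only [expSub_mul_right]
      _ ≤ expSub p q (l.filter fun a => !decide (tail a = v)) fun s₂ =>
            (1 + p / 2) ^ (∑ u ∈ Finset.range v, X u s₂) * 2 := by
          refine expSub_mono fun s₂ _ => ?_
          rw [mul_comm _ (2 : ℝ≥0∞)]
          gcongr
          exact expSub_pow_countP_le h (g v s₂) _
      _ = expSub p q l (fun s => (1 + p / 2) ^ (∑ u ∈ Finset.range v, X u s)) * 2 := by
          have hs := expSub_split (p := p) (q := q) (fun a => decide (tail a = v)) l
            fun _ s₂ => (1 + p / 2) ^ ∑ u ∈ Finset.range v, X u s₂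
          simp only [expSub_const h] at hs
          rw [expSub_mul_right, ← hs]
          congr 2
          ext s
          rw [hsum s]
      _ ≤ 2 ^ v * 2 := by gcongr
      _ = 2 ^ (v + 1) := (pow_succ _ _).symm

/-- The exponential moment of a binomial variable at base `2`, for the Chernoff bound on the sample
size. -/
lemma expSub_two_pow_length (h : p + q = 1) (l : List α) :
    expSub p q l (fun s => 2 ^ s.length) = (1 + p) ^ l.length := by
  induction l with
  | nil => simp [expSub]
  | cons a l ih =>
    rw [expSub]
    simp only [List.length_cons, pow_succ, expSub_mul_right, ih]
    calc _ = (1 + p) ^ l.length * (p + (p + q)) := by ring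
      _ = _ := by rw [h, add_comm p 1]

-- Markov's inequality for the random variable `b ^ X`.
open Classical in
lemma expSub_indicator_le {b : ℝ≥0∞} (hb : 1 ≤ b) (hb' : b ≠ ⊤) (l : List α) (X : List α → ℕ)
    (B : ℕ) :
    expSub p q l (fun s => if B ≤ X s then 1 else 0) ≤
      expSub p q l (fun s => b ^ X s) * (b ^ B)⁻¹ := by
  rw [← expSub_mul_right]
  refine expSub_mono fun s _ => ?_
  split_ifs with hs
  · rw [← ENNReal.mul_inv_cancel (pow_ne_zero B (zero_lt_one.trans_le hb).ne')
      (ENNReal.pow_ne_top hb')]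
    gcongr
  · simp

lemma expSub_one_zero (l : List α) (F : List α → ℝ≥0∞) : expSub 1 0 l F = F l := by
  induction l generalizing F with
  | nil => rfl
  | cons a l ih => simp [expSub, ih]

end Random

end MapReduce


namespace MapReduce

/-! ### The local ratio method -/

section LocalRatio

variable {n : ℕ} (w : Sym2 (Fin n) → ℝ)

/-- The weight of an edge, reduced by the potentials of its end points. -/
noncomputable def residual (φ : ℕ → ℝ) (a : Fin n × Fin n) : ℝ := w s(a.1, a.2) - φ a.1 - φ a.2

/-- Raise the potentials of both end points of an edge by `r`. -/
noncomputable def bump (φ : ℕ → ℝ) (a : Fin n × Fin n) (r : ℝ) : ℕ → ℝ :=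
  fun x => if x = a.1 ∨ x = a.2 then φ x + r else φ x

/-- The potentials after the edges of a list are pushed on the stack, in order. -/
noncomputable def push (φ : ℕ → ℝ) : List (Fin n × Fin n) → ℕ → ℝ
  | [] => φ
  | a :: l => push (bump φ a (residual w φ a)) l

/-- All edges have positive residual weight when they are pushed. -/
def Pushable (φ : ℕ → ℝ) : List (Fin n × Fin n) → Prop
  | [] => True
  | a :: l => 0 < residual w φ a ∧ Pushable (bump φ a (residual w φ a)) l

/-- The sum of the residual weights at the times of the pushes. -/
noncomputable def pushWeight (φ : ℕ → ℝ) : List (Fin n × Fin n) → ℝ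
  | [] => 0
  | a :: l => residual w φ a + pushWeight (bump φ a (residual w φ a)) l

variable {w}

lemma residual_swap (φ : ℕ → ℝ) (a : Fin n × Fin n) : residual w φ a.swap = residual w φ a := by
  simp only [residual, Prod.fst_swap, Prod.snd_swap, Sym2.eq_swap]
  ring

lemma residual_anti {φ ψ : ℕ → ℝ} (h : φ ≤ ψ) (a : Fin n × Fin n) :
    residual w ψ a ≤ residual w φ a := by
  have h1 := h a.1
  have h2 := h a.2
  simp only [residual]
  linarith

lemma le_bump (φ : ℕ → ℝ) (a : Fin n × Fin n) {r : ℝ} (hr : 0 ≤ r) : φ ≤ bump φ a r := by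
  intro x
  simp only [bump]
  split_ifs <;> linarith

lemma push_append (φ : ℕ → ℝ) (l₁ l₂ : List (Fin n × Fin n)) :
    push w φ (l₁ ++ l₂) = push w (push w φ l₁) l₂ := by
  induction l₁ generalizing φ with
  | nil => rfl
  | cons a l ih => exact ih _

lemma pushable_append {φ : ℕ → ℝ} {l₁ l₂ : List (Fin n × Fin n)} :
    Pushable w φ (l₁ ++ l₂) ↔ Pushable w φ l₁ ∧ Pushable w (push w φ l₁) l₂ := by
  induction l₁ generalizing φ with
  | nil => simp [Pushable, push]
  | cons a l ih => simp only [List.cons_append, Pushable, push, ih, and_assoc]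

lemma le_push {φ : ℕ → ℝ} {l : List (Fin n × Fin n)} (h : Pushable w φ l) : φ ≤ push w φ l := by
  induction l generalizing φ with
  | nil => exact le_rfl
  | cons a l ih => exact (le_bump φ a h.1.le).trans (ih h.2)

lemma sum_bump (φ : ℕ → ℝ) {a : Fin n × Fin n} (ha : a.1 ≠ a.2) (r : ℝ) :
    ∑ v : Fin n, bump φ a r v = ∑ v : Fin n, φ v + 2 * r := by
  have h : ∀ v : Fin n, bump φ a r v =
      φ v + ((if v = a.1 then r else 0) + if v = a.2 then r else 0) := by
    intro v
    simp only [bump, Fin.val_inj]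
    by_cases h1 : v = a.1
    · subst h1
      simp [ha]
    · by_cases h2 : v = a.2 <;> simp [h1, h2, ha.symm]
  simp only [h, Finset.sum_add_distrib, Finset.sum_ite_eq', Finset.mem_univ, if_true]
  ring

/-- The dual side of the accounting: a push raises two potentials by the residual. For this the end
points must be distinct. -/
lemma sum_push (φ : ℕ → ℝ) {l : List (Fin n × Fin n)} (hl : ∀ a ∈ l, a.1 ≠ a.2) :
    ∑ v : Fin n, push w φ l v = ∑ v : Fin n, φ v + 2 * pushWeight w φ l := by
  induction l generalizing φ with
  | nil => simp [push, pushWeight]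
  | cons a l ih =>
    rw [push, ih _ fun b hb => hl b (List.mem_cons_of_mem _ hb),
      sum_bump φ (hl a List.mem_cons_self), pushWeight]
    ring

/-- `x` is an end point of an edge of the list. -/
def Covers (m : List (Fin n × Fin n)) (x : Fin n) : Prop := ∃ a ∈ m, x = a.1 ∨ x = a.2

open Classical in
/-- Add an edge to a matching if that is possible. -/
noncomputable def greedy (m : List (Fin n × Fin n)) (a : Fin n × Fin n) : List (Fin n × Fin n) :=
  if Covers m a.1 ∨ Covers m a.2 then m else m ++ [a]

/-- Unwind a stack, last pushed edge first. -/
noncomputable def unwind (m l : List (Fin n × Fin n)) : List (Fin n × Fin n) :=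
  l.reverse.foldl greedy m

lemma unwind_append (m l₁ l₂ : List (Fin n × Fin n)) :
    unwind m (l₁ ++ l₂) = unwind (unwind m l₂) l₁ := by
  simp [unwind, List.foldl_append]

/-- No two edges of the list have a common end point. -/
def IndepList (m : List (Fin n × Fin n)) : Prop :=
  m.Pairwise fun a b => a.1 ≠ b.1 ∧ a.1 ≠ b.2 ∧ a.2 ≠ b.1 ∧ a.2 ≠ b.2

lemma indepList_greedy {m : List (Fin n × Fin n)} (h : IndepList m) (a : Fin n × Fin n) :
    IndepList (greedy m a) := by
  unfold greedy
  split_ifs with hc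
  · exact h
  · refine List.pairwise_append.2 ⟨h, List.pairwise_singleton _ _, ?_⟩
    intro b hb c hcm
    rw [List.mem_singleton.1 hcm]
    push Not at hc
    refine ⟨fun he => hc.1 ⟨b, hb, Or.inl he.symm⟩, fun he => hc.2 ⟨b, hb, Or.inl he.symm⟩,
      fun he => hc.1 ⟨b, hb, Or.inr he.symm⟩, fun he => hc.2 ⟨b, hb, Or.inr he.symm⟩⟩

lemma mem_of_mem_greedy {m : List (Fin n × Fin n)} {a b : Fin n × Fin n} (h : b ∈ greedy m a) :
    b ∈ m ∨ b = a := by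
  unfold greedy at h
  split_ifs at h with hc
  · exact Or.inl h
  · simpa using h

lemma unwind_cons (m : List (Fin n × Fin n)) (a : Fin n × Fin n) (l : List (Fin n × Fin n)) :
    unwind m (a :: l) = greedy (unwind m l) a := by
  simp [unwind, List.foldl_append]

lemma indepList_unwind (l : List (Fin n × Fin n)) : IndepList (unwind [] l) := by
  induction l with
  | nil => exact List.Pairwise.nil
  | cons a l ih =>
    rw [unwind_cons]
    exact indepList_greedy ih a

lemma mem_of_mem_unwind {l : List (Fin n × Fin n)} {b : Fin n × Fin n} (h : b ∈ unwind [] l) :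
    b ∈ l := by
  induction l with
  | nil => simp [unwind] at h
  | cons a l ih =>
    rw [unwind_cons] at h
    rcases mem_of_mem_greedy h with h | h
    · exact List.mem_cons_of_mem _ (ih h)
    · simp [h]

lemma residual_bump_le (φ : ℕ → ℝ) (a b : Fin n × Fin n) {r : ℝ} (hr : 0 ≤ r) :
    residual w (bump φ a r) b ≤ residual w φ b :=
  residual_anti (le_bump φ a hr) b

lemma residual_bump_le_sub (φ : ℕ → ℝ) (a b : Fin n × Fin n) {r : ℝ} (hr : 0 ≤ r)
    (h : b.1 = a.1 ∨ b.1 = a.2 ∨ b.2 = a.1 ∨ b.2 = a.2) :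
    residual w (bump φ a r) b ≤ residual w φ b - r := by
  have h1 := le_bump φ a hr b.1
  have h2 := le_bump φ a hr b.2
  simp only [residual]
  rcases h with h | h | h | h <;> rw [h] at * <;>
    simp only [bump, true_or, or_true, if_true] at * <;> linarith

lemma sum_residual_bump_le (φ : ℕ → ℝ) (a : Fin n × Fin n) {r : ℝ} (hr : 0 ≤ r)
    (m : List (Fin n × Fin n)) :
    (m.map (residual w (bump φ a r))).sum ≤ (m.map (residual w φ)).sum :=
  List.sum_le_sum fun b _ => residual_bump_le φ a b hr

/-- This is the case in which unwinding rejects `a`: an edge of the matching touches `a`, so raising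
the potentials costs that edge at least `r`, and no other edge gains. -/
lemma sum_residual_bump_le_sub (φ : ℕ → ℝ) (a : Fin n × Fin n) {r : ℝ} (hr : 0 ≤ r)
    {m : List (Fin n × Fin n)} (h : Covers m a.1 ∨ Covers m a.2) :
    (m.map (residual w (bump φ a r))).sum ≤ (m.map (residual w φ)).sum - r := by
  have : ∃ b ∈ m, b.1 = a.1 ∨ b.1 = a.2 ∨ b.2 = a.1 ∨ b.2 = a.2 := by
    rcases h with ⟨b, hb, h | h⟩ | ⟨b, hb, h | h⟩ <;> exact ⟨b, hb, by simp [h]⟩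
  clear h
  obtain ⟨b, hb, h⟩ := this
  obtain ⟨m₁, m₂, rfl⟩ := List.append_of_mem hb
  have h1 := sum_residual_bump_le (w := w) φ a hr m₁
  have h2 := sum_residual_bump_le (w := w) φ a hr m₂
  have h3 := residual_bump_le_sub (w := w) φ a b hr h
  simp only [List.map_append, List.map_cons, List.sum_append, List.sum_cons]
  linarith

/-- The matching that results from unwinding the stack is as heavy as the pushes. -/
lemma pushWeight_le {φ : ℕ → ℝ} {l : List (Fin n × Fin n)} (h : Pushable w φ l) :
    pushWeight w φ l ≤ ((unwind [] l).map (residual w φ)).sum := by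
  induction l generalizing φ with
  | nil => simp [unwind, pushWeight]
  | cons a l ih =>
    rw [unwind_cons, pushWeight]
    have h2 := ih h.2
    unfold greedy
    -- If `a` is blocked, an edge already taken pays for its residual weight; otherwise `a` joins
    -- the matching and contributes this weight itself.
    split_ifs with hc
    · have := sum_residual_bump_le_sub (w := w) φ a h.1.le hc
      linarith
    · have := sum_residual_bump_le (w := w) φ a h.1.le (unwind [] l)
      simp only [List.map_append, List.sum_append, List.map_cons, List.map_nil, List.sum_cons,
        List.sum_nil]
      linarith

/-- Weak LP duality: each edge of the matching is paid by the potentials of its end points, and the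
end points of different edges are distinct. -/
lemma sum_matching_le {G : SimpleGraph (Fin n)} {φ : ℕ → ℝ} (h0 : ∀ x, 0 ≤ φ x)
    (hφ : ∀ u v : Fin n, s(u, v) ∈ G.edgeSet → residual w φ (u, v) ≤ 0)
    {T : Finset (Sym2 (Fin n))} (hT : IsMatching G T) :
    ∑ e ∈ T, w e ≤ ∑ v : Fin n, φ v := by
  have h1 : ∀ e ∈ T, w e ≤ ∑ v ∈ e.toFinset, φ v := by
    intro e he
    have hE := hT.1 e he
    induction e with
    | _ u v =>
      have hne : u ≠ v := SimpleGraph.Adj.ne hE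
      have := hφ u v hE
      rw [Sym2.toFinset_mk_eq, Finset.sum_pair hne]
      simp only [residual] at this
      linarith
  calc ∑ e ∈ T, w e ≤ ∑ e ∈ T, ∑ v ∈ e.toFinset, φ v := Finset.sum_le_sum h1
    _ = ∑ v ∈ T.biUnion Sym2.toFinset, φ v := by
        rw [Finset.sum_biUnion]
        intro e he f hf hef
        rw [Function.onFun, Finset.disjoint_left]
        intro v hv hv'
        exact hT.2 e he f hf hef v (Sym2.mem_toFinset.1 hv) (Sym2.mem_toFinset.1 hv')
    _ ≤ ∑ v : Fin n, φ v :=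
        Finset.sum_le_sum_of_subset_of_nonneg (Finset.subset_univ _) fun v _ _ => h0 v

/-- The local ratio theorem. -/
theorem isTwoApprox_unwind {G : SimpleGraph (Fin n)} {l : List (Fin n × Fin n)}
    (hl : ∀ a ∈ l, s(a.1, a.2) ∈ G.edgeSet) (hp : Pushable w 0 l)
    (hφ : ∀ u v : Fin n, s(u, v) ∈ G.edgeSet → residual w (push w 0 l) (u, v) ≤ 0) :
    IsTwoApprox G w ((unwind [] l).map fun a => ((a.1 : ℕ), (a.2 : ℕ))) := by
  classical
  have hind := indepList_unwind l
  have hmem : ∀ a ∈ unwind [] l, s(a.1, a.2) ∈ G.edgeSet := fun a ha => hl a (mem_of_mem_unwind ha)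
  have hnd : ((unwind [] l).map fun a => s(a.1, a.2)).Nodup := by
    rw [List.Nodup, List.pairwise_map]
    refine hind.imp fun {a b} hab he => ?_
    rcases Sym2.eq_iff.1 he with h | h
    · exact hab.1 h.1
    · exact hab.2.1 h.1
  refine ⟨((unwind [] l).map fun a => s(a.1, a.2)).toFinset, ?_, ⟨?_, ?_⟩, ?_⟩
  · intro x
    simp only [List.map_map, List.mem_map, List.mem_toFinset, Function.comp]
    constructor
    · rintro ⟨a, ha, rfl⟩
      exact ⟨_, ⟨a, ha, rfl⟩, rfl⟩
    · rintro ⟨_, ⟨a, ha, rfl⟩, rfl⟩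
      exact ⟨a, ha, rfl⟩
  · intro e he
    obtain ⟨a, ha, rfl⟩ := List.mem_map.1 (List.mem_toFinset.1 he)
    exact hmem a ha
  · intro e he f hf hef v hv hv'
    obtain ⟨a, ha, rfl⟩ := List.mem_map.1 (List.mem_toFinset.1 he)
    obtain ⟨b, hb, rfl⟩ := List.mem_map.1 (List.mem_toFinset.1 hf)
    have hab : a ≠ b := fun h => hef (by rw [h])
    have : Std.Symm fun a b : Fin n × Fin n =>
        a.1 ≠ b.1 ∧ a.1 ≠ b.2 ∧ a.2 ≠ b.1 ∧ a.2 ≠ b.2 :=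
      ⟨fun a b h => ⟨h.1.symm, h.2.2.1.symm, h.2.1.symm, h.2.2.2.symm⟩⟩
    have := hind.forall ha hb hab
    rcases Sym2.mem_iff.1 hv with h1 | h1 <;> rcases Sym2.mem_iff.1 hv' with h2 | h2
    · exact this.1 (h1.symm.trans h2)
    · exact this.2.1 (h1.symm.trans h2)
    · exact this.2.2.1 (h1.symm.trans h2)
    · exact this.2.2.2 (h1.symm.trans h2)
  · intro T' hT'
    -- The chain is: weight of `T'` ≤ sum of the potentials = twice the pushed weight ≤ twice the
    -- weight of the unwound matching.
    have h1 := sum_matching_le (w := w) (φ := push w 0 l) (le_push hp) hφ hT'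
    have h2 := sum_push (w := w) 0 (l := l) fun a ha => SimpleGraph.Adj.ne (hl a ha)
    have h3 := pushWeight_le hp
    rw [List.sum_toFinset _ hnd, List.map_map]
    have h4 : ((unwind [] l).map (residual w 0)).sum =
        ((unwind [] l).map (w ∘ fun a => s(a.1, a.2))).sum := by
      congr 1
      refine List.map_congr_left fun a _ => ?_
      simp [residual]
    simp only [Pi.zero_apply, Finset.sum_const_zero, zero_add] at h2
    linarith

/-! ### Weight words -/

variable {G : SimpleGraph (Fin n)}

lemma zero_mem_weightWords (W : ℕ) : (0 : ℝ) ∈ weightWords G w W := by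
  classical
  exact ⟨0, by simp, by simp⟩

lemma weightWords_mono {W W' : ℕ} (h : W ≤ W') : weightWords G w W ⊆ weightWords G w W' := by
  rintro x ⟨a, ha, hx⟩
  exact ⟨a, ha.trans (by exact_mod_cast h), hx⟩

lemma sub_mem_weightWords {W W' : ℕ} {x y : ℝ} (hx : x ∈ weightWords G w W)
    (hy : y ∈ weightWords G w W') : x - y ∈ weightWords G w (W + W') := by
  obtain ⟨a, ha, rfl⟩ := hx
  obtain ⟨b, hb, rfl⟩ := hy
  refine ⟨a - b, ?_, ?_⟩
  · push_cast
    refine le_trans ?_ (add_le_add ha hb)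
    rw [← Finset.sum_add_distrib]
    exact Finset.sum_le_sum fun e _ => abs_sub (a e) (b e)
  · rw [← Finset.sum_sub_distrib]
    refine Finset.sum_congr rfl fun e _ => ?_
    simp only [Pi.sub_apply]
    push_cast
    ring

lemma edge_mem_weightWords {e : Sym2 (Fin n)} (he : e ∈ G.edgeSet) : w e ∈ weightWords G w 1 := by
  classical
  refine ⟨Pi.single e 1, ?_, ?_⟩
  · rw [Finset.sum_eq_single e]
    · simp
    · intro f _ hf
      simp [hf]
    · intro h
      exact absurd (SimpleGraph.mem_edgeFinset.2 he) h
  · rw [Finset.sum_eq_single e]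
    · simp
    · intro f _ hf
      simp [hf]
    · intro h
      exact absurd (SimpleGraph.mem_edgeFinset.2 he) h

lemma residual_mem_weightWords {φ : ℕ → ℝ} {W : ℕ} (hφ : ∀ x, φ x ∈ weightWords G w W)
    {a : Fin n × Fin n} (ha : s(a.1, a.2) ∈ G.edgeSet) :
    residual w φ a ∈ weightWords G w (2 * W + 1) := by
  have := sub_mem_weightWords (sub_mem_weightWords (edge_mem_weightWords ha) (hφ a.1)) (hφ a.2)
  rwa [show 1 + W + W = 2 * W + 1 by ring] at this

/-- The new potential of an end point is `φ u + (w e - φ u - φ v) = w e - φ v`. Thanks to this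
cancellation the coefficient sum grows by `1` per push; adding the bounds for a potential and a
residual separately could triple it each time and would lead to exponential coefficients. -/
lemma bump_mem_weightWords {φ : ℕ → ℝ} {W : ℕ} (hφ : ∀ x, φ x ∈ weightWords G w W)
    {a : Fin n × Fin n} (ha : s(a.1, a.2) ∈ G.edgeSet) (x : ℕ) :
    bump φ a (residual w φ a) x ∈ weightWords G w (W + 1) := by
  have h1 := sub_mem_weightWords (edge_mem_weightWords ha) (hφ a.1)
  have h2 := sub_mem_weightWords (edge_mem_weightWords ha) (hφ a.2)
  rw [add_comm 1 W] at h1 h2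
  simp only [bump, residual]
  split_ifs with h
  · rcases h with rfl | rfl
    · convert h2 using 1
      ring
    · convert h1 using 1
      ring
  · exact weightWords_mono (Nat.le_succ W) (hφ x)

lemma push_mem_weightWords {φ : ℕ → ℝ} {W : ℕ} (hφ : ∀ x, φ x ∈ weightWords G w W)
    {l : List (Fin n × Fin n)} (hl : ∀ a ∈ l, s(a.1, a.2) ∈ G.edgeSet) (x : ℕ) :
    push w φ l x ∈ weightWords G w (W + l.length) := by
  induction l generalizing φ W with
  | nil => exact hφ x
  | cons a l ih =>
    have := ih (W := W + 1) (bump_mem_weightWords hφ (hl a List.mem_cons_self))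
      fun b hb => hl b (List.mem_cons_of_mem _ hb)
    rwa [show W + 1 + l.length = W + (a :: l).length by simp; ring] at this

end LocalRatio

end MapReduce


namespace MapReduce

/-! ### One phase of the algorithm -/

section Phase

variable {n : ℕ} (w : Sym2 (Fin n) → ℝ)

/-- The residual weight of an edge, if there is one. -/
noncomputable def value (φ : ℕ → ℝ) : Option (Fin n × Fin n) → ℝ
  | none => 0
  | some a => residual w φ a

open Classical in
/-- The first edge of a list that has the largest residual weight, provided that is positive. -/
noncomputable def best (φ : ℕ → ℝ) (l : List (Fin n × Fin n)) : Option (Fin n × Fin n) :=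
  l.foldl (fun b a => if value w φ b < residual w φ a then some a else b) none

open Classical in
/-- The edges that are pushed when the vertices `0, …, v - 1` in turn push their best edge in the
sample `s`. -/
noncomputable def pushed (φ : ℕ → ℝ) (s : List (Fin n × Fin n)) : ℕ → List (Fin n × Fin n)
  | 0 => []
  | v + 1 => pushed φ s v ++
      (best w (push w φ (pushed φ s v)) (s.filter fun a => (a.1 : ℕ) = v)).toList

open Classical in
/-- The edges with positive residual weight. -/
noncomputable def alive (φ : ℕ → ℝ) (l : List (Fin n × Fin n)) : List (Fin n × Fin n) :=
  l.filter fun a => 0 < residual w φ a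

/-- Every edge is an arc from each of its end points. -/
def arcs (l : List (Fin n × Fin n)) : List (Fin n × Fin n) := l.flatMap fun a => [a, a.swap]

variable {w}

lemma best_append (φ : ℕ → ℝ) (l : List (Fin n × Fin n)) (a : Fin n × Fin n) :
    best w φ (l ++ [a]) =
      if value w φ (best w φ l) < residual w φ a then some a else best w φ l := by
  simp only [best, List.foldl_append, List.foldl_cons, List.foldl_nil]
  congr

lemma best_spec (φ : ℕ → ℝ) (l : List (Fin n × Fin n)) :
    0 ≤ value w φ (best w φ l) ∧ (∀ a ∈ l, residual w φ a ≤ value w φ (best w φ l)) ∧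
      ∀ a, best w φ l = some a → a ∈ l ∧ 0 < residual w φ a := by
  induction l using List.reverseRecOn with
  | nil => simp [best, value]
  | append_singleton l a ih =>
    obtain ⟨h0, h1, h2⟩ := ih
    rw [best_append]
    split_ifs with h
    · refine ⟨h0.trans h.le, ?_, ?_⟩
      · intro b hb
        rcases List.mem_append.1 hb with hb | hb
        · exact (h1 b hb).trans h.le
        · rw [List.mem_singleton.1 hb, value]
      · intro b hb
        cases hb
        exact ⟨by simp, h0.trans_lt h⟩
    · refine ⟨h0, ?_, fun b hb => ⟨List.mem_append_left _ (h2 b hb).1, (h2 b hb).2⟩⟩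
      intro b hb
      rcases List.mem_append.1 hb with hb | hb
      · exact h1 b hb
      · rw [List.mem_singleton.1 hb]
        exact not_lt.1 h

lemma pushable_pushed (φ : ℕ → ℝ) (s : List (Fin n × Fin n)) (v : ℕ) :
    Pushable w φ (pushed w φ s v) := by
  induction v with
  | zero => trivial
  | succ v ih =>
    rw [pushed, pushable_append]
    refine ⟨ih, ?_⟩
    have := (best_spec (w := w) (push w φ (pushed w φ s v))
      (s.filter fun a => (a.1 : ℕ) = v)).2.2
    cases hb : best w (push w φ (pushed w φ s v)) (s.filter fun a => (a.1 : ℕ) = v) with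
    | none => trivial
    | some a => exact ⟨(this a hb).2, trivial⟩

lemma mem_of_mem_pushed {φ : ℕ → ℝ} {s : List (Fin n × Fin n)} {v : ℕ} {a : Fin n × Fin n}
    (h : a ∈ pushed w φ s v) : a ∈ s := by
  induction v with
  | zero => simp [pushed] at h
  | succ v ih =>
    rw [pushed] at h
    rcases List.mem_append.1 h with h | h
    · exact ih h
    · rw [Option.mem_toList] at h
      exact List.mem_of_mem_filter ((best_spec _ _).2.2 a h).1

lemma length_pushed_le (φ : ℕ → ℝ) (s : List (Fin n × Fin n)) (v : ℕ) :
    (pushed w φ s v).length ≤ v := by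
  induction v with
  | zero => simp [pushed]
  | succ v ih =>
    rw [pushed, List.length_append]
    have : (best w (push w φ (pushed w φ s v)) (s.filter fun a => (a.1 : ℕ) = v)).toList.length
        ≤ 1 := by
      cases best w (push w φ (pushed w φ s v)) (s.filter fun a => (a.1 : ℕ) = v) <;> simp
    omega

lemma push_pushed_mono (φ : ℕ → ℝ) (s : List (Fin n × Fin n)) {u v : ℕ} (h : u ≤ v) :
    push w φ (pushed w φ s u) ≤ push w φ (pushed w φ s v) := by
  induction v, h using Nat.le_induction with
  | base => exact le_rfl
  | succ v _ ih =>
    have := pushable_pushed (w := w) φ s (v + 1)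
    rw [pushed, pushable_append] at this
    rw [pushed, push_append]
    exact ih.trans (le_push this.2)

/-- This is hypothesis `hg` of `expSub_prod_le` for the algorithm: before the turn of `v`, only arcs
with a smaller tail have been looked at. -/
lemma pushed_congr (φ : ℕ → ℝ) {s s' : List (Fin n × Fin n)} {v : ℕ}
    (h : s.filter (fun a => (a.1 : ℕ) < v) = s'.filter fun a => (a.1 : ℕ) < v) :
    pushed w φ s v = pushed w φ s' v := by
  induction v with
  | zero => rfl
  | succ v ih =>
    have h1 : s.filter (fun a => (a.1 : ℕ) < v) = s'.filter fun a => (a.1 : ℕ) < v := by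
      have := congrArg (List.filter fun a => (a.1 : ℕ) < v) h
      rw [List.filter_filter, List.filter_filter] at this
      convert this using 2 <;>
      · ext a
        by_cases ha : (a.1 : ℕ) < v
        · simp [ha, ha.trans (Nat.lt_succ_self v)]
        · simp [ha]
    have h2 : s.filter (fun a => (a.1 : ℕ) = v) = s'.filter fun a => (a.1 : ℕ) = v := by
      have := congrArg (List.filter fun a => (a.1 : ℕ) = v) h
      rw [List.filter_filter, List.filter_filter] at this
      convert this using 2 <;>
      · ext a
        by_cases ha : (a.1 : ℕ) = v <;> simp [ha]
    rw [pushed, pushed, ih h1]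
    congr 4

/-- After the turn of a vertex, the remaining edges at this vertex are better than all sampled
ones. -/
lemma lt_of_residual_pos (φ : ℕ → ℝ) (s : List (Fin n × Fin n)) {a b : Fin n × Fin n}
    (ha : 0 < residual w (push w φ (pushed w φ s (a.1 + 1))) a) (hb : b ∈ s)
    (hab : (b.1 : ℕ) = a.1) :
    residual w (push w φ (pushed w φ s a.1)) b < residual w (push w φ (pushed w φ s a.1)) a := by
  classical
  rw [pushed, push_append] at ha
  set ψ := push w φ (pushed w φ s a.1)
  obtain ⟨h0, h1, h2⟩ := best_spec (w := w) ψ (s.filter fun x => (x.1 : ℕ) = a.1)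
  have hle := h1 b (List.mem_filter.2 ⟨hb, by simpa using hab⟩)
  -- If nothing is pushed, the sampled arcs have nonpositive residual weight. If `c` is pushed, `a`
  -- shares its tail and loses at least the residual of `c`, which is at least that of `b`; for `a`
  -- to stay positive it must have been larger than `b`.
  cases hbest : best w ψ (s.filter fun x => (x.1 : ℕ) = a.1) with
  | none =>
    rw [hbest] at ha hle
    exact lt_of_le_of_lt hle ha
  | some c =>
    rw [hbest] at ha hle
    obtain ⟨hc, hpos⟩ := h2 c hbest
    have hca : c.1 = a.1 := Fin.ext (by simpa using (List.mem_filter.1 hc).2)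
    have := residual_bump_le_sub (w := w) ψ c a hpos.le (Or.inl hca.symm)
    simp only [Option.toList_some, push] at ha
    simp only [value] at hle
    linarith

lemma countP_le_countP_arcs (P : Fin n × Fin n → Bool) (l : List (Fin n × Fin n)) :
    l.countP P ≤ (arcs l).countP P := by
  induction l with
  | nil => simp
  | cons a l ih =>
    simp only [arcs, List.flatMap_cons, List.countP_append, List.countP_cons] at *
    omega

lemma length_arcs (l : List (Fin n × Fin n)) : (arcs l).length = 2 * l.length := by
  induction l with
  | nil => rfl
  | cons a l ih =>
    simp only [arcs, List.flatMap_cons, List.length_append, List.length_cons,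
      List.length_nil] at *
    omega

lemma length_eq_sum_filter (l : List (Fin n × Fin n)) :
    l.length = ∑ u ∈ Finset.range n, (l.filter fun a => (a.1 : ℕ) = u).length := by
  induction l with
  | nil => simp
  | cons a l ih =>
    have : ∀ u : ℕ, ((a :: l).filter fun a => (a.1 : ℕ) = u).length =
        (l.filter fun a => (a.1 : ℕ) = u).length + if (a.1 : ℕ) = u then 1 else 0 := by
      intro u
      rw [List.filter_cons]
      by_cases h : (a.1 : ℕ) = u <;> simp [h]
    simp only [this, Finset.sum_add_distrib, ← ih, Finset.sum_ite_eq, Finset.mem_range, a.1.2,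
      if_true, List.length_cons]

open Classical in
/-- The number of arcs with tail `u` that are better than all sampled ones when it is the turn
of `u`. -/
noncomputable def excess (w : Sym2 (Fin n) → ℝ) (φ : ℕ → ℝ) (l s : List (Fin n × Fin n)) (u : ℕ) :
    ℕ :=
  (l.filter fun a => (a.1 : ℕ) = u).countP fun a => ∀ b ∈ s.filter (fun a => (a.1 : ℕ) = u),
    residual w (push w φ (pushed w φ s u)) b < residual w (push w φ (pushed w φ s u)) a

/-- Each surviving edge is charged to the vertex written first. It was positive already at the end
of this vertex's turn because potentials only grow, so at that turn it beat every sampled arc there.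
-/
lemma length_alive_le (φ : ℕ → ℝ) (E s : List (Fin n × Fin n)) :
    (alive w (push w φ (pushed w φ s n)) E).length ≤
      ∑ u ∈ Finset.range n, excess w φ (arcs (alive w φ E)) s u := by
  classical
  rw [length_eq_sum_filter]
  refine Finset.sum_le_sum fun u hu => ?_
  have hu := Finset.mem_range.1 hu
  rw [excess, List.countP_filter]
  refine le_trans ?_ (countP_le_countP_arcs _ _)
  rw [alive, alive, List.filter_filter, ← List.countP_eq_length_filter, List.countP_filter]
  refine List.countP_mono_left fun a _ ha => ?_
  simp only [Bool.and_eq_true, decide_eq_true_eq, List.mem_filter, and_imp] at ha ⊢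
  obtain ⟨h1, h2⟩ := ha
  subst h1
  refine ⟨⟨fun b hb hba => ?_, rfl⟩, ?_⟩
  · refine lt_of_residual_pos φ s ?_ hb hba
    exact h2.trans_le (residual_anti (push_pushed_mono φ s hu) a)
  · exact h2.trans_le (residual_anti (le_push (pushable_pushed φ s n)) a)

lemma excess_self (φ : ℕ → ℝ) (l : List (Fin n × Fin n)) (u : ℕ) : excess w φ l l u = 0 := by
  classical
  rw [excess, List.countP_eq_zero]
  intro a ha h
  exact lt_irrefl _ (of_decide_eq_true h a ha)

lemma one_add_mul_le_pow_ennreal (x : ℝ≥0∞) (m : ℕ) : 1 + m * x ≤ (1 + x) ^ m := by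
  induction m with
  | zero => simp
  | succ m ih =>
    calc 1 + ((m + 1 : ℕ) : ℝ≥0∞) * x ≤ (1 + m * x) * (1 + x) := by
          push_cast
          calc 1 + ((m : ℝ≥0∞) + 1) * x ≤ 1 + ((m : ℝ≥0∞) + 1) * x + m * x * x := le_self_add
            _ = _ := by ring
      _ ≤ (1 + x) ^ m * (1 + x) := by gcongr
      _ = _ := (pow_succ _ _).symm

/-- By Bernoulli's inequality, `m ≥ 2 N / η` factors `1 + η / (2 N)` multiply to at least `2`. This
converts the moment bound in base `1 + p / 2` to base `2`. -/
lemma two_pow_le_one_add_pow {N η m k : ℕ} (hN : 0 < N) (hm : 2 * N ≤ m * η) :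
    (2 : ℝ≥0∞) ^ k ≤ (1 + (η : ℝ≥0∞) / N / 2) ^ (m * k) := by
  rw [pow_mul]
  gcongr
  refine le_trans ?_ (one_add_mul_le_pow_ennreal _ m)
  have hN0 : ((2 * N : ℕ) : ℝ≥0∞) ≠ 0 := by simpa using hN.ne'
  have : (1 : ℝ≥0∞) ≤ m * ((η : ℝ≥0∞) / N / 2) := by
    calc (1 : ℝ≥0∞) = (2 * N : ℕ) / (2 * N : ℕ) :=
          (ENNReal.div_self hN0 (ENNReal.natCast_ne_top _)).symm
      _ ≤ (m * η : ℕ) / (2 * N : ℕ) := by gcongr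
      _ = _ := by
          push_cast
          rw [div_eq_mul_inv, div_eq_mul_inv, div_eq_mul_inv,
            ENNReal.mul_inv (Or.inl (by norm_num)) (Or.inl (by norm_num))]
          ring
  calc (2 : ℝ≥0∞) = 1 + 1 := by norm_num
    _ ≤ _ := by gcongr

/-- The left side is at most `exp (2 η)`, and `e ^ 2 < 8`. The exponent is the number of arcs of `N`
edges. -/
lemma one_add_pow_le_eight_pow {N η : ℕ} (hN : 0 < N) :
    (1 + (η : ℝ≥0∞) / N) ^ (2 * N) ≤ 8 ^ η := by
  have hN' : (0 : ℝ) < N := by exact_mod_cast hN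
  have h1 : (η : ℝ≥0∞) / N = ENNReal.ofReal (η / N) := by
    rw [ENNReal.ofReal_div_of_pos hN', ENNReal.ofReal_natCast, ENNReal.ofReal_natCast]
  have h2 : (1 + (η : ℝ) / N) ^ (2 * N) ≤ 8 ^ η := by
    calc (1 + (η : ℝ) / N) ^ (2 * N) ≤ Real.exp (η / N) ^ (2 * N) := by
          gcongr
          rw [add_comm]
          exact Real.add_one_le_exp _
      _ = (Real.exp 1 ^ 2) ^ η := by
          rw [← Real.exp_nat_mul, ← Real.exp_nat_mul, ← Real.exp_nat_mul]
          congr 1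
          push_cast
          field_simp
      _ ≤ 8 ^ η := by
          gcongr
          have := Real.exp_one_lt_d9
          have h0 := Real.exp_pos 1
          nlinarith
  rw [h1, ← ENNReal.ofReal_one, ← ENNReal.ofReal_add zero_le_one (by positivity),
    ← ENNReal.ofReal_pow (by positivity)]
  refine (ENNReal.ofReal_le_ofReal h2).trans ?_
  rw [ENNReal.ofReal_pow (by norm_num)]
  norm_num

lemma pow_mul_inv_mul_pow {a b : ℝ≥0∞} (h0 : a ≠ 0) (h1 : a ≠ ⊤) (k : ℕ) :
    a ^ k * ((a * b) ^ k)⁻¹ = (b ^ k)⁻¹ := by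
  have h0' := pow_ne_zero k h0
  have h1' := ENNReal.pow_ne_top (n := k) h1
  rw [mul_pow, ENNReal.mul_inv (Or.inl h0') (Or.inl h1'), ← mul_assoc,
    ENNReal.mul_inv_cancel h0' h1', one_mul]

/-- The sample is not too large, and the number of edges shrinks as expected. -/
def GoodSample (w : Sym2 (Fin n) → ℝ) (φ : ℕ → ℝ) (E : List (Fin n × Fin n)) (S : ℕ)
    (s : List (Fin n × Fin n)) : Prop :=
  s.length ≤ 256 * S ∧
  (alive w (push w φ (pushed w φ s n)) E).length * (2 * S) ≤ (alive w φ E).length * n ∧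
  ((alive w φ E).length ≤ 64 * S → (alive w (push w φ (pushed w φ s n)) E).length = 0)

/-- The weight `p` of the random sublists of a phase, and the weight `q`. -/
noncomputable def keepProb (N S : ℕ) : ℝ≥0∞ := (min N (64 * S) : ℕ) / (N : ℕ)

noncomputable def dropProb (N S : ℕ) : ℝ≥0∞ := (N - 64 * S : ℕ) / (N : ℕ)

lemma keepProb_add_dropProb {N S : ℕ} (hN : 0 < N) : keepProb N S + dropProb N S = 1 := by
  rw [keepProb, dropProb, ENNReal.div_add_div_same, ← Nat.cast_add,
    show min N (64 * S) + (N - 64 * S) = N by omega]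
  exact ENNReal.div_self (by simpa using hN.ne') (ENNReal.natCast_ne_top _)

-- For `N ≤ 64 S` the whole list is sampled and no arc exceeds itself. For larger `N` there are two
-- bad events, each of probability at most `32 ^ (-n)`. A total excess of `6 n m` costs `2 ^ n / 2 ^
-- (6 n)`, and a sample of size `256 S` costs `8 ^ (64 S) / 2 ^ (256 S) = 2 ^ (-64 S)`, where `n ≤
-- S`.
open Classical in
lemma expSub_not_goodSample_le {φ : ℕ → ℝ} {E : List (Fin n × Fin n)} {S : ℕ} (hS : n ≤ S)
    (hE : 0 < (alive w φ E).length) :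
    expSub (keepProb (alive w φ E).length S) (dropProb (alive w φ E).length S)
      (arcs (alive w φ E)) (fun s => if GoodSample w φ E S s then 0 else 1) ≤
      2 * (32 ^ n)⁻¹ := by
  set N := (alive w φ E).length with hN
  set l := arcs (alive w φ E) with hl
  have hpq := keepProb_add_dropProb (S := S) hE
  rcases le_or_gt N (64 * S) with hNS | hNS
  · have hp : keepProb N S = 1 := by
      rw [keepProb, min_eq_left hNS]
      exact ENNReal.div_self (by simpa using hE.ne') (ENNReal.natCast_ne_top _)
    have hq : dropProb N S = 0 := by
      rw [dropProb, Nat.sub_eq_zero_of_le hNS]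
      simp
    rw [hp, hq, expSub_one_zero]
    have h0 : (alive w (push w φ (pushed w φ l n)) E).length = 0 := by
      have := length_alive_le (w := w) φ E l
      simpa [← hl, excess_self] using this
    have hg : GoodSample w φ E S l := by
      refine ⟨?_, ?_, fun _ => h0⟩
      · rw [hl, length_arcs]
        omega
      · rw [h0]
        simp
    simp [hg]
  · have hp : keepProb N S = (64 * S : ℕ) / (N : ℕ) := by
      rw [keepProb, min_eq_right hNS.le]
    -- With this `m` the power `(1 + p / 2) ^ m` is at least `2`, while `m * (64 S) ≤ 3 N` because
    -- `64 S < N`. Fewer than `6 n m` survivors then give `64 S N' ≤ 18 N n`, which is stronger than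
    -- `2 S N' ≤ N n`.
    set m := 2 * N / (64 * S) + 1 with hm
    have hnS : 64 * n ≤ 64 * S := by omega
    have hmN : 2 * N ≤ m * (64 * S) := by
      rw [hm, mul_comm _ (64 * S)]
      rcases Nat.eq_zero_or_pos (64 * S) with h | h
      · have : n = 0 := by omega
        exfalso
        have h1 : alive w φ E ≠ [] := by
          intro h
          rw [h] at hN
          simp at hN
          omega
        obtain ⟨a, -⟩ := List.exists_mem_of_ne_nil _ h1
        subst this
        exact a.1.elim0
      · exact (Nat.lt_mul_div_succ (2 * N) h).le
    have hmN' : m * (64 * S) ≤ 3 * N := by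
      have := Nat.div_mul_le_self (2 * N) (64 * S)
      rw [hm, add_mul]
      omega
    have hbad : ∀ s, (if GoodSample w φ E S s then (0 : ℝ≥0∞) else 1) ≤
        (if m * (6 * n) ≤ ∑ u ∈ Finset.range n, excess w φ l s u then 1 else 0) +
        if 256 * S ≤ s.length then 1 else 0 := by
      intro s
      by_cases h1 : m * (6 * n) ≤ ∑ u ∈ Finset.range n, excess w φ l s u
      · split_ifs <;> simp
      by_cases h2 : 256 * S ≤ s.length
      · split_ifs <;> simp
      have hg : GoodSample w φ E S s := by
        refine ⟨by omega, ?_, fun h => absurd h (not_le.2 hNS)⟩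
        have h3 := length_alive_le (w := w) φ E s
        rw [← hl] at h3
        rw [← hN]
        push Not at h1
        set N' := (alive w (push w φ (pushed w φ s n)) E).length
        have h4 : N' ≤ m * (6 * n) := by omega
        have h5 : N' * (64 * S) ≤ m * (64 * S) * (6 * n) :=
          (Nat.mul_le_mul_right _ h4).trans (le_of_eq (by ring))
        have h6 : m * (64 * S) * (6 * n) ≤ 3 * N * (6 * n) := Nat.mul_le_mul_right _ hmN'
        nlinarith
      simp [hg]
    refine (expSub_mono fun s _ => hbad s).trans ?_
    rw [expSub_add, two_mul]
    refine add_le_add ?_ ?_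
    · have hb : (1 : ℝ≥0∞) ≤ 1 + keepProb N S / 2 := le_self_add
      have hb' : 1 + keepProb N S / 2 ≠ ⊤ := by
        have : keepProb N S ≠ ⊤ := by
          refine ne_top_of_le_ne_top ENNReal.one_ne_top ?_
          rw [← hpq]
          exact le_self_add
        exact ENNReal.add_ne_top.2 ⟨ENNReal.one_ne_top, ENNReal.div_ne_top this (by norm_num)⟩
      refine (expSub_indicator_le hb hb' l _ _).trans ?_
      have h1 : expSub (keepProb N S) (dropProb N S) l
          (fun s => (1 + keepProb N S / 2) ^ ∑ u ∈ Finset.range n, excess w φ l s u) ≤ 2 ^ n := by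
        have := expSub_prod_le hpq (fun a : Fin n × Fin n => (a.1 : ℕ))
          (fun v s => residual w (push w φ (pushed w φ s v)))
          (fun v s s' h => by rw [pushed_congr φ h]) l n
        simp only [excess]
        convert this
      have h2 : (2 : ℝ≥0∞) ^ (6 * n) ≤ (1 + keepProb N S / 2) ^ (m * (6 * n)) := by
        rw [hp]
        exact two_pow_le_one_add_pow hE hmN
      calc _ ≤ 2 ^ n * ((2 : ℝ≥0∞) ^ (6 * n))⁻¹ := mul_le_mul' h1 (ENNReal.inv_le_inv.2 h2)
        _ = (32 ^ n)⁻¹ := by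
          rw [pow_mul 2 6 n, show (2 : ℝ≥0∞) ^ 6 = 2 * 32 by norm_num,
            pow_mul_inv_mul_pow two_ne_zero (by simp)]
    · refine (expSub_indicator_le (b := 2) (by norm_num) (by simp) l List.length _).trans ?_
      rw [expSub_two_pow_length hpq, hl, length_arcs, hp]
      calc _ ≤ (8 : ℝ≥0∞) ^ (64 * S) * (2 ^ (256 * S))⁻¹ :=
            mul_le_mul' (one_add_pow_le_eight_pow hE) le_rfl
        _ = (2 ^ (64 * S))⁻¹ := by
          rw [show 256 * S = 4 * (64 * S) by ring, pow_mul 2 4 (64 * S),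
            show (2 : ℝ≥0∞) ^ 4 = 8 * 2 by norm_num, pow_mul_inv_mul_pow (by simp) (by simp)]
        _ ≤ (2 ^ (5 * n))⁻¹ := by
          refine ENNReal.inv_le_inv.2 (pow_le_pow_right₀ (by norm_num) (by omega))
        _ = _ := by
          rw [pow_mul 2 5 n, show (2 : ℝ≥0∞) ^ 5 = 32 by norm_num]

end Phase

end MapReduce


namespace MapReduce

/-! ### The program

The fourth word of a packet is its kind: `0` is an edge with its residual weight, `1` the number of
edges of a machine, `2` a sampled arc, `3` a change of a potential, `4` an edge on the stack, `5` an
edge of the matching, and `6` the number of the layer of the stack that is unwound next. -/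

/-- The number of the current packet. -/
def it : IExp := .load (.lit 0)

/-- A word of the current packet. -/
def fld (j : Fin 4) : IExp := .inbox j it

def isKind (k : ℕ) : Test := .ieq (fld 3) (.lit k)

/-- A variable. -/
def var (k : ℕ) : IExp := .load (.lit k)

def whenever (b : Test) (c : Cmd) : Cmd := .ite b c .skip

def forInbox (body : Cmd) : Cmd := .loop (.lit 0) (.param .inboxLength) body

/-- Send the current packet to oneself. -/
def forward : Cmd := .send (.param .self) (fun j => fld j) (.inbox it)

/-- The weight of a packet, reduced by the potentials of its end points. -/
def reduced (t : IExp) : WExp :=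
  .sub (.sub (.inbox t) (.load (.inbox 0 t))) (.load (.inbox 1 t))

/-- Integer cell `2` becomes one more than the announced layer, so that `0` is left to mean that the
stack is not yet being unwound. -/
def scanMode : Cmd := forInbox (whenever (isKind 6) (.istore (.lit 2) (.add (fld 0) (.lit 1))))

/-- Stored weights are already reduced by the previous potentials, so packets of kind `3` carry only
the changes. The number of surviving edges goes to every machine because the sampling probability
depends on the total. -/
def reduceRound : Cmd :=
  .seq (forInbox (whenever (isKind 3) (.wstore (fld 0) (.inbox it))))
  (.seq (forInbox (.ite (isKind 0)
      (whenever (.wlt .zero (reduced it))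
        (.seq (.istore (.lit 2) (.add (var 2) (.lit 1)))
          (.send (.param .self) ![fld 0, fld 1, .lit 0, .lit 0] (reduced it))))
      (whenever (isKind 4) forward)))
    (.loop (.lit 1) (.param .machines)
      (.send (var 1) ![var 2, .lit 0, .lit 0, .lit 1] .zero)))

/-- Send an arc with probability `64 S / N`, where `N` is the content of the variable `2`. -/
def flip (f : Fin 4 → IExp) : Cmd :=
  .seq (.draw (.lit 3) (.sub (var 2) (.lit 1)))
    (.ite (.ilt (.load (.lit 3)) (.mul (.lit 64) (.param .capacity)))
      (.send (.lit 0) f (.inbox it)) .skip)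

/-- The number of the current phase. -/
def phase : IExp := .div (.param .round) (.lit 4)

/-- All machines compute the same total `N` in cell `2`. When it is `0`, each tells itself to unwind
from the last filled layer; in phase `0` the truncated subtraction names layer `0`, which is empty.
-/
def sampleRound : Cmd :=
  .seq (forInbox (whenever (isKind 1) (.istore (.lit 2) (.add (var 2) (fld 0)))))
  (.seq (forInbox (.ite (isKind 0)
      (.seq forward
        (.seq (flip ![fld 0, fld 1, .lit 0, .lit 2]) (flip ![fld 1, fld 0, .lit 0, .lit 2])))
      (whenever (isKind 4) forward)))
    (whenever (.ieq (var 2) (.lit 0))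
      (.send (.param .self) ![.sub phase (.lit 1), .lit 0, .lit 0, .lit 6] .zero)))

/-- The number of the best packet so far. -/
def bestPacket : IExp := .sub (var 2) (.lit 1)

/-- On machine `0`, weight cells below `n` hold the changes of the potentials in this phase, and
weight cell `n` holds the best residual weight of the current search. Integer cell `2` is one more
than the position of the best packet, or `0`. The finished layer goes to the machine with the number
of the phase, and the changes are spread over all machines by residue. -/
def pushRound : Cmd :=
  .seq (forInbox (whenever (.not (.and (.not (isKind 0)) (.not (isKind 4)))) forward))
  (whenever (.ieq (.param .self) (.lit 0))
    (.seq (.loop (.lit 1) (.param .vertices)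
      (.seq (.istore (.lit 2) (.lit 0))
      (.seq (.wstore (.param .vertices) .zero)
      (.seq (forInbox (whenever (.and (isKind 2) (.and (.ieq (fld 0) (var 1))
          (.wlt (.load (.param .vertices)) (reduced it))))
        (.seq (.istore (.lit 2) (.add it (.lit 1))) (.wstore (.param .vertices) (reduced it)))))
      (whenever (.ilt (.lit 0) (var 2))
        (.seq (.send phase ![.inbox 0 bestPacket, .inbox 1 bestPacket, .lit 0, .lit 4] .zero)
        (.seq (.wstore (.inbox 0 bestPacket)
          (.add (.load (.inbox 0 bestPacket)) (.load (.param .vertices))))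
        (.wstore (.inbox 1 bestPacket)
          (.add (.load (.inbox 1 bestPacket)) (.load (.param .vertices)))))))))))
    (.loop (.lit 1) (.param .vertices)
      (.send (.mod (var 1) (.param .machines)) ![var 1, .lit 0, .lit 0, .lit 3]
        (.load (var 1))))))

/-- A single machine cannot send `n` changes to each of `M` machines within its space. A machine
that holds about `n / M` of them can broadcast its share with `O(n + M)` packets. -/
def relayRound : Cmd :=
  forInbox (.ite (isKind 3)
    (.loop (.lit 1) (.param .machines) (.send (var 1) (fun j => fld j) (.inbox it))) forward)

/-- Add the current edge to the matching. -/
def take : Cmd :=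
  .seq (.istore (.add (.lit 4) (fld 0)) (.lit 1))
  (.seq (.istore (.add (.lit 4) (fld 1)) (.lit 1))
  (.seq (.output (fld 0) (fld 1))
    (.send (.sub (var 2) (.lit 2)) ![fld 0, fld 1, .lit 0, .lit 5] .zero)))

/-- Integer cell `4 + v` flags that `v` is covered. The inbox is read backwards because the stack is
last in, first out. Results of earlier rounds are discarded by the model, so each machine outputs
the whole matching and only the output in the halting round counts. -/
def unwindRound : Cmd :=
  .seq (.ite (.ieq (.param .self) (.sub (var 2) (.lit 1)))
    (.seq (forInbox (whenever (isKind 5) take))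
    (.seq (.loop (.lit 1) (.param .inboxLength)
      (.seq (.istore (.lit 0) (.sub (.sub (.param .inboxLength) (.lit 1)) (var 1)))
        (whenever (.and (isKind 4) (.and (.ieq (.load (.add (.lit 4) (fld 0))) (.lit 0))
          (.ieq (.load (.add (.lit 4) (fld 1))) (.lit 0)))) take)))
    (whenever (.ieq (var 2) (.lit 1)) .halt)))
    (forInbox (whenever (isKind 4) forward)))
  (.send (.param .self) ![.sub (var 2) (.lit 2), .lit 0, .lit 0, .lit 6] .zero)

/-- The algorithm. -/
def matchingProgram : Cmd :=
  .seq scanMode (.ite (.ilt (.lit 0) (var 2)) unwindRound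
    (.ite (.ieq (.mod (.param .round) (.lit 4)) (.lit 0)) reduceRound
    (.ite (.ieq (.mod (.param .round) (.lit 4)) (.lit 1)) sampleRound
    (.ite (.ieq (.mod (.param .round) (.lit 4)) (.lit 2)) pushRound relayRound))))

lemma matchingProgram_bounded : matchingProgram.Bounded := by
  simp [matchingProgram, scanMode, unwindRound, reduceRound, sampleRound, pushRound, relayRound,
    take, whenever, forInbox, forward, flip, Cmd.Bounded]

/-- No loops are nested deeper than two: vertices over inbox in the push round, inbox over machines
in the relay round. -/
lemma matchingProgram_cost {env : Env} {B : ℕ} (hB : 1 ≤ B) (h1 : env.param .vertices ≤ B)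
    (h2 : env.param .machines ≤ B) (h3 : env.param .inboxLength ≤ B) :
    matchingProgram.cost env ≤ 200 * B ^ 2 := by
  simp only [matchingProgram, scanMode, unwindRound, reduceRound, sampleRound, pushRound,
    relayRound, take, whenever, forInbox, forward, flip, Cmd.cost, IExp.eval]
  generalize env.param .vertices = x at *
  generalize env.param .machines = y at *
  generalize env.param .inboxLength = z at *
  have h4 : x * z ≤ B ^ 2 := by rw [sq]; gcongr
  have h5 : z * y ≤ B ^ 2 := by rw [sq]; gcongr
  have h6 : B ≤ B ^ 2 := by nlinarith
  nlinarith

/-! ### Inboxes and outboxes by kinds -/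

/-- The packets of a kind. -/
def ofKind (k : ℕ) (l : List Packet) : List Packet := l.filter fun p => p.field 3 = k

/-- The packets of a kind that are sent to machine `j`. -/
def pick (k j : ℕ) (o : List (ℕ × Packet)) : List Packet :=
  (o.filter fun x => x.1 = j ∧ x.2.field 3 = k).map Prod.snd

lemma ofKind_append (k : ℕ) (l₁ l₂ : List Packet) :
    ofKind k (l₁ ++ l₂) = ofKind k l₁ ++ ofKind k l₂ := List.filter_append ..

lemma ofKind_cons (k : ℕ) (p : Packet) (l : List Packet) :
    ofKind k (p :: l) = if p.field 3 = k then p :: ofKind k l else ofKind k l := by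
  simp [ofKind, List.filter_cons]

lemma ofKind_nil (k : ℕ) : ofKind k [] = [] := rfl

lemma ofKind_concat (k : ℕ) (p : Packet) (l : List Packet) :
    ofKind k (l ++ [p]) = if p.field 3 = k then ofKind k l ++ [p] else ofKind k l := by
  rw [ofKind_append, ofKind_cons, ofKind_nil]
  split_ifs <;> simp

lemma mem_ofKind {k : ℕ} {p : Packet} {l : List Packet} :
    p ∈ ofKind k l ↔ p ∈ l ∧ p.field 3 = k := by
  simp [ofKind]

lemma pick_nil (k j : ℕ) : pick k j [] = [] := rfl

lemma pick_append (k j : ℕ) (o₁ o₂ : List (ℕ × Packet)) :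
    pick k j (o₁ ++ o₂) = pick k j o₁ ++ pick k j o₂ := by
  simp [pick]

lemma pick_concat (k j : ℕ) (o : List (ℕ × Packet)) (d : ℕ) (p : Packet) :
    pick k j (o ++ [(d, p)]) = if d = j ∧ p.field 3 = k then pick k j o ++ [p] else pick k j o := by
  rw [pick_append]
  split_ifs with h
  · simp [pick, h]
  · simp only [pick, List.filter_cons, List.filter_nil, h, decide_false, Bool.false_eq_true,
      if_false, List.map_nil, List.append_nil]

lemma flatMap_ite_eq_ofKind {β : Type} (k : ℕ) (l : List Packet) (g : Packet → List β) :
    (l.flatMap fun p => if p.field 3 = k then g p else []) = (ofKind k l).flatMap g := by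
  induction l with
  | nil => rfl
  | cons a l ih =>
    rw [List.flatMap_cons, ih, ofKind_cons]
    split_ifs <;> simp

lemma length_flatMap_le {α β : Type} (l : List α) (h : α → List β) (c : ℕ)
    (hc : ∀ x ∈ l, (h x).length ≤ c) : (l.flatMap h).length ≤ c * l.length := by
  induction l with
  | nil => simp
  | cons a l ih =>
    have h1 := hc a List.mem_cons_self
    have h2 := ih fun x hx => hc x (List.mem_cons_of_mem _ hx)
    rw [List.flatMap_cons, List.length_append, List.length_cons, mul_add]
    omega

/-! ### Loops over the inbox -/

/-- The data of machine `i` in round `r`, and limits that suffice for them. -/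
structure Fits (L : Limits) (env : Env) (n S M i r : ℕ) : Prop where
  param : env.param = publicData n S M i r env.inbox.length
  cells : n + 10 ≤ L.cells
  small : 10 ≤ L.maxInt
  len : env.inbox.length ≤ L.maxInt
  vertices : n ≤ L.maxInt
  machines : M ≤ L.maxInt
  round : r ≤ L.maxInt
  valid : ∀ p ∈ env.inbox, L.Valid p
  zero : (0 : ℝ) ∈ L.words

section Loops

variable {L : Limits} {env : Env} {n S M i r : ℕ}

/-- The invariant speaks of the prefix already read instead of an index, which matches the recursion
of `List.flatMap`, `List.filter` and `List.foldl` in the specifications. -/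
lemma runs_forInbox (hf : Fits L env n S M i r) {s : Machine} {body : Cmd}
    {Q : Machine → Prop} (I : List Packet → Machine → Prop)
    (h0 : I [] { s with steps := s.steps + 1 })
    (hs : ∀ pre p post, env.inbox = pre ++ p :: post → env.inbox[pre.length]? = some p →
      ∀ s' : Machine, I pre s' → Runs (exec L env body { s' with
        steps := s'.steps + 1
        ints := Function.update s'.ints 0 pre.length }) (I (pre ++ [p])))
    (hQ : ∀ s', I env.inbox s' → Q s') : Runs (exec L env (forInbox body) s) Q := by
  have hc := hf.cells
  refine runs_loop (N := env.inbox.length) (fun t s' => I (env.inbox.take t) s') (by omega)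
    (by simp [IExp.eval, hf.param, publicData]) hf.len h0 ?_ ?_
  · intro t ht s' hI
    have h1 : env.inbox = env.inbox.take t ++ env.inbox[t] :: env.inbox.drop (t + 1) := by simp
    have h2 : (env.inbox.take t).length = t := by
      rw [List.length_take]
      omega
    have := hs _ _ _ h1 (by rw [h2]; exact List.getElem?_eq_getElem ht) s' hI
    rw [h2] at this
    rwa [List.take_succ_eq_append_getElem ht]
  · intro s' hI
    rw [List.take_length] at hI
    exact hQ s' hI

lemma sim_forInbox {α : Type} {p q : ℝ≥0∞} (hf : Fits L env n S M i r) {s : Machine} {body : Cmd}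
    {Q : List α → Machine → Prop} (l : Packet → List α)
    (I : List Packet → List α → Machine → Prop)
    (h0 : I [] [] { s with steps := s.steps + 1 })
    (hs : ∀ pre x post, env.inbox = pre ++ x :: post → env.inbox[pre.length]? = some x →
      ∀ a, ∀ s' : Machine, I pre a s' → Sim p q (exec L env body { s' with
        steps := s'.steps + 1
        ints := Function.update s'.ints 0 pre.length }) (l x) fun a' => I (pre ++ [x]) (a ++ a'))
    (hQ : ∀ a s', I env.inbox a s' → Q a s') :
    Sim p q (exec L env (forInbox body) s) (env.inbox.flatMap l) Q := by
  have hc := hf.cells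
  -- `sim_loop` expects one list of choices per pass number, so the inbox is rewritten in terms of
  -- its indices.
  have hl : env.inbox.flatMap l = (List.range env.inbox.length).flatMap
      fun t => (env.inbox[t]?).elim [] l := by
    have : env.inbox = (List.range env.inbox.length).flatMap fun t => (env.inbox[t]?).toList := by
      generalize env.inbox = I
      induction I using List.reverseRecOn with
      | nil => rfl
      | append_singleton I a ih =>
        rw [List.length_append, List.length_singleton, List.range_succ, List.flatMap_append]
        conv_lhs => rw [ih]
        congr 1
        · refine List.flatMap_congr fun t ht => ?_
          rw [List.getElem?_append_left (List.mem_range.1 ht)]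
        · simp
    conv_lhs => rw [this]
    rw [List.flatMap_assoc]
    refine List.flatMap_congr fun t _ => ?_
    cases env.inbox[t]? <;> simp
  rw [hl]
  refine sim_loop (N := env.inbox.length) (fun t a s' => I (env.inbox.take t) a s') (by omega)
    (by simp [IExp.eval, hf.param, publicData]) hf.len h0 ?_ ?_
  · intro t ht a s' hI
    have h1 : env.inbox = env.inbox.take t ++ env.inbox[t] :: env.inbox.drop (t + 1) := by simp
    have h2 : (env.inbox.take t).length = t := by
      rw [List.length_take]
      omega
    have := hs _ _ _ h1 (by rw [h2]; exact List.getElem?_eq_getElem ht) a s' hI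
    rw [h2] at this
    rw [List.take_succ_eq_append_getElem ht, List.getElem?_eq_getElem ht]
    exact this
  · intro a s' hI
    rw [List.take_length] at hI
    exact hQ a s' hI

end Loops

end MapReduce


namespace MapReduce

/-! ### Execution of the scan, the relay round and the reduce round on one machine. -/

section Rounds

variable {L : Limits} {env : Env} {n S M i r : ℕ}

/-- The state of a machine after the search for a packet of kind `6`. -/
structure Started (s : Machine) (m : ℕ) : Prop where
  halted : s.halted = false
  result : s.result = []
  outbox : s.outbox = []
  weights : ∀ x, s.weights x = 0
  mode : s.ints 2 = m
  ints : ∀ x, 3 ≤ x → s.ints x = 0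

lemma fld_eval {s : Machine} {p : Packet} (hp : env.inbox[s.ints 0]? = some p) (j : Fin 4) :
    (fld j).eval env s = p.field j := by
  simp [fld, it, IExp.eval, hp]

lemma inbox_it_eval {s : Machine} {p : Packet} (hp : env.inbox[s.ints 0]? = some p) :
    (WExp.inbox it).eval env s = p.weight := by
  simp [it, IExp.eval, WExp.eval, hp]

lemma isKind_eval {s : Machine} {p : Packet} (hp : env.inbox[s.ints 0]? = some p) (k : ℕ) :
    (isKind k).eval env s ↔ p.field 3 = k := by
  simp [isKind, Test.eval, fld_eval hp, IExp.eval]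

lemma reduced_eval {s : Machine} {p : Packet} {t : IExp}
    (hp : env.inbox[t.eval env s]? = some p) :
    (reduced t).eval env s = p.weight - s.weights (p.field 0) - s.weights (p.field 1) := by
  simp [reduced, WExp.eval, IExp.eval, hp]

lemma runs_whenever {s : Machine} {b : Test} {c : Cmd} {Q : Machine → Prop}
    (ht : b.eval env s → Runs (exec L env c { s with steps := s.steps + 1 }) Q)
    (hf : ¬ b.eval env s → Q { s with steps := s.steps + 1 + 1 }) :
    Runs (exec L env (whenever b c) s) Q :=
  runs_ite ht fun h => runs_skip (hf h)

/-- Sending the current packet to another machine. -/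
lemma runs_resend {s : Machine} {p : Packet} {d : IExp} {Q : Machine → Prop}
    (hp : env.inbox[s.ints 0]? = some p) (hv : L.Valid p)
    (h : Q { s with
      steps := s.steps + 1
      outbox := s.outbox ++ [(d.eval env s, p)] }) :
    Runs (exec L env (.send d (fun j => fld j) (.inbox it)) s) Q := by
  refine runs_send ?_ ?_ ?_
  · intro j
    rw [fld_eval hp]
    exact hv.1 j
  · rw [inbox_it_eval hp]
    exact hv.2
  · simpa only [fld_eval hp, inbox_it_eval hp] using h

lemma runs_forward (hf : Fits L env n S M i r) {s : Machine} {p : Packet} {Q : Machine → Prop}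
    (hp : env.inbox[s.ints 0]? = some p)
    (h : Q { s with
      steps := s.steps + 1
      outbox := s.outbox ++ [(i, p)] }) :
    Runs (exec L env forward s) Q := by
  refine runs_resend hp (hf.valid p (List.mem_of_getElem? hp)) ?_
  simpa only [IExp.eval, hf.param, publicData] using h

lemma runs_scanMode (hf : Fits L env n S M i r)
    (h6 : ∀ p ∈ env.inbox, p.field 3 = 6 → p.field 0 + 1 ≤ L.maxInt) :
    Runs (exec L env scanMode Machine.init) fun s =>
      Started s ((ofKind 6 env.inbox).getLast?.elim 0 fun p => p.field 0 + 1) := by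
  have hc := hf.cells
  refine runs_forInbox hf
    (fun pre s => Started s ((ofKind 6 pre).getLast?.elim 0 fun p => p.field 0 + 1)) ?_ ?_ ?_
  · constructor <;> simp [Machine.init, ofKind]
  · intro pre p post hI hp s hs
    refine runs_whenever ?_ ?_
    · intro hk
      rw [isKind_eval (by simpa using hp)] at hk
      have hmem : p ∈ env.inbox := by rw [hI]; simp
      refine runs_istore ?_ ?_ ?_
      · simp only [IExp.eval]
        omega
      · simpa [IExp.eval, fld_eval (s := { s with
          steps := s.steps + 1 + 1
          ints := Function.update s.ints 0 pre.length }) (by simpa using hp)] using h6 p hmem hk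
      · rw [ofKind_concat, if_pos hk]
        simp only [IExp.eval, fld_eval (s := { s with
          steps := s.steps + 1 + 1
          ints := Function.update s.ints 0 pre.length }) (by simpa using hp)]
        refine ⟨hs.halted, hs.result, hs.outbox, hs.weights, by simp, ?_⟩
        intro x hx
        have := hs.ints x hx
        have h2 : x ≠ 2 := by omega
        have h0 : x ≠ 0 := by omega
        simpa [h2, h0] using this
    · intro hk
      rw [isKind_eval (by simpa using hp)] at hk
      rw [ofKind_concat, if_neg hk]
      refine ⟨hs.halted, hs.result, hs.outbox, hs.weights, by simpa using hs.mode, ?_⟩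
      intro x hx
      have h0 : x ≠ 0 := by omega
      simpa [h0] using hs.ints x hx
  · exact fun s hs => hs

lemma runs_relayRound (hf : Fits L env n S M i r) {s : Machine} (hs : Started s 0) :
    Runs (exec L env relayRound s) fun s' => s'.halted = false ∧ s'.result = [] ∧
      s'.outbox = env.inbox.flatMap fun p =>
        if p.field 3 = 3 then (List.range M).map fun j => (j, p) else [(i, p)] := by
  have hc := hf.cells
  refine runs_forInbox hf (fun pre s' => s'.halted = false ∧ s'.result = [] ∧
      s'.outbox = pre.flatMap fun p =>
        if p.field 3 = 3 then (List.range M).map fun j => (j, p) else [(i, p)]) ?_ ?_ ?_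
  · exact ⟨hs.halted, hs.result, by simp [hs.outbox]⟩
  · rintro pre p post hI hp s' ⟨h1, h2, h3⟩
    refine runs_ite ?_ ?_
    · intro hk
      rw [isKind_eval (by simpa using hp)] at hk
      refine runs_loop (N := M) (fun j s'' => s''.ints 0 = pre.length ∧ s''.halted = false ∧
        s''.result = [] ∧ s''.outbox = s'.outbox ++ (List.range j).map fun j => (j, p))
        (by omega) (by simp [IExp.eval, hf.param, publicData]) hf.machines ?_ ?_ ?_
      · simp [h1, h2]
      · rintro j hj s'' ⟨g0, g1, g2, g3⟩
        refine runs_resend (p := p) (by simpa [g0] using hp) (hf.valid p (by rw [hI]; simp)) ?_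
        refine ⟨by simpa using g0, g1, g2, ?_⟩
        simp [g3, var, IExp.eval, List.range_succ]
      · rintro s'' ⟨g0, g1, g2, g3⟩
        refine ⟨g1, g2, ?_⟩
        simp [g3, h3, hk]
    · intro hk
      rw [isKind_eval (by simpa using hp)] at hk
      refine runs_forward hf (p := p) (by simpa using hp) ⟨h1, h2, ?_⟩
      simp [h3, hk]
  · exact fun s' h => h

/-- The packet of an edge on a machine, with its weight reduced by `ψ`. -/
noncomputable def reducePacket (ψ : ℕ → ℝ) (p : Packet) : Packet :=
  ⟨![p.field 0, p.field 1, 0, 0], p.weight - ψ (p.field 0) - ψ (p.field 1)⟩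

/-- The packet that announces the number of edges on a machine. -/
def countPacket (c : ℕ) : Packet := ⟨![c, 0, 0, 1], 0⟩

-- Memory starts at `0` in each round. A vertex without a packet is therefore treated as unchanged,
-- and `h3'` says that this is right.
open Classical in
lemma runs_reduceRound (hf : Fits L env n S M i r) {s : Machine} (hs : Started s 0) {ψ : ℕ → ℝ}
    (h3 : ∀ p ∈ env.inbox, p.field 3 = 3 → p.field 0 < n ∧ p.weight = ψ (p.field 0))
    (h3' : ∀ v < n, ψ v = 0 ∨ ∃ p ∈ env.inbox, p.field 3 = 3 ∧ p.field 0 = v)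
    (h0 : ∀ p ∈ env.inbox, p.field 3 = 0 → p.field 0 < n ∧ p.field 1 < n ∧
      (reducePacket ψ p).weight ∈ L.words) :
    Runs (exec L env reduceRound s) fun s' => s'.halted = false ∧ s'.result = [] ∧
      s'.outbox = (env.inbox.flatMap fun p =>
        if p.field 3 = 0 then
          if 0 < (reducePacket ψ p).weight then [(i, reducePacket ψ p)] else []
        else if p.field 3 = 4 then [(i, p)] else []) ++
      (List.range M).map fun j => (j, countPacket
        ((ofKind 0 env.inbox).countP fun p => 0 < (reducePacket ψ p).weight)) := by
  have hc := hf.cells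
  have hsmall := hf.small
  refine runs_seq ?_
  -- Each cell holds the final change or is still `0` with no packet for its vertex seen so far;
  -- several packets for one vertex would agree by `h3`.
  refine runs_forInbox hf (fun pre s' => s'.halted = false ∧ s'.result = [] ∧ s'.outbox = [] ∧
    s'.ints 2 = 0 ∧ ∀ v < n, s'.weights v = ψ v ∨
      s'.weights v = 0 ∧ ∀ p ∈ pre, p.field 3 = 3 → p.field 0 ≠ v) ?_ ?_ ?_
  · refine ⟨hs.halted, hs.result, hs.outbox, hs.mode, fun v _ => Or.inr ⟨hs.weights v, by simp⟩⟩
  · rintro pre p post hI hp s' ⟨g1, g2, g3, g4, g5⟩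
    have hmem : p ∈ env.inbox := by rw [hI]; simp
    refine runs_whenever ?_ ?_
    · intro hk
      rw [isKind_eval (by simpa using hp)] at hk
      obtain ⟨hlt, hw⟩ := h3 p hmem hk
      have e1 := fld_eval (s := { s' with
          steps := s'.steps + 1 + 1
          ints := Function.update s'.ints 0 pre.length }) (by simpa using hp) 0
      have e2 := inbox_it_eval (s := { s' with
          steps := s'.steps + 1 + 1
          ints := Function.update s'.ints 0 pre.length }) (by simpa using hp)
      refine runs_wstore ?_ ?_ ?_
      · rw [e1]
        omega
      · rw [e2]
        exact (hf.valid p hmem).2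
      · rw [e1, e2]
        refine ⟨g1, g2, g3, by simpa using g4, ?_⟩
        intro v hv
        by_cases hvp : v = p.field 0
        · left
          simp [hvp, hw]
        · simp only [Function.update_of_ne hvp]
          refine (g5 v hv).imp_right fun h => ⟨h.1, fun x hx hx3 => ?_⟩
          rcases List.mem_append.1 hx with hx | hx
          · exact h.2 x hx hx3
          · rw [List.mem_singleton.1 hx]
            exact fun h => hvp h.symm
    · intro hk
      rw [isKind_eval (by simpa using hp)] at hk
      refine ⟨g1, g2, g3, by simpa using g4, ?_⟩
      intro v hv
      refine (g5 v hv).imp_right fun h => ⟨h.1, fun x hx hx3 => ?_⟩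
      rcases List.mem_append.1 hx with hx | hx
      · exact h.2 x hx hx3
      · rw [List.mem_singleton.1 hx] at hx3
        exact absurd hx3 hk
  rintro s₁ ⟨g1, g2, g3, g4, g5⟩
  have hψ : ∀ v < n, s₁.weights v = ψ v := by
    intro v hv
    rcases g5 v hv with h | ⟨h, h'⟩
    · exact h
    · rcases h3' v hv with h4 | ⟨p, hp, hp3, hpv⟩
      · rw [h, h4]
      · exact absurd hpv (h' p hp hp3)
  clear g5
  refine runs_seq ?_
  refine runs_forInbox hf (fun pre s' => s'.halted = false ∧ s'.result = [] ∧
    (s'.outbox = pre.flatMap fun p =>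
        if p.field 3 = 0 then
          if 0 < (reducePacket ψ p).weight then [(i, reducePacket ψ p)] else []
        else if p.field 3 = 4 then [(i, p)] else []) ∧
    (∀ v < n, s'.weights v = ψ v) ∧
    s'.ints 2 = (ofKind 0 pre).countP fun p => 0 < (reducePacket ψ p).weight) ?_ ?_ ?_
  · exact ⟨g1, g2, by simp [g3], hψ, by simp [ofKind, g4]⟩
  · rintro pre p post hI hp s' ⟨g1, g2, g3, g4, g5⟩
    have hmem : p ∈ env.inbox := by rw [hI]; simp
    refine runs_ite ?_ ?_
    · intro hk
      rw [isKind_eval (by simpa using hp)] at hk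
      obtain ⟨hl0, hl1, hw⟩ := h0 p hmem hk
      have e : ∀ k x, (reduced it).eval env { s' with
          steps := k
          ints := Function.update (Function.update s'.ints 0 pre.length) 2 x } =
          (reducePacket ψ p).weight := by
        intro k x
        rw [reduced_eval (p := p) (by simpa [it, IExp.eval] using hp)]
        simp [reducePacket, g4 _ hl0, g4 _ hl1]
      have e' : ∀ k, (reduced it).eval env { s' with
          steps := k
          ints := Function.update s'.ints 0 pre.length } =
          (reducePacket ψ p).weight := by
        intro k
        rw [reduced_eval (p := p) (by simpa [it, IExp.eval] using hp)]
        simp [reducePacket, g4 _ hl0, g4 _ hl1]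
      refine runs_whenever ?_ ?_
      · intro hpos
        simp only [Test.eval, WExp.eval, e'] at hpos
        -- The counter never exceeds the number of packets read, so the increased counter is still
        -- an integer word.
        have hlen : (ofKind 0 pre).countP (fun p => 0 < (reducePacket ψ p).weight) + 1 ≤
            env.inbox.length := by
          have h1 : (ofKind 0 pre).countP (fun p => 0 < (reducePacket ψ p).weight) ≤ pre.length :=
            List.countP_le_length.trans (List.length_filter_le _ _)
          rw [hI, List.length_append, List.length_cons]
          omega
        have := hf.len
        refine runs_seq ?_
        refine runs_istore (by simp only [IExp.eval]; omega) ?_ ?_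
        · simp only [var, IExp.eval]
          simp [g5]
          omega
        · refine runs_send ?_ ?_ ?_
          · have hv := (hf.valid p hmem).1
            intro j
            fin_cases j
            · simpa [fld, it, IExp.eval, hp] using hv 0
            · simpa [fld, it, IExp.eval, hp] using hv 1
            · simp [IExp.eval]
            · simp [IExp.eval]
          · simp only [IExp.eval]
            rw [e]
            exact hw
          · refine ⟨g1, g2, ?_, g4, ?_⟩
            · simp only [IExp.eval] at e ⊢
              simp only [e, hf.param, publicData]
              have : (reducePacket ψ p) = ⟨![p.field 0, p.field 1, 0, 0],
                (reducePacket ψ p).weight⟩ := rfl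
              rw [List.flatMap_append, List.flatMap_singleton, if_pos hk, if_pos hpos, g3]
              congr 3
              rw [this]
              congr 1
              ext j
              fin_cases j <;> simp [fld, it, IExp.eval, hp]
            · rw [ofKind_concat, if_pos hk, List.countP_append]
              simp [var, IExp.eval, g5, hpos]
      · intro hpos
        simp only [Test.eval, WExp.eval, e'] at hpos
        refine ⟨g1, g2, ?_, g4, ?_⟩
        · rw [List.flatMap_append, List.flatMap_singleton, if_pos hk, if_neg hpos, List.append_nil]
          exact g3
        · rw [ofKind_concat, if_pos hk, List.countP_append]
          simp [g5, hpos]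
    · intro hk
      rw [isKind_eval (by simpa using hp)] at hk
      refine runs_whenever ?_ ?_
      · intro hk4
        rw [isKind_eval (by simpa using hp)] at hk4
        refine runs_forward hf (p := p) (by simpa using hp) ⟨g1, g2, ?_, g4, ?_⟩
        · simp [g3, hk4]
        · simp [ofKind_concat, hk, g5]
      · intro hk4
        rw [isKind_eval (by simpa using hp)] at hk4
        refine ⟨g1, g2, ?_, g4, ?_⟩
        · simp [g3, hk4, hk]
        · simp [ofKind_concat, hk, g5]
  rintro s₂ ⟨g1, g2, g3, g4, g5⟩
  have hcnt : s₂.ints 2 ≤ L.maxInt := by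
    rw [g5]
    exact (List.countP_le_length.trans (List.length_filter_le _ _)).trans hf.len
  refine runs_loop (N := M) (fun j s' => s'.halted = false ∧ s'.result = [] ∧
    s'.ints 2 = s₂.ints 2 ∧ s'.outbox = s₂.outbox ++
      (List.range j).map fun j => (j, countPacket (s₂.ints 2)))
    (by omega) (by simp [IExp.eval, hf.param, publicData]) hf.machines ?_ ?_ ?_
  · exact ⟨g1, g2, rfl, by simp⟩
  · rintro j hj s' ⟨q1, q2, q3, q4⟩
    refine runs_send ?_ ?_ ?_
    · intro k
      fin_cases k
      · simpa [var, IExp.eval, q3] using hcnt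
      · simp [IExp.eval]
      · simp [IExp.eval]
      · simp [IExp.eval]
        omega
    · exact hf.zero
    · refine ⟨q1, q2, by simpa using q3, ?_⟩
      rw [q4, List.range_succ, List.map_append, List.append_assoc]
      have he : ∀ f : Fin 4 → ℕ, f 0 = s₂.ints 2 → f 1 = 0 → f 2 = 0 → f 3 = 1 →
          (⟨f, 0⟩ : Packet) = countPacket (s₂.ints 2) := by
        intro f h0 h1 h2 h3
        simp only [countPacket, Packet.mk.injEq, and_true]
        ext k
        fin_cases k <;> simp [h0, h1, h2, h3]
      simp only [WExp.eval]
      rw [he]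
      · simp [var, IExp.eval]
      · simp [var, IExp.eval, q3]
      · simp [IExp.eval]
      · simp [IExp.eval]
      · simp [IExp.eval]
  · rintro s' ⟨q1, q2, q3, q4⟩
    refine ⟨q1, q2, ?_⟩
    rw [q4, g3, g5]

end Rounds

end MapReduce


namespace MapReduce

/-! ### Execution of the sampling round on one machine. -/

section Rounds

variable {L : Limits} {env : Env} {n S M i r : ℕ} {w : Sym2 (Fin n) → ℝ} {φ : ℕ → ℝ}

/-- A packet that describes an edge or arc and its residual weight. -/
noncomputable def arcPacket (w : Sym2 (Fin n) → ℝ) (φ : ℕ → ℝ) (k : ℕ) (a : Fin n × Fin n) :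
    Packet :=
  ⟨![a.1, a.2, 0, k], residual w φ a⟩

/-- A packet that describes an edge without its weight. -/
def plainPacket (k : ℕ) (a : Fin n × Fin n) : Packet := ⟨![a.1, a.2, 0, k], 0⟩

/-- The packet that announces the layer of the stack to be unwound next. -/
def modePacket (t : ℕ) : Packet := ⟨![t, 0, 0, 6], 0⟩

/-- A packet that describes the change of a potential. -/
noncomputable def potentialPacket (ψ : ℕ → ℝ) (v : ℕ) : Packet := ⟨![v, 0, 0, 3], ψ v⟩

lemma packet_mk_eq {f : Fin 4 → ℕ} {a b c d : ℕ} {x y : ℝ} (h0 : f 0 = a) (h1 : f 1 = b)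
    (h2 : f 2 = c) (h3 : f 3 = d) (hx : x = y) : (⟨f, x⟩ : Packet) = ⟨![a, b, c, d], y⟩ := by
  rw [Packet.mk.injEq]
  refine ⟨?_, hx⟩
  ext k
  fin_cases k <;> simp [h0, h1, h2, h3]

lemma arcPacket_injective (w : Sym2 (Fin n) → ℝ) (φ : ℕ → ℝ) (k : ℕ) :
    Function.Injective (arcPacket w φ k) := by
  intro a b h
  have h0 := congrArg (fun p : Packet => p.field 0) h
  have h1 := congrArg (fun p : Packet => p.field 1) h
  simp only [arcPacket, Matrix.cons_val_zero, Matrix.cons_val_one] at h0 h1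
  exact Prod.ext (Fin.ext h0) (Fin.ext h1)

lemma plainPacket_injective (k : ℕ) : Function.Injective (plainPacket (n := n) k) := by
  intro a b h
  have h0 := congrArg (fun p : Packet => p.field 0) h
  have h1 := congrArg (fun p : Packet => p.field 1) h
  simp only [plainPacket, Matrix.cons_val_zero, Matrix.cons_val_one] at h0 h1
  exact Prod.ext (Fin.ext h0) (Fin.ext h1)

lemma runs_send_packet {s : Machine} {d : IExp} {f : Fin 4 → IExp} {x : WExp} {dst : ℕ}
    {p : Packet} {Q : Machine → Prop} (hd : d.eval env s = dst)
    (hf : ∀ j, (f j).eval env s = p.field j) (hx : x.eval env s = p.weight) (hp : L.Valid p)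
    (h : Q { s with
      steps := s.steps + 1
      outbox := s.outbox ++ [(dst, p)] }) :
    Runs (exec L env (.send d f x) s) Q := by
  refine runs_send (fun j => by rw [hf]; exact hp.1 j) (by rw [hx]; exact hp.2) ?_
  simpa only [hd, hf, hx] using h

/-- What a machine sends in a sampling round. -/
noncomputable def sampleContent (w : Sym2 (Fin n) → ℝ) (φ : ℕ → ℝ) (i : ℕ) (pre : List Packet)
    (a : List (Fin n × Fin n)) (k j : ℕ) : List Packet :=
  if k = 0 then if j = i then ofKind 0 pre else []
  else if k = 2 then if j = 0 then a.map (arcPacket w φ 2) else []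
  else if k = 4 then if j = i then ofKind 4 pre else []
  else []

/-- The state of a machine in a sampling round. -/
structure Sampled (w : Sym2 (Fin n) → ℝ) (φ : ℕ → ℝ) (i N b : ℕ) (pre : List Packet)
    (a : List (Fin n × Fin n)) (s : Machine) : Prop where
  halted : s.halted = false
  result : s.result = []
  count : s.ints 2 = N
  outbox : ∀ k j, pick k j s.outbox = sampleContent w φ i pre a k j
  length : s.outbox.length ≤ b

/-- The random number overwrites cell `3` before the words of the packet are evaluated, hence `hfx`
asks for their values in every state with the same current packet. -/
lemma sim_flip (hf : Fits L env n S M i r) {s : Machine} {N b : ℕ} {pre : List Packet}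
    {a : List (Fin n × Fin n)} {p : Packet} {x : Fin n × Fin n} {f : Fin 4 → IExp}
    (hN : 0 < N) (hN' : N ≤ L.maxInt) (hs : Sampled w φ i N b pre a s)
    (hp : env.inbox[s.ints 0]? = some p) (hfx : ∀ s' : Machine, s'.ints 0 = s.ints 0 →
      (f 0).eval env s' = x.1 ∧ (f 1).eval env s' = x.2 ∧ (f 2).eval env s' = 0 ∧
      (f 3).eval env s' = 2)
    (hn : n ≤ L.maxInt) (hw : p.weight = residual w φ x) (hpw : p.weight ∈ L.words) :
    Sim (keepProb N S) (dropProb N S) (exec L env (flip f) s) [x] fun a' s' =>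
      Sampled w φ i N (b + 1) pre (a ++ a') s' ∧ s'.ints 0 = s.ints 0 := by
  have hc := hf.cells
  have hsmall := hf.small
  refine sim_draw (N := N) (H := 64 * S) (by omega) ?_ hN' ?_ rfl rfl ?_ ?_
  · simp only [IExp.eval, var, hs.count]
    omega
  · intro k
    simp [IExp.eval, hf.param, publicData]
  · intro k
    obtain ⟨h0, h1, h2, h3⟩ := hfx { s with
        steps := s.steps + 1 + 1
        ints := Function.update s.ints 3 k } (by simp)
    refine runs_send ?_ ?_ ?_
    · have := x.1.2
      have := x.2.2
      intro j
      fin_cases j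
      · simp only [Fin.zero_eta, h0]
        omega
      · simp only [Fin.mk_one, h1]
        omega
      · simp only [Fin.reduceFinMk, h2]
        omega
      · simp only [Fin.reduceFinMk, h3]
        omega
    · rw [inbox_it_eval (p := p) (by simpa using hp)]
      exact hpw
    · rw [inbox_it_eval (p := p) (by simpa using hp),
        packet_mk_eq (y := residual w φ x) h0 h1 h2 h3 hw]
      refine ⟨⟨hs.halted, hs.result, by simpa using hs.count, ?_, ?_⟩, by simp⟩
      · intro k j
        have h3 : ((⟨![(x.1 : ℕ), x.2, 0, 2], residual w φ x⟩ : Packet).field 3) = 2 := rfl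
        simp only [IExp.eval]
        rw [pick_concat, hs.outbox, h3]
        by_cases hk : k = 2
        · subst hk
          by_cases hj : j = 0
          · subst hj
            simp [sampleContent, arcPacket]
          · simp [sampleContent, hj, Ne.symm hj]
        · rw [if_neg (by omega)]
          simp [sampleContent, hk]
      · simpa using hs.length
  · intro k
    refine runs_skip ⟨⟨hs.halted, hs.result, by simpa using hs.count, ?_, ?_⟩, by simp⟩
    · simpa using hs.outbox
    · have := hs.length
      simp only
      omega

/-- The list of random choices has to be a function of the packets read. The decoder `dec` provides
this, making it equal to the arcs of `E`. -/
lemma sim_sampleRound (hf : Fits L env n S M i r) {s : Machine} (hs : Started s 0)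
    {E : List (Fin n × Fin n)} {N : ℕ} {dec : Packet → Fin n × Fin n}
    (hdec : ∀ a, dec (arcPacket w φ 0 a) = a)
    (hE : ofKind 0 env.inbox = E.map (arcPacket w φ 0))
    (hN : ((ofKind 1 env.inbox).map fun p => p.field 0).sum = N) (hN' : N ≤ L.maxInt)
    (hEN : E.length ≤ N) :
    Sim (keepProb N S) (dropProb N S) (exec L env sampleRound s) (arcs E) fun a s' =>
      s'.halted = false ∧ s'.result = [] ∧ s'.outbox.length ≤ 3 * env.inbox.length + 1 ∧
      ∀ k j, pick k j s'.outbox = if k = 6 then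
        if N = 0 ∧ j = i then [modePacket (r / 4 - 1)] else []
        else sampleContent w φ i env.inbox a k j := by
  have hc := hf.cells
  have hsmall := hf.small
  have hl : arcs E = env.inbox.flatMap fun p =>
      if p.field 3 = 0 then [dec p, (dec p).swap] else [] := by
    rw [flatMap_ite_eq_ofKind 0 env.inbox fun p => [dec p, (dec p).swap], hE, List.flatMap_map]
    simp only [hdec]
    rfl
  rw [hl, sampleRound]
  refine runs_seq_sim ?_
  refine runs_forInbox hf (fun pre s' => s'.halted = false ∧ s'.result = [] ∧ s'.outbox = [] ∧
    s'.ints 2 = ((ofKind 1 pre).map fun p => p.field 0).sum) ?_ ?_ ?_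
  · exact ⟨hs.halted, hs.result, hs.outbox, hs.mode⟩
  · rintro pre p post hI hp s' ⟨g1, g2, g3, g4⟩
    refine runs_whenever ?_ ?_
    · intro hk
      rw [isKind_eval (by simpa using hp)] at hk
      -- Every partial sum is bounded by the total `N`, so no intermediate value exceeds the word
      -- size.
      have hle : ((ofKind 1 (pre ++ [p])).map fun p => p.field 0).sum ≤ N := by
        rw [← hN, hI, show pre ++ p :: post = (pre ++ [p]) ++ post by simp,
          ofKind_append 1 (pre ++ [p]) post, List.map_append, List.sum_append]
        exact Nat.le_add_right _ _
      rw [ofKind_concat, if_pos hk, List.map_append, List.sum_append] at hle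
      simp only [List.map_cons, List.map_nil, List.sum_cons, List.sum_nil, add_zero] at hle
      have e : (fld 0).eval env { s' with
          steps := s'.steps + 1 + 1
          ints := Function.update s'.ints 0 pre.length } = p.field 0 :=
        fld_eval (by simpa using hp) 0
      refine runs_istore (by simp only [IExp.eval]; omega) ?_ ?_
      · simp only [IExp.eval, e, var]
        simp [g4]
        omega
      · simp only [IExp.eval, e, var]
        refine ⟨g1, g2, g3, ?_⟩
        rw [ofKind_concat, if_pos hk]
        simp [g4]
    · intro hk
      rw [isKind_eval (by simpa using hp)] at hk
      refine ⟨g1, g2, g3, ?_⟩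
      rw [ofKind_concat, if_neg hk]
      simpa using g4
  rintro s₁ ⟨g1, g2, g3, g4⟩
  rw [hN] at g4
  refine sim_seq_runs ?_
  refine sim_forInbox hf _
    (fun pre a s' => Sampled w φ i N (3 * pre.length) pre a s') ?_ ?_ ?_
  · refine ⟨g1, g2, g4, ?_, by simp [g3]⟩
    intro k j
    simp [g3, pick_nil, sampleContent, ofKind_nil]
  · intro pre p post hI hp a s' hs'
    have hmem : p ∈ env.inbox := by rw [hI]; simp
    have hlen := hs'.length
    have hfw : ∀ k, p.field 3 = 0 ∨ p.field 3 = 4 → Runs (exec L env forward { s' with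
        steps := k
        ints := Function.update s'.ints 0 pre.length }) fun s'' =>
        Sampled w φ i N (3 * pre.length + 1) (pre ++ [p]) a s'' ∧ s''.ints 0 = pre.length := by
      intro k hk
      refine runs_forward hf (p := p) (by simpa using hp) ?_
      refine ⟨⟨hs'.halted, hs'.result, by simpa using hs'.count, ?_, by simpa using hlen⟩, by simp⟩
      intro k j
      simp only
      rw [pick_concat, hs'.outbox]
      simp only [sampleContent, ofKind_concat]
      rcases hk with hk | hk <;>
      · simp only [hk]
        by_cases hj : j = i
        · subst hj
          by_cases h0 : k = 0
          · simp [h0]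
          · by_cases h4 : k = 4
            · simp [h4]
            · simp [h0, h4, Ne.symm h0, Ne.symm h4]
        · simp [hj, Ne.symm hj]
    by_cases hk : p.field 3 = 0
    · rw [if_pos hk]
      refine sim_ite (fun _ => ?_)
        (fun h => absurd ((isKind_eval (by simpa using hp) 0).2 hk) h)
      refine runs_seq_sim ((hfw _ (Or.inl hk)).mono ?_)
      rintro s₂ ⟨hs₂, h0⟩
      have hpE : p ∈ E.map (arcPacket w φ 0) := by
        rw [← hE]
        exact mem_ofKind.2 ⟨hmem, hk⟩
      obtain ⟨x, hx, rfl⟩ := List.mem_map.1 hpE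
      -- The current edge is among those counted, so `N` is positive and drawing from `{0, …, N -
      -- 1}` makes sense.
      have hNpos : 0 < N := lt_of_lt_of_le (List.length_pos_of_mem hx) hEN
      rw [hdec]
      refine Sim.mono (sim_seq (l₁ := [x]) (l₂ := [x.swap])
        (Q := fun a' s'' => Sampled w φ i N (3 * (pre.length + 1)) (pre ++ [arcPacket w φ 0 x])
          (a ++ a') s'') ?_) ?_
      · refine (sim_flip hf hNpos hN' hs₂ (p := arcPacket w φ 0 x) (by rw [h0]; exact hp) ?_
          hf.vertices rfl (hf.valid _ hmem).2).mono ?_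
        · intro s'' hs''
          have := fld_eval (s := s'') (p := arcPacket w φ 0 x) (by rw [hs'', h0]; exact hp)
          simp [this, IExp.eval, arcPacket]
        · rintro a' s₃ ⟨hs₃, h0'⟩
          refine (sim_flip hf hNpos hN' hs₃ (p := arcPacket w φ 0 x)
            (by rw [h0', h0]; exact hp) ?_ hf.vertices
            (by rw [residual_swap]; rfl) (hf.valid _ hmem).2).mono ?_
          · intro s'' hs''
            have := fld_eval (s := s'') (p := arcPacket w φ 0 x) (by rw [hs'', h0', h0]; exact hp)
            simp [this, IExp.eval, arcPacket]
          · rintro a'' s₄ ⟨hs₄, -⟩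
            rw [List.append_assoc] at hs₄
            exact hs₄
      · intro a' s'' h
        simpa using h
    · rw [if_neg hk]
      refine Runs.sim ?_
      rw [List.append_nil]
      refine runs_ite (fun h => absurd ((isKind_eval (by simpa using hp) 0).1 h) hk) (fun _ => ?_)
      refine runs_whenever ?_ ?_
      · intro hk4
        rw [isKind_eval (by simpa using hp)] at hk4
        refine (hfw _ (Or.inr hk4)).mono ?_
        rintro s'' ⟨hs'', -⟩
        refine ⟨hs''.halted, hs''.result, hs''.count, hs''.outbox, hs''.length.trans ?_⟩
        simp only [List.length_append, List.length_singleton]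
        omega
      · intro hk4
        rw [isKind_eval (by simpa using hp)] at hk4
        refine ⟨hs'.halted, hs'.result, by simpa using hs'.count, ?_, ?_⟩
        · intro k j
          simp only [hs'.outbox, sampleContent, ofKind_concat, hk, hk4, if_false]
        · simp only [List.length_append, List.length_singleton]
          omega
  · intro a s' hs'
    refine runs_whenever ?_ ?_
    · intro h0
      simp only [Test.eval, var, IExp.eval, hs'.count] at h0
      have hph : phase.eval env s' = r / 4 := by
        simp [phase, IExp.eval, hf.param, publicData]
      have hr := hf.round
      have hr4 : r / 4 ≤ r := Nat.div_le_self _ _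
      have hph' : ∀ k, (IExp.sub phase (.lit 1)).eval env { s' with steps := k } = r / 4 - 1 := by
        intro k
        simp [phase, IExp.eval, hf.param, publicData]
      refine runs_send_packet (dst := i) (p := modePacket (r / 4 - 1))
        (by simp [IExp.eval, hf.param, publicData]) ?_ rfl ⟨?_, hf.zero⟩ ?_
      · intro k
        fin_cases k
        · exact hph' _
        · rfl
        · rfl
        · rfl
      · intro k
        fin_cases k <;> simp [modePacket] <;> omega
      · refine ⟨hs'.halted, hs'.result, ?_, ?_⟩
        · have := hs'.length
          simp only [List.length_append, List.length_singleton]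
          omega
        · intro k j
          simp only
          have h3 : (modePacket (r / 4 - 1)).field 3 = 6 := rfl
          rw [pick_concat, hs'.outbox, h3]
          by_cases hk : k = 6
          · subst hk
            by_cases hj : j = i
            · simp [hj, h0, sampleContent]
            · simp [hj, Ne.symm hj, sampleContent]
          · simp [hk, Ne.symm hk]
    · intro h0
      simp only [Test.eval, var, IExp.eval, hs'.count] at h0
      refine ⟨hs'.halted, hs'.result, ?_, ?_⟩
      · have := hs'.length
        simp only
        omega
      · intro k j
        simp only [hs'.outbox]
        by_cases hk : k = 6
        · simp [hk, h0, sampleContent]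
        · simp [hk]

end Rounds

end MapReduce


namespace MapReduce

/-! ### Execution of the push round, on the central machine and on the others. -/

section Rounds

variable {L : Limits} {env : Env} {n S M i r : ℕ} {w : Sym2 (Fin n) → ℝ} {φ : ℕ → ℝ}

lemma runs_forwardStored (hf : Fits L env n S M i r) {s : Machine} (hs : Started s 0) :
    Runs (exec L env
      (forInbox (whenever (.not (.and (.not (isKind 0)) (.not (isKind 4)))) forward)) s)
      fun s' => s'.halted = false ∧ s'.result = [] ∧ (∀ x, s'.weights x = 0) ∧
      s'.outbox = env.inbox.flatMap fun p =>
        if p.field 3 = 0 ∨ p.field 3 = 4 then [(i, p)] else [] := by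
  refine runs_forInbox hf (fun pre s' => s'.halted = false ∧ s'.result = [] ∧
    (∀ x, s'.weights x = 0) ∧ s'.outbox = pre.flatMap fun p =>
        if p.field 3 = 0 ∨ p.field 3 = 4 then [(i, p)] else []) ?_ ?_ fun s' h => h
  · exact ⟨hs.halted, hs.result, hs.weights, by simp [hs.outbox]⟩
  · rintro pre p post hI hp s' ⟨h1, h2, h3, h4⟩
    refine runs_whenever ?_ ?_
    · intro hk
      simp only [Test.eval, isKind_eval (env := env) (s := { s' with
          steps := s'.steps + 1
          ints := Function.update s'.ints 0 pre.length }) (p := p) (by simpa using hp)] at hk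
      refine runs_forward hf (p := p) (by simpa using hp) ⟨h1, h2, h3, ?_⟩
      have : p.field 3 = 0 ∨ p.field 3 = 4 := by tauto
      rw [List.flatMap_append, List.flatMap_singleton, if_pos this, h4]
    · intro hk
      simp only [Test.eval, isKind_eval (env := env) (s := { s' with
          steps := s'.steps + 1
          ints := Function.update s'.ints 0 pre.length }) (p := p) (by simpa using hp)] at hk
      refine ⟨h1, h2, h3, ?_⟩
      have : ¬ (p.field 3 = 0 ∨ p.field 3 = 4) := by tauto
      rw [List.flatMap_append, List.flatMap_singleton, if_neg this, h4, List.append_nil]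

lemma runs_pushRound_idle (hf : Fits L env n S M i r) {s : Machine} (hs : Started s 0)
    (hi : i ≠ 0) :
    Runs (exec L env pushRound s) fun s' => s'.halted = false ∧ s'.result = [] ∧
      s'.outbox = env.inbox.flatMap fun p =>
        if p.field 3 = 0 ∨ p.field 3 = 4 then [(i, p)] else [] := by
  refine runs_seq ((runs_forwardStored hf hs).mono ?_)
  rintro s₁ ⟨h1, h2, -, h4⟩
  refine runs_whenever (fun h => absurd ?_ hi) fun _ => ⟨h1, h2, h4⟩
  simpa [Test.eval, IExp.eval, hf.param, publicData] using h

/-- The state of the central machine in the turn of a vertex. -/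
structure Turn (w : Sym2 (Fin n) → ℝ) (φ P : ℕ → ℝ) (o : List (ℕ × Packet)) (v : ℕ)
    (s : Machine) : Prop where
  halted : s.halted = false
  result : s.result = []
  outbox : s.outbox = o
  vertex : s.ints 1 = v
  weights : ∀ x < n, s.weights x = P x - φ x

/-- The state of the central machine during the search for the best arc, where `l` is the list of
the arcs seen so far. -/
structure Search (env : Env) (w : Sym2 (Fin n) → ℝ) (φ P : ℕ → ℝ) (o : List (ℕ × Packet)) (v : ℕ)
    (l : List (Fin n × Fin n)) (s : Machine) : Prop extends Turn w φ P o v s where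
  value : s.weights n = value w P (best w P (l.filter fun a => (a.1 : ℕ) = v))
  none : best w P (l.filter fun a => (a.1 : ℕ) = v) = none → s.ints 2 = 0
  some : ∀ a, best w P (l.filter fun a => (a.1 : ℕ) = v) = some a →
    s.ints 2 ≠ 0 ∧ env.inbox[s.ints 2 - 1]? = some (arcPacket w φ 2 a)

lemma arcPacket_weight_sub {P : ℕ → ℝ} {k : ℕ} (a : Fin n × Fin n) {W : ℕ → ℝ}
    (h : ∀ x < n, W x = P x - φ x) :
    (arcPacket w φ k a).weight - W ((arcPacket w φ k a).field 0) -
      W ((arcPacket w φ k a).field 1) = residual w P a := by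
  simp only [arcPacket, Matrix.cons_val_zero, Matrix.cons_val_one, h _ a.1.2, h _ a.2.2, residual]
  ring

/-- The loop performs the fold that defines `best`, over the arcs with tail `v`. The arcs read so
far are recovered as a list `l₀`; injectivity of the encoding shows that it is `l` at the end. -/
lemma runs_search (hf : Fits L env n S M i r) {s : Machine} {l : List (Fin n × Fin n)}
    {P : ℕ → ℝ} {o : List (ℕ × Packet)} {v : ℕ}
    (hl : ofKind 2 env.inbox = l.map (arcPacket w φ 2))
    (hres : ∀ a ∈ l, residual w P a ∈ L.words)
    (hs : Turn w φ P o v s) (h2 : s.ints 2 = 0) (hn : s.weights n = 0) :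
    Runs (exec L env (forInbox (whenever (.and (isKind 2) (.and (.ieq (fld 0) (var 1))
          (.wlt (.load (.param .vertices)) (reduced it))))
        (.seq (.istore (.lit 2) (.add it (.lit 1)))
          (.wstore (.param .vertices) (reduced it))))) s)
      (Search env w φ P o v l) := by
  have hc := hf.cells
  refine runs_forInbox hf (fun pre s' => ∃ l₀, ofKind 2 pre = l₀.map (arcPacket w φ 2) ∧
    Search env w φ P o v l₀ s') ?_ ?_ ?_
  · refine ⟨[], rfl, ⟨⟨hs.halted, hs.result, hs.outbox, hs.vertex, hs.weights⟩, ?_, ?_, ?_⟩⟩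
    · simpa [best, MapReduce.value] using hn
    · intro _
      exact h2
    · simp [best]
  · rintro pre p post hI hp s' ⟨l₀, hl₀, hS⟩
    have hmem : p ∈ env.inbox := by rw [hI]; simp
    set s₁ : Machine := { s' with
        steps := s'.steps + 1
        ints := Function.update s'.ints 0 pre.length } with hs₁
    have hp₁ : env.inbox[s₁.ints 0]? = some p := by simpa [hs₁] using hp
    by_cases hk : p.field 3 = 2
    · have hpE : p ∈ l.map (arcPacket w φ 2) := by
        rw [← hl]
        exact mem_ofKind.2 ⟨hmem, hk⟩
      obtain ⟨a, ha, rfl⟩ := List.mem_map.1 hpE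
      have e : (reduced it).eval env s₁ = residual w P a := by
        rw [reduced_eval (p := arcPacket w φ 2 a) (by simpa [it, IExp.eval] using hp₁)]
        exact arcPacket_weight_sub a hS.weights
      have hf0 : (arcPacket w φ 2 a).field 0 = a.1 := rfl
      have hcond : (Test.and (isKind 2) (.and (.ieq (fld 0) (var 1))
          (.wlt (.load (.param .vertices)) (reduced it)))).eval env s₁ ↔
          (a.1 : ℕ) = v ∧ value w P (best w P (l₀.filter fun a => (a.1 : ℕ) = v)) <
            residual w P a := by
        simp only [Test.eval, isKind_eval hp₁, hk, fld_eval hp₁, e, hf0, WExp.eval, IExp.eval,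
          hf.param, publicData, var]
        rw [← hS.value]
        have h1 : s₁.ints 1 = v := by simpa [hs₁] using hS.vertex
        rw [h1]
        simp [hs₁]
      have hrest : (l₀ ++ [a]).filter (fun a => (a.1 : ℕ) = v) =
          if (a.1 : ℕ) = v then l₀.filter (fun a => (a.1 : ℕ) = v) ++ [a]
          else l₀.filter fun a => (a.1 : ℕ) = v := by
        rw [List.filter_append]
        split_ifs with h <;> simp [h]
      have hl₀' : ofKind 2 (pre ++ [arcPacket w φ 2 a]) =
          (l₀ ++ [a]).map (arcPacket w φ 2) := by
        rw [ofKind_concat, if_pos hk, hl₀]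
        simp
      refine runs_whenever ?_ ?_
      · intro hb
        obtain ⟨hv, hlt⟩ := hcond.1 hb
        rw [if_pos hv] at hrest
        have hbest : best w P ((l₀ ++ [a]).filter fun a => (a.1 : ℕ) = v) = some a := by
          rw [hrest, best_append, if_pos hlt]
        have hlen : pre.length + 1 ≤ L.maxInt := by
          refine le_trans ?_ hf.len
          rw [hI, List.length_append, List.length_cons]
          omega
        refine runs_seq (runs_istore (by simp only [IExp.eval]; omega) ?_ ?_)
        · simpa [it, IExp.eval, hs₁] using hlen
        · have e' : (reduced it).eval env { s₁ with
              steps := s₁.steps + 1 + 1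
              ints := Function.update s₁.ints 2 (pre.length + 1) } = residual w P a := by
            rw [reduced_eval (p := arcPacket w φ 2 a) (by simpa [it, IExp.eval] using hp₁)]
            exact arcPacket_weight_sub a hS.weights
          have e0 : (IExp.add it (.lit 1)).eval env { s₁ with steps := s₁.steps + 1 } =
              pre.length + 1 := by
            simp [it, IExp.eval, hs₁]
          rw [e0]
          simp only [IExp.eval]
          refine runs_wstore ?_ ?_ ?_
          · simp only [IExp.eval, hf.param, publicData]
            omega
          · rw [e']
            exact hres a ha
          · rw [e']
            simp only [IExp.eval, hf.param, publicData]
            refine ⟨l₀ ++ [a], hl₀', ⟨⟨hS.halted, hS.result, hS.outbox, ?_, ?_⟩, ?_, ?_, ?_⟩⟩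
            · simpa [hs₁] using hS.vertex
            · intro x hx
              have hxn : x ≠ n := hx.ne
              simpa [hxn] using hS.weights x hx
            · rw [hbest]
              simp [MapReduce.value]
            · rw [hbest]
              simp
            · rw [hbest]
              intro b hb
              cases hb
              simpa using hp
      · intro hb
        have hbest : best w P ((l₀ ++ [a]).filter fun a => (a.1 : ℕ) = v) =
            best w P (l₀.filter fun a => (a.1 : ℕ) = v) := by
          rw [hrest]
          split_ifs with hv
          · rw [best_append, if_neg fun hlt => hb (hcond.2 ⟨hv, hlt⟩)]
          · rfl
        refine ⟨l₀ ++ [a], hl₀', ⟨⟨hS.halted, hS.result, hS.outbox, ?_, hS.weights⟩, ?_, ?_, ?_⟩⟩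
        · simpa [hs₁] using hS.vertex
        · rw [hbest]
          exact hS.value
        · rw [hbest]
          simpa [hs₁] using hS.none
        · rw [hbest]
          simpa [hs₁] using hS.some
    · refine runs_whenever ?_ ?_
      · intro hb
        exact absurd ((isKind_eval hp₁ 2).1 hb.1) hk
      · intro _
        refine ⟨l₀, by rw [ofKind_concat, if_neg hk, hl₀],
          ⟨⟨hS.halted, hS.result, hS.outbox, ?_, hS.weights⟩, hS.value, ?_, ?_⟩⟩
        · simpa [hs₁] using hS.vertex
        · simpa [hs₁] using hS.none
        · simpa [hs₁] using hS.some
  · rintro s' ⟨l₀, hl₀, hS⟩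
    rw [hl] at hl₀
    rwa [(List.map_injective_iff.2 (arcPacket_injective w φ 2)) hl₀]

lemma runs_wstore_eq {s : Machine} {a : IExp} {e : WExp} {k : ℕ} {x : ℝ} {Q : Machine → Prop}
    (hk : a.eval env s = k) (hx : e.eval env s = x) (hc : k < L.cells) (hw : x ∈ L.words)
    (h : Q { s with
      steps := s.steps + 1
      weights := Function.update s.weights k x }) : Runs (exec L env (.wstore a e) s) Q := by
  subst hk
  subst hx
  exact runs_wstore hc hw h

lemma runs_pushBest (hf : Fits L env n S M i r) {s : Machine} {l : List (Fin n × Fin n)}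
    {P : ℕ → ℝ} {o : List (ℕ × Packet)} {v : ℕ} (hS : Search env w φ P o v l s)
    (hne : ∀ a ∈ l, a.1 ≠ a.2)
    (hP : ∀ x, push w P (best w P (l.filter fun a => (a.1 : ℕ) = v)).toList x - φ x ∈ L.words) :
    Runs (exec L env (whenever (.ilt (.lit 0) (var 2))
        (.seq (.send phase ![.inbox 0 bestPacket, .inbox 1 bestPacket, .lit 0, .lit 4] .zero)
        (.seq (.wstore (.inbox 0 bestPacket)
          (.add (.load (.inbox 0 bestPacket)) (.load (.param .vertices))))
        (.wstore (.inbox 1 bestPacket)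
          (.add (.load (.inbox 1 bestPacket)) (.load (.param .vertices))))))) s)
      (Turn w φ (push w P (best w P (l.filter fun a => (a.1 : ℕ) = v)).toList)
        (o ++ (best w P (l.filter fun a => (a.1 : ℕ) = v)).toList.map
          fun a => (r / 4, plainPacket 4 a)) v) := by
  have hc := hf.cells
  have hsmall := hf.small
  have hvert := hf.vertices
  cases hb : best w P (l.filter fun a => (a.1 : ℕ) = v) with
  | none =>
    refine runs_whenever (fun h => ?_) fun _ => ?_
    · simp [Test.eval, var, IExp.eval, hS.none hb] at h
    · refine ⟨hS.halted, hS.result, ?_, hS.vertex, hS.weights⟩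
      simpa using hS.outbox
  | some a =>
    obtain ⟨hne0, hget⟩ := hS.some a hb
    have hal : a ∈ l := List.mem_of_mem_filter ((best_spec _ _).2.2 a hb).1
    have ha1 := a.1.2
    have ha2 := a.2.2
    -- The second store must read a potential that the first has not changed, which requires
    -- distinct end points.
    have hneq : (a.1 : ℕ) ≠ a.2 := fun h => hne a hal (Fin.ext h)
    have hw := hS.value
    rw [hb] at hw hP
    simp only [MapReduce.value] at hw
    have e : ∀ (s' : Machine) (j : Fin 4), s'.ints 2 = s.ints 2 →
        (IExp.inbox j bestPacket).eval env s' = (arcPacket w φ 2 a).field j := by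
      intro s' j h
      simp [bestPacket, var, IExp.eval, h, hget]
    have e0 : ∀ s' : Machine, s'.ints 2 = s.ints 2 →
        (IExp.inbox 0 bestPacket).eval env s' = a.1 := fun s' h => e s' 0 h
    have e1 : ∀ s' : Machine, s'.ints 2 = s.ints 2 →
        (IExp.inbox 1 bestPacket).eval env s' = a.2 := fun s' h => e s' 1 h
    have hP' : ∀ x, push w P [a] x = if x = a.1 ∨ x = a.2 then P x + residual w P a else P x :=
      fun x => rfl
    simp only [Option.toList_some] at hP ⊢
    refine runs_whenever (fun _ => ?_) fun h => ?_
    · refine runs_seq (runs_send_packet (dst := r / 4) (p := plainPacket 4 a)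
        (by simp [phase, IExp.eval, hf.param, publicData]) ?_ rfl ⟨?_, hf.zero⟩ ?_)
      · intro j
        fin_cases j
        · exact e0 _ rfl
        · exact e1 _ rfl
        · rfl
        · rfl
      · intro j
        fin_cases j <;> simp [plainPacket] <;> omega
      have hv1 : ∀ s' : Machine, s'.ints 2 = s.ints 2 → s'.weights = s.weights →
          (WExp.add (.load (.inbox 0 bestPacket)) (.load (.param .vertices))).eval env s' =
            push w P [a] a.1 - φ a.1 := by
        intro s' h h'
        simp only [WExp.eval, e0 s' h]
        simp only [IExp.eval, hf.param, publicData, h', hw, hS.weights _ ha1,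
          hP', true_or, if_true]
        ring
      refine runs_seq (runs_wstore_eq (e0 _ rfl) (hv1 _ rfl rfl) (by omega) (hP _) ?_)
      · have hv2 : ∀ s' : Machine, s'.ints 2 = s.ints 2 →
            s'.weights = Function.update s.weights a.1 (push w P [a] a.1 - φ a.1) →
            (WExp.add (.load (.inbox 1 bestPacket)) (.load (.param .vertices))).eval env s' =
              push w P [a] a.2 - φ a.2 := by
          intro s' h h'
          have h1 : n ≠ (a.1 : ℕ) := ha1.ne'
          simp only [WExp.eval, e1 s' h]
          simp only [IExp.eval, hf.param, publicData, h',
            Function.update_of_ne hneq.symm, Function.update_of_ne h1, hw, hS.weights _ ha2,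
            hP', or_true, if_true]
          ring
        refine runs_wstore_eq (e1 _ rfl) (hv2 _ rfl rfl) (by omega) (hP _) ?_
        · refine ⟨hS.halted, hS.result, ?_, hS.vertex, ?_⟩
          · simp [hS.outbox]
          · intro x hx
            simp only
            by_cases hx2 : x = a.2
            · rw [hx2, Function.update_self]
            · rw [Function.update_of_ne hx2]
              by_cases hx1 : x = a.1
              · rw [hx1, Function.update_self]
              · rw [Function.update_of_ne hx1, hP', if_neg (by tauto), hS.weights x hx]
    · exfalso
      simp only [Test.eval, var, IExp.eval] at h
      omega

/-- Weights in the inbox are relative to `φ`, so the machine stores only differences from `φ`, and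
`hP` bounds these. The outbox has three blocks: the forwarded packets, the new layer in the order of
the pushes, and the differences. -/
lemma runs_pushRound_central (hf : Fits L env n S M 0 r) {s : Machine} (hs : Started s 0)
    {l : List (Fin n × Fin n)} (hl : ofKind 2 env.inbox = l.map (arcPacket w φ 2))
    (hne : ∀ a ∈ l, a.1 ≠ a.2)
    (hres : ∀ u, u ≤ n → ∀ a ∈ l, residual w (push w φ (pushed w φ l u)) a ∈ L.words)
    (hP : ∀ u, u ≤ n → ∀ x, push w φ (pushed w φ l u) x - φ x ∈ L.words) :
    Runs (exec L env pushRound s) fun s' => s'.halted = false ∧ s'.result = [] ∧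
      s'.outbox = (env.inbox.flatMap fun p =>
        if p.field 3 = 0 ∨ p.field 3 = 4 then [(0, p)] else []) ++
        (pushed w φ l n).map (fun a => (r / 4, plainPacket 4 a)) ++
        (List.range n).map fun v => (v % M, potentialPacket
          (fun x => push w φ (pushed w φ l n) x - φ x) v) := by
  have hc := hf.cells
  have hsmall := hf.small
  refine runs_seq ((runs_forwardStored hf hs).mono ?_)
  rintro s₁ ⟨g1, g2, g3, g4⟩
  refine runs_whenever (fun _ => ?_) fun h => ?_
  swap
  · exact absurd (by simp [Test.eval, IExp.eval, hf.param, publicData]) h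
  rw [← g4]
  refine runs_seq ?_
  refine runs_loop (N := n) (fun v s' => s'.halted = false ∧ s'.result = [] ∧
    s'.outbox = s₁.outbox ++ (pushed w φ l v).map (fun a => (r / 4, plainPacket 4 a)) ∧
    ∀ x < n, s'.weights x = push w φ (pushed w φ l v) x - φ x) (by omega)
    (by simp [IExp.eval, hf.param, publicData]) hf.vertices ?_ ?_ ?_
  · refine ⟨g1, g2, by simp [pushed], ?_⟩
    intro x _
    simp [pushed, push, g3]
  · rintro v hv s' ⟨q1, q2, q3, q4⟩
    refine runs_seq (runs_istore (by simp only [IExp.eval]; omega) (by simp [IExp.eval]) ?_)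
    refine runs_seq (runs_wstore ?_ hf.zero ?_)
    · simp only [IExp.eval, hf.param, publicData]
      omega
    simp only [IExp.eval, hf.param, publicData, WExp.eval]
    refine runs_seq ((runs_search (w := w) (φ := φ) (P := push w φ (pushed w φ l v)) (v := v)
      (o := s₁.outbox ++ (pushed w φ l v).map fun a => (r / 4, plainPacket 4 a)) hf hl
      (hres v hv.le) ?_ ?_ ?_).mono ?_)
    · refine ⟨q1, q2, q3, by simp, ?_⟩
      intro x hx
      have hxn : x ≠ n := hx.ne
      simpa [hxn] using q4 x hx
    · simp
    · simp
    intro s₂ hS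
    refine (runs_pushBest hf hS hne ?_).mono ?_
    · intro x
      have := hP (v + 1) hv x
      rwa [pushed, push_append] at this
    · intro s₃ hT
      refine ⟨hT.halted, hT.result, ?_, ?_⟩
      · rw [hT.outbox, pushed, List.map_append, List.append_assoc]
      · intro x hx
        rw [hT.weights x hx, pushed, push_append]
  · rintro s₂ ⟨q1, q2, q3, q4⟩
    refine runs_loop (N := n) (fun v s' => s'.halted = false ∧ s'.result = [] ∧
      s'.weights = s₂.weights ∧
      s'.outbox = s₂.outbox ++ (List.range v).map fun v => (v % M, potentialPacket
          (fun x => push w φ (pushed w φ l n) x - φ x) v)) (by omega)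
      (by simp [IExp.eval, hf.param, publicData]) hf.vertices ?_ ?_ ?_
    · exact ⟨q1, q2, rfl, by simp⟩
    · rintro v hv s' ⟨t1, t2, t3, t4⟩
      have hvert := hf.vertices
      refine runs_send_packet (dst := v % M) (p := potentialPacket
          (fun x => push w φ (pushed w φ l n) x - φ x) v) ?_ ?_ ?_ ⟨?_, hP n le_rfl v⟩ ?_
      · simp [var, IExp.eval, hf.param, publicData]
      · intro j
        fin_cases j <;> simp [potentialPacket, var, IExp.eval]
      · simp [WExp.eval, var, IExp.eval, t3, q4 v hv, potentialPacket]
      · intro j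
        fin_cases j <;> simp [potentialPacket] <;> omega
      · refine ⟨t1, t2, t3, ?_⟩
        simp [t4, List.range_succ]
    · rintro s' ⟨t1, t2, t3, t4⟩
      refine ⟨t1, t2, ?_⟩
      rw [t4, q3]

end Rounds

end MapReduce


namespace MapReduce

/-! ### Execution of the unwinding round and the dispatch between the rounds. -/

section Rounds

variable {L : Limits} {env : Env} {n S M i r : ℕ}

/-- The state of a machine that unwinds layer `t` and has the matching `m`. -/
structure Marked (t : ℕ) (m : List (Fin n × Fin n)) (s : Machine) : Prop where
  halted : s.halted = false
  result : s.result = m.map fun a => ((a.1 : ℕ), (a.2 : ℕ))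
  outbox : s.outbox = m.map fun a => (t - 1, plainPacket 5 a)
  mode : s.ints 2 = t + 1
  flags : ∀ x : Fin n, s.ints (4 + x) = 0 ↔ ¬ Covers m x

lemma Marked.mono {t : ℕ} {m : List (Fin n × Fin n)} {s : Machine} (h : Marked t m s)
    {s' : Machine} (h1 : s'.halted = s.halted) (h2 : s'.result = s.result)
    (h3 : s'.outbox = s.outbox) (h4 : ∀ x, 2 ≤ x → s'.ints x = s.ints x) : Marked t m s' :=
  ⟨h1 ▸ h.halted, h2 ▸ h.result, h3 ▸ h.outbox, (h4 2 le_rfl).trans h.mode, fun x => by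
    rw [h4 _ (by omega)]
    exact h.flags x⟩

lemma covers_concat {m : List (Fin n × Fin n)} {a : Fin n × Fin n} {x : Fin n} :
    Covers (m ++ [a]) x ↔ Covers m x ∨ x = a.1 ∨ x = a.2 := by
  simp [Covers, or_and_right, exists_or]

lemma runs_take (hf : Fits L env n S M i r) {s : Machine} {t k : ℕ} {m : List (Fin n × Fin n)}
    {a : Fin n × Fin n} (hs : Marked t m s)
    (hp : env.inbox[s.ints 0]? = some (plainPacket k a)) :
    Runs (exec L env take s) fun s' => Marked t (m ++ [a]) s' ∧ s'.ints 1 = s.ints 1 := by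
  have hc := hf.cells
  have hsmall := hf.small
  have hvert := hf.vertices
  have ha1 := a.1.2
  have ha2 := a.2.2
  have e0 : ∀ s' : Machine, s'.ints 0 = s.ints 0 → (fld 0).eval env s' = a.1 := fun s' h =>
    fld_eval (p := plainPacket k a) (by rw [h]; exact hp) 0
  have e1 : ∀ s' : Machine, s'.ints 0 = s.ints 0 → (fld 1).eval env s' = a.2 := fun s' h =>
    fld_eval (p := plainPacket k a) (by rw [h]; exact hp) 1
  -- The flags start at address `4`, so setting one leaves the program variables alone.
  have hu : ∀ (c x : ℕ) (f : ℕ → ℕ) (y : ℕ), c < 4 → Function.update f (4 + x) y c = f c := by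
    intro c x f y hc
    exact Function.update_of_ne (by omega) _ _
  have g0 : ∀ s' : Machine, s'.ints 0 = s.ints 0 →
      (IExp.add (.lit 4) (fld 0)).eval env s' = 4 + a.1 := by
    intro s' h
    simp only [IExp.eval, e0 s' h]
  have g1 : ∀ s' : Machine, s'.ints 0 = s.ints 0 →
      (IExp.add (.lit 4) (fld 1)).eval env s' = 4 + a.2 := by
    intro s' h
    simp only [IExp.eval, e1 s' h]
  refine runs_seq (runs_istore ?_ ?_ ?_)
  · rw [g0 _ rfl]
    omega
  · simp only [IExp.eval]
    omega
  rw [g0 _ rfl]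
  have k1 : (IExp.lit 1).eval env s = 1 := rfl
  rw [k1]
  refine runs_seq (runs_istore ?_ ?_ ?_)
  · rw [g1 _ (hu 0 _ _ _ (by omega))]
    omega
  · simp only [IExp.eval]
    omega
  rw [g1 _ (hu 0 _ _ _ (by omega))]
  have hz : ∀ y z : ℕ, Function.update (Function.update s.ints (4 + a.1) y) (4 + a.2) z 0 =
      s.ints 0 := by
    intro y z
    rw [hu 0 _ _ _ (by omega), hu 0 _ _ _ (by omega)]
  refine runs_seq (runs_output ?_ ?_ ?_)
  · rw [e0 _ (hz _ _)]
    omega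
  · rw [e1 _ (hz _ _)]
    omega
  rw [e0 _ (hz _ _), e1 _ (hz _ _)]
  refine runs_send_packet (dst := t - 1) (p := plainPacket 5 a) ?_ ?_ rfl ⟨?_, hf.zero⟩ ?_
  · simp only [IExp.eval, var]
    rw [hu 2 _ _ _ (by omega), hu 2 _ _ _ (by omega), hs.mode]
    omega
  · intro j
    fin_cases j
    · exact e0 _ (hz _ _)
    · exact e1 _ (hz _ _)
    · rfl
    · rfl
  · intro j
    fin_cases j <;> simp [plainPacket] <;> omega
  · refine ⟨⟨hs.halted, ?_, ?_, ?_, ?_⟩, ?_⟩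
    · simp [hs.result]
    · simp [hs.outbox]
    · simp only
      rw [hu 2 _ _ _ (by omega), hu 2 _ _ _ (by omega), hs.mode]
    · intro x
      rw [covers_concat]
      simp only [IExp.eval]
      by_cases h2 : x = a.2
      · simp [h2]
      · have h2' : 4 + (x : ℕ) ≠ 4 + a.2 := fun h => h2 (Fin.ext (by omega))
        rw [Function.update_of_ne h2']
        by_cases h1 : x = a.1
        · simp [h1]
        · have h1' : 4 + (x : ℕ) ≠ 4 + a.1 := fun h => h1 (Fin.ext (by omega))
          rw [Function.update_of_ne h1', hs.flags x]
          simp [h1, h2]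
    · simp only
      rw [hu 1 _ _ _ (by omega), hu 1 _ _ _ (by omega)]

lemma runs_sendMode (hf : Fits L env n S M i r) {s : Machine} {t : ℕ} (ht : t ≤ L.maxInt)
    (h2 : s.ints 2 = t + 1) {Q : Machine → Prop}
    (h : Q { s with
      steps := s.steps + 1
      outbox := s.outbox ++ [(i, modePacket (t - 1))] }) :
    Runs (exec L env
      (.send (.param .self) ![.sub (var 2) (.lit 2), .lit 0, .lit 0, .lit 6] .zero) s) Q := by
  have hsmall := hf.small
  refine runs_send_packet (dst := i) (p := modePacket (t - 1)) ?_ ?_ rfl ⟨?_, hf.zero⟩ h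
  · simp [IExp.eval, hf.param, publicData]
  · intro j
    fin_cases j <;> simp [modePacket, var, IExp.eval, h2]
  · intro j
    fin_cases j <;> simp [modePacket] <;> omega

lemma runs_unwindRound_active (hf : Fits L env n S M i r) {s : Machine} (hs : Started s (i + 1))
    (hi : i ≤ L.maxInt) {m l : List (Fin n × Fin n)}
    (hm : ofKind 5 env.inbox = m.map (plainPacket 5))
    (hl : ofKind 4 env.inbox = l.map (plainPacket 4)) :
    Runs (exec L env unwindRound s) fun s' => (s'.halted = true ↔ i = 0) ∧
      s'.result = (unwind m l).map (fun a => ((a.1 : ℕ), (a.2 : ℕ))) ∧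
      s'.outbox = (unwind m l).map (fun a => (i - 1, plainPacket 5 a)) ++
        [(i, modePacket (i - 1))] := by
  classical
  have hc := hf.cells
  have hsmall := hf.small
  have hlen := hf.len
  refine runs_seq (runs_ite (fun _ => ?_) fun h => absurd ?_ h)
  swap
  · simp [Test.eval, var, IExp.eval, hf.param, publicData, hs.mode]
  refine runs_seq ?_
  refine runs_forInbox hf (fun pre s' => ∃ m₀ : List (Fin n × Fin n),
    ofKind 5 pre = m₀.map (plainPacket 5) ∧ Marked i m₀ s') ?_ ?_ ?_
  · refine ⟨[], rfl, ⟨hs.halted, by simp [hs.result], by simp [hs.outbox], hs.mode, ?_⟩⟩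
    intro x
    simp [Covers, hs.ints (4 + x) (by omega)]
  · rintro pre p post hI hp s' ⟨m₀, hm₀, hM⟩
    have hmem : p ∈ env.inbox := by rw [hI]; simp
    refine runs_whenever ?_ ?_
    · intro hk
      rw [isKind_eval (by simpa using hp)] at hk
      have hpE : p ∈ m.map (plainPacket 5) := by
        rw [← hm]
        exact mem_ofKind.2 ⟨hmem, hk⟩
      obtain ⟨a, ha, rfl⟩ := List.mem_map.1 hpE
      refine Runs.mono (runs_take hf (k := 5) (a := a) (t := i) (m := m₀) ?_ ?_) ?_
      · refine hM.mono rfl rfl rfl fun x hx => ?_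
        have : x ≠ 0 := by omega
        simp [this]
      · simpa using hp
      · rintro s'' ⟨hM', -⟩
        refine ⟨m₀ ++ [a], ?_, hM'⟩
        rw [ofKind_concat, if_pos hk, hm₀]
        simp
    · intro hk
      rw [isKind_eval (by simpa using hp)] at hk
      refine ⟨m₀, by rw [ofKind_concat, if_neg hk, hm₀], hM.mono rfl rfl rfl ?_⟩
      intro x hx
      have : x ≠ 0 := by omega
      simp [this]
  rintro s₁ ⟨m₀, hm₀, hM⟩
  rw [hm] at hm₀
  rw [← (List.map_injective_iff.2 (plainPacket_injective 5)) hm₀] at hM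
  clear hm₀ m₀
  refine runs_seq ?_
  -- After `t` passes the last `t` packets have been treated. A further pass puts one packet in
  -- front of this suffix, in accordance with `unwind_cons`.
  refine runs_loop (N := env.inbox.length) (fun t s' => ∃ l₀ : List (Fin n × Fin n),
    ofKind 4 (env.inbox.drop (env.inbox.length - t)) = l₀.map (plainPacket 4) ∧
    Marked i (unwind m l₀) s') (by omega) (by simp [IExp.eval, hf.param, publicData]) hlen ?_ ?_ ?_
  · refine ⟨[], by simp [ofKind_nil], hM.mono rfl rfl rfl fun x _ => rfl⟩
  · rintro t ht s' ⟨l₀, hl₀, hM'⟩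
    have e1 : (IExp.sub (.sub (.param .inboxLength) (.lit 1)) (var 1)).eval env { s' with
        steps := s'.steps + 1
        ints := Function.update s'.ints 1 t } = env.inbox.length - 1 - t := by
      simp [var, IExp.eval, hf.param, publicData]
    refine runs_seq (runs_istore (by simp only [IExp.eval]; omega) (by rw [e1]; omega) ?_)
    rw [e1]
    simp only [IExp.eval]
    set s₂ : Machine := { s' with
        steps := s'.steps + 1 + 1
        ints := Function.update (Function.update s'.ints 1 t) 0 (env.inbox.length - 1 - t) }
      with hs₂
    have hlt : env.inbox.length - 1 - t < env.inbox.length := by omega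
    obtain ⟨p, hp⟩ : ∃ p, env.inbox[env.inbox.length - 1 - t]? = some p :=
      ⟨_, List.getElem?_eq_getElem hlt⟩
    have hdrop : env.inbox.drop (env.inbox.length - (t + 1)) =
        p :: env.inbox.drop (env.inbox.length - t) := by
      have h1 : env.inbox.length - (t + 1) = env.inbox.length - 1 - t := by omega
      have h2 : env.inbox.length - t = env.inbox.length - 1 - t + 1 := by omega
      rw [h1, h2, List.drop_eq_getElem_cons hlt]
      rw [List.getElem?_eq_getElem hlt] at hp
      rw [Option.some.inj hp]
    have hmem : p ∈ env.inbox := List.mem_of_getElem? hp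
    have hp₂ : env.inbox[s₂.ints 0]? = some p := by simpa [hs₂] using hp
    have hM₂ : Marked i (unwind m l₀) s₂ := by
      refine hM'.mono rfl rfl rfl ?_
      intro x hx
      have h0 : x ≠ 0 := by omega
      have h1 : x ≠ 1 := by omega
      simp [hs₂, h0, h1]
    by_cases hk : p.field 3 = 4
    · have hpE : p ∈ l.map (plainPacket 4) := by
        rw [← hl]
        exact mem_ofKind.2 ⟨hmem, hk⟩
      obtain ⟨a, ha, rfl⟩ := List.mem_map.1 hpE
      have hf0 : (plainPacket 4 a).field 0 = a.1 := rfl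
      have hf1 : (plainPacket 4 a).field 1 = a.2 := rfl
      have hl₁ : ofKind 4 (env.inbox.drop (env.inbox.length - (t + 1))) =
          (a :: l₀).map (plainPacket 4) := by
        rw [hdrop, ofKind_cons, if_pos hk, hl₀, List.map_cons]
      have hcond : (Test.and (isKind 4) (.and (.ieq (.load (.add (.lit 4) (fld 0))) (.lit 0))
          (.ieq (.load (.add (.lit 4) (fld 1))) (.lit 0)))).eval env s₂ ↔
          ¬ (Covers (unwind m l₀) a.1 ∨ Covers (unwind m l₀) a.2) := by
        simp only [Test.eval, isKind_eval hp₂, IExp.eval, fld_eval hp₂, hk, hf0, hf1,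
          hM₂.flags, true_and, not_or]
      refine runs_whenever ?_ ?_
      · intro hb
        refine Runs.mono (runs_take hf (k := 4) (a := a) (t := i) (m := unwind m l₀)
          ?_ ?_) ?_
        · exact hM₂.mono rfl rfl rfl fun x _ => rfl
        · exact hp₂
        rintro s₃ ⟨hM₃, -⟩
        refine ⟨a :: l₀, hl₁, ?_⟩
        rw [unwind_cons, greedy, if_neg (hcond.1 hb)]
        exact hM₃
      · intro hb
        refine ⟨a :: l₀, hl₁, ?_⟩
        rw [hcond, not_not] at hb
        rw [unwind_cons, greedy, if_pos hb]
        exact hM₂.mono rfl rfl rfl fun x _ => rfl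
    · refine runs_whenever ?_ ?_
      · intro hb
        exact absurd ((isKind_eval hp₂ 4).1 hb.1) hk
      · intro _
        refine ⟨l₀, by rw [hdrop, ofKind_cons, if_neg hk, hl₀], ?_⟩
        exact hM₂.mono rfl rfl rfl fun x _ => rfl
  rintro s₃ ⟨l₀, hl₀, hM₃⟩
  rw [Nat.sub_self, List.drop_zero, hl] at hl₀
  rw [← (List.map_injective_iff.2 (plainPacket_injective 4)) hl₀] at hM₃
  refine runs_whenever (fun h0 => ?_) fun h0 => ?_
  · simp only [Test.eval, var, IExp.eval, hM₃.mode] at h0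
    refine runs_halt ?_
    refine runs_sendMode hf hi (by exact hM₃.mode) ?_
    refine ⟨?_, hM₃.result, ?_⟩
    · simp only [true_iff]
      omega
    · simp only [hM₃.outbox]
  · simp only [Test.eval, var, IExp.eval, hM₃.mode] at h0
    refine runs_sendMode hf hi (by exact hM₃.mode) ?_
    refine ⟨?_, hM₃.result, ?_⟩
    · simp only [hM₃.halted, Bool.false_eq_true, false_iff]
      omega
    · simp only [hM₃.outbox]

lemma runs_unwindRound_idle (hf : Fits L env n S M i r) {s : Machine} {t : ℕ}
    (hs : Started s (t + 1)) (ht : t ≤ L.maxInt) (hi : i ≠ t) :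
    Runs (exec L env unwindRound s) fun s' => s'.halted = false ∧ s'.result = [] ∧
      s'.outbox = (env.inbox.flatMap fun p => if p.field 3 = 4 then [(i, p)] else []) ++
        [(i, modePacket (t - 1))] := by
  refine runs_seq (runs_ite (fun h => absurd ?_ hi) fun _ => ?_)
  · simpa [Test.eval, var, IExp.eval, hf.param, publicData, hs.mode] using h
  refine runs_forInbox hf (fun pre s' => s'.halted = false ∧ s'.result = [] ∧
    s'.ints 2 = t + 1 ∧
    s'.outbox = pre.flatMap fun p => if p.field 3 = 4 then [(i, p)] else []) ?_ ?_ ?_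
  · exact ⟨hs.halted, hs.result, hs.mode, by simp [hs.outbox]⟩
  · rintro pre p post hI hp s' ⟨h1, h2, h3, h4⟩
    refine runs_whenever ?_ ?_
    · intro hk
      rw [isKind_eval (by simpa using hp)] at hk
      refine runs_forward hf (p := p) (by simpa using hp) ⟨h1, h2, by simpa using h3, ?_⟩
      simp [h4, hk]
    · intro hk
      rw [isKind_eval (by simpa using hp)] at hk
      refine ⟨h1, h2, by simpa using h3, ?_⟩
      simp [h4, hk]
  · rintro s' ⟨h1, h2, h3, h4⟩
    refine runs_sendMode hf ht h3 ⟨h1, h2, ?_⟩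
    rw [← h4]

/-! ### The rounds of a machine -/

/-- In a round without packets of kind `6`, the kind of the round depends on its number. -/
lemma sim_matchingProgram {α : Type} {p q : ℝ≥0∞} {l : List α} {Q : List α → Machine → Prop}
    (hf : Fits L env n S M i r) (h6 : ofKind 6 env.inbox = [])
    (h : ∀ s, Started s 0 → Sim p q (exec L env (
      if r % 4 = 0 then reduceRound else if r % 4 = 1 then sampleRound
      else if r % 4 = 2 then pushRound else relayRound) s) l Q) :
    Sim p q (exec L env matchingProgram Machine.init) l Q := by
  refine runs_seq_sim ((runs_scanMode hf ?_).mono ?_)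
  · intro p hp h3
    have : p ∈ ofKind 6 env.inbox := mem_ofKind.2 ⟨hp, h3⟩
    rw [h6] at this
    simp at this
  · intro s hs
    rw [h6] at hs
    simp only [List.getLast?_nil, Option.elim_none] at hs
    have hst : ∀ k, Started { s with steps := k } 0 := fun k =>
      ⟨hs.halted, hs.result, hs.outbox, hs.weights, hs.mode, hs.ints⟩
    refine sim_ite (fun h0 => ?_) fun _ => ?_
    · simp [Test.eval, var, IExp.eval, hs.mode] at h0
    have key : ∀ (c k : ℕ), (Test.ieq (.mod (.param .round) (.lit 4)) (.lit c)).eval env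
        { s with steps := k } ↔ r % 4 = c := by
      intro c k
      simp [Test.eval, IExp.eval, hf.param, publicData]
    refine sim_ite (fun h0 => ?_) fun h0 => ?_
    · rw [key] at h0
      simpa [h0] using h _ (hst (s.steps + 1 + 1))
    refine sim_ite (fun h1 => ?_) fun h1 => ?_
    · rw [key] at h0 h1
      simpa [h1] using h _ (hst (s.steps + 1 + 1 + 1))
    refine sim_ite (fun h2 => ?_) fun h2 => ?_
    · rw [key] at h0 h1 h2
      simpa [h2] using h _ (hst (s.steps + 1 + 1 + 1 + 1))
    · rw [key] at h0 h1 h2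
      simpa [h0, h1, h2] using h _ (hst (s.steps + 1 + 1 + 1 + 1))

lemma runs_matchingProgram_unwind {t : ℕ} {Q : Machine → Prop} (hf : Fits L env n S M i r)
    (h6 : ofKind 6 env.inbox = [modePacket t]) (ht : t + 1 ≤ L.maxInt)
    (h : ∀ s, Started s (t + 1) → Runs (exec L env unwindRound s) Q) :
    Runs (exec L env matchingProgram Machine.init) Q := by
  refine runs_seq ((runs_scanMode hf ?_).mono ?_)
  · intro p hp h3
    have : p ∈ ofKind 6 env.inbox := mem_ofKind.2 ⟨hp, h3⟩
    rw [h6, List.mem_singleton] at this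
    rw [this]
    simpa [modePacket] using ht
  · intro s hs
    rw [h6] at hs
    simp only [List.getLast?_singleton, Option.elim_some] at hs
    have hs' : Started s (t + 1) := hs
    refine runs_ite (fun _ => ?_) fun h0 => ?_
    · exact h _ ⟨hs.halted, hs.result, hs.outbox, hs.weights, hs.mode, hs.ints⟩
    · simp [Test.eval, var, IExp.eval, hs'.mode] at h0

end Rounds

end MapReduce


namespace MapReduce

/-! ### The rounds of the whole network -/

section Network

variable {L : Limits} {n S M r H : ℕ}

/-- The limits suffice for `n` vertices and inboxes with at most `300 H` packets. -/
structure Ample (L : Limits) (n H : ℕ) : Prop where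
  two_le : 2 ≤ n
  le : n ≤ H
  cells : 1000 * H ≤ L.cells
  maxInt : 1000 * H ≤ L.maxInt
  maxSteps : 200 * (300 * H) ^ 2 ≤ L.maxSteps
  zero : (0 : ℝ) ∈ L.words

/-- The packets of each kind in each inbox are given by `c`. -/
structure Contents (L : Limits) (c : Fin M → ℕ → List Packet) (inb : Fin M → List Packet) :
    Prop where
  ofKind_eq : ∀ i k, ofKind k (inb i) = c i k
  valid : ∀ i, ∀ p ∈ inb i, L.Valid p

lemma length_eq_sum_ofKind {K : ℕ} {l : List Packet} (h : ∀ k, K ≤ k → ofKind k l = []) :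
    l.length = ∑ k ∈ Finset.range K, (ofKind k l).length := by
  have h' : ∀ p ∈ l, p.field 3 < K := by
    intro p hp
    by_contra hk
    have : p ∈ ofKind (p.field 3) l := mem_ofKind.2 ⟨hp, rfl⟩
    rw [h _ (not_lt.1 hk)] at this
    simp at this
  clear h
  induction l with
  | nil => simp [ofKind_nil]
  | cons a l ih =>
    rw [List.length_cons, ih fun p hp => h' p (List.mem_cons_of_mem _ hp)]
    have : ∀ k, (ofKind k (a :: l)).length
        = (ofKind k l).length + if a.field 3 = k then 1 else 0 := by
      intro k
      rw [ofKind_cons]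
      split_ifs <;> simp
    simp only [this, Finset.sum_add_distrib, Finset.sum_ite_eq, Finset.mem_range]
    rw [if_pos (h' a List.mem_cons_self)]

lemma ofKind_deliver (s : Fin M → Machine) (j : Fin M) (k : ℕ) :
    ofKind k (deliver s j) = (List.finRange M).flatMap fun i => pick k j (s i).outbox := by
  rw [deliver, ofKind, List.filter_flatMap]
  refine List.flatMap_congr fun i _ => ?_
  rw [List.filter_map, List.filter_filter, pick]
  congr 1
  refine List.filter_congr fun x _ => ?_
  simp [Bool.and_comm]

lemma contents_deliver {s : Fin M → Machine} (h : ∀ i, ∀ x ∈ (s i).outbox, L.Valid x.2) :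
    Contents L (fun j k => (List.finRange M).flatMap fun i => pick k j (s i).outbox)
      (deliver s) := by
  refine ⟨fun j k => ofKind_deliver s j k, fun j p hp => ?_⟩
  simp only [deliver, List.mem_flatMap, List.mem_map, List.mem_filter] at hp
  obtain ⟨i, -, x, ⟨hx, -⟩, rfl⟩ := hp
  exact h i x hx

lemma flatMap_finRange_single {β : Type} {i : Fin M} {g : Fin M → List β}
    (h : ∀ j, j ≠ i → g j = []) : (List.finRange M).flatMap g = g i := by
  induction M with
  | zero => exact i.elim0
  | succ M ih =>
    rw [List.finRange_succ, List.flatMap_cons, List.flatMap_map]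
    refine Fin.cases (fun h => ?_) (fun i h => ?_) i h
    · rw [List.flatMap_eq_nil_iff.2 fun j _ => h j.succ (Fin.succ_ne_zero j), List.append_nil]
    · rw [h 0 (Fin.succ_ne_zero i).symm, List.nil_append,
        ih fun j hj => h j.succ fun e => hj (Fin.succ_injective _ e)]

/-- What machine `i` reads in round `r`. -/
abbrev roundEnv (n S r : ℕ) (inb : Fin M → List Packet) (i : Fin M) : Env :=
  ⟨publicData n S M i r (inb i).length, inb i⟩

lemma Ample.fits (hA : Ample L n H) (hM : M ≤ n + 1) (hr : r ≤ 500 * n)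
    {inb : Fin M → List Packet} {i : Fin M} (hlen : (inb i).length ≤ 300 * H)
    (hv : ∀ p ∈ inb i, L.Valid p) : Fits L (roundEnv n S r inb i) n S M i r := by
  have h1 := hA.le
  have h2 := hA.cells
  have h3 := hA.maxInt
  have h4 := hA.two_le
  refine ⟨rfl, by omega, by omega, ?_, by omega, by omega, by omega, hv, hA.zero⟩
  change (inb i).length ≤ _
  omega

/-- Only sublists of `l` enter `expSub p q l`, so `F` may be raised to `⊤` elsewhere. -/
lemma Sim.and_sublist {α β : Type} {p q : ℝ≥0∞} {P : PMF (Option β)} {l : List α}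
    {Q : List α → β → Prop} (h : Sim p q P l Q) :
    Sim p q P l fun a b => a.Sublist l ∧ Q a b := by
  classical
  intro f F hF
  refine (h f (fun a => if a.Sublist l then F a else ⊤) fun a b hab => ?_).trans
    (expSub_mono fun a ha => by rw [if_pos ha])
  split_ifs with ha
  · exact hF a b ⟨ha, hab⟩
  · exact le_top

-- The interface between machines and network. Steps, inbox lengths and the validity of packets are
-- settled here, so the individual rounds only have to show what is sent and that outbox and result
-- are short.
open Classical in
lemma loss_run_succ_le_of_sim {α : Type} {p q : ℝ≥0∞} (hA : Ample L n H) (hM : M ≤ n + 1)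
    {inb : Fin M → List Packet} (hlen : ∀ i, (inb i).length ≤ 300 * H) {R : ℕ}
    {l : Fin M → List α} {Q : Fin M → List α → Machine → Prop}
    (h : ∀ i, Sim p q (exec L (roundEnv n S r inb i) matchingProgram Machine.init) (l i)
      fun a s => Q i a s ∧ s.outbox.length ≤ 1000 * H ∧ s.result.length ≤ 1000 * H)
    {f : List (ℕ × ℕ) → ℝ≥0∞} {F : List α → ℝ≥0∞}
    (hF : ∀ (a : Fin M → List α) (s : Fin M → Machine), (∀ i, Q i (a i) (s i)) →
      (∀ i, ∀ x ∈ (s i).outbox, L.Valid x.2) →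
      loss (if ∃ i, (s i).halted = true then
          PMF.pure (some ((List.finRange M).flatMap fun i => (s i).result))
        else run L matchingProgram n S R (r + 1) (deliver s)) f ≤ F ((List.finRange M).flatMap a)) :
    loss (run L matchingProgram n S (R + 1) r inb) f ≤ expSub p q ((List.finRange M).flatMap l) F := by
  have h1 := hA.le
  have h2 := hA.cells
  have h4 := hA.two_le
  rw [run, loss_andThen]
  refine Sim.parallel (fun i => sim_work (Q := Q i) matchingProgram_bounded ?_ ?_ ((h i).mono ?_)) _ _ ?_
  · exact (matchingProgram_cost (B := 300 * H) (by omega) (by change n ≤ _; omega)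
      (by change M ≤ _; omega) (hlen i)).trans hA.maxSteps
  · exact (hlen i).trans (by omega)
  · rintro a s ⟨g1, g2, g3⟩
    exact ⟨g1, g2.trans h2, g3.trans h2⟩
  · rintro _ s ⟨a, rfl, ha⟩
    exact hF a s (fun i => (ha i).1) fun i => (ha i).2

/-- A round in which no machine halts. -/
lemma loss_run_succ_le {α : Type} {p q : ℝ≥0∞} (hA : Ample L n H) (hM : M ≤ n + 1)
    (hr : r ≤ 500 * n) {inb : Fin M → List Packet} (hlen : ∀ i, (inb i).length ≤ 300 * H)
    (hv : ∀ i, ∀ p ∈ inb i, L.Valid p) {R : ℕ}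
    {l : Fin M → List α} (o : Fin M → List α → ℕ → Fin M → List Packet)
    (h : ∀ i, Fits L (roundEnv n S r inb i) n S M i r →
      Sim p q (exec L (roundEnv n S r inb i) matchingProgram Machine.init) (l i)
      fun a s => s.halted = false ∧ s.result.length ≤ n ∧ s.outbox.length ≤ 1000 * H ∧
        ∀ k (j : Fin M), pick k j s.outbox = o i a k j)
    {f : List (ℕ × ℕ) → ℝ≥0∞} {F : List α → ℝ≥0∞}
    (hF : ∀ (a : Fin M → List α) (inb' : Fin M → List Packet), (∀ i, (a i).Sublist (l i)) →
      Contents L (fun j k => (List.finRange M).flatMap fun i => o i (a i) k j) inb' →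
      loss (run L matchingProgram n S R (r + 1) inb') f ≤ F ((List.finRange M).flatMap a)) :
    loss (run L matchingProgram n S (R + 1) r inb) f ≤ expSub p q ((List.finRange M).flatMap l) F := by
  have h1 := hA.le
  refine loss_run_succ_le_of_sim hA hM hlen (Q := fun i a s => a.Sublist (l i) ∧ s.halted = false ∧
      ∀ k (j : Fin M), pick k j s.outbox = o i a k j)
    (fun i => (h i (hA.fits hM hr (hlen i) (hv i))).and_sublist.mono ?_) ?_
  · rintro a s ⟨g0, g1, g2, g3, g4⟩
    exact ⟨⟨g0, g1, g4⟩, g3, by omega⟩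
  · intro a s hs hval
    rw [if_neg (by simp [fun i => (hs i).2.1])]
    refine hF a _ (fun i => (hs i).1) ?_
    have := contents_deliver hval
    simpa only [(hs _).2.2] using this

/-- A deterministic round in which no machine halts. -/
lemma loss_run_succ_le_of_sim_nil (hA : Ample L n H) (hM : M ≤ n + 1)
    (hr : r ≤ 500 * n) {inb : Fin M → List Packet} (hlen : ∀ i, (inb i).length ≤ 300 * H)
    (hv : ∀ i, ∀ p ∈ inb i, L.Valid p) {R : ℕ} (o : Fin M → ℕ → Fin M → List Packet)
    (h : ∀ i, Fits L (roundEnv n S r inb i) n S M i r →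
      Sim (α := Unit) 1 0 (exec L (roundEnv n S r inb i) matchingProgram Machine.init) []
      fun _ s => s.halted = false ∧ s.result.length ≤ n ∧ s.outbox.length ≤ 1000 * H ∧
        ∀ k (j : Fin M), pick k j s.outbox = o i k j)
    {f : List (ℕ × ℕ) → ℝ≥0∞} {c : ℝ≥0∞}
    (hF : ∀ inb' : Fin M → List Packet,
      Contents L (fun j k => (List.finRange M).flatMap fun i => o i k j) inb' →
      loss (run L matchingProgram n S R (r + 1) inb') f ≤ c) :
    loss (run L matchingProgram n S (R + 1) r inb) f ≤ c := by
  -- A deterministic round makes its choices from the empty list, where the expectation is just the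
  -- value of the constant `F`.
  have := loss_run_succ_le (R := R) (f := f) hA hM hr hlen hv (α := Unit) (p := 1) (q := 0)
    (l := fun _ => []) (F := fun _ => c) (fun i _ => o i) h
    fun _ inb' _ => hF inb'
  rwa [expSub_one_zero] at this

end Network

end MapReduce


namespace MapReduce

/-! ### The packets between two rounds -/

section Shuffle

lemma pick_map {α : Type} (k j : ℕ) (l : List α) (d : α → ℕ) (g : α → Packet) {k₀ : ℕ}
    (hg : ∀ a, (g a).field 3 = k₀) :
    pick k j (l.map fun a => (d a, g a)) =
      if k = k₀ then (l.filter fun a => d a = j).map g else [] := by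
  rw [pick, List.filter_map, List.map_map]
  split_ifs with h
  · subst h
    congr 1
    exact List.filter_congr fun a _ => by simp [hg]
  · rw [List.map_eq_nil_iff, List.filter_eq_nil_iff]
    intro a _
    simp only [Function.comp, decide_eq_true_eq, hg]
    tauto

lemma filter_range_eq {M j : ℕ} (h : j < M) : ((List.range M).filter fun a => a = j) = [j] := by
  induction M with
  | zero => omega
  | succ M ih =>
    rw [List.range_succ, List.filter_append]
    rcases Nat.lt_succ_iff_lt_or_eq.1 h with h | rfl
    · rw [ih h, List.filter_cons_of_neg (by simp; omega), List.filter_nil, List.append_nil]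
    · rw [List.filter_cons_of_pos (by simp), List.filter_nil,
        List.filter_eq_nil_iff.2 (by simp; omega), List.nil_append]

lemma pick_broadcast {M : ℕ} (k : ℕ) (j : Fin M) (p : Packet) :
    pick k j ((List.range M).map fun x => (x, p)) = if k = p.field 3 then [p] else [] := by
  rw [pick_map (k₀ := p.field 3) _ _ _ _ _ fun _ => rfl, filter_range_eq j.2]
  rfl

lemma pick_singleton (k j i : ℕ) (p : Packet) :
    pick k j [(i, p)] = if j = i ∧ k = p.field 3 then [p] else [] := by
  rw [← List.nil_append [(i, p)], pick_concat]
  simp only [eq_comm (a := i), eq_comm (a := p.field 3), pick_nil, List.nil_append]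

lemma pick_forward (k i j : ℕ) (P : ℕ → Prop) [DecidablePred P] (l : List Packet) :
    pick k j (l.flatMap fun p => if P (p.field 3) then [(i, p)] else []) =
      if j = i ∧ P k then ofKind k l else [] := by
  induction l with
  | nil => simp [pick_nil, ofKind_nil]
  | cons a l ih =>
    rw [List.flatMap_cons, pick_append, ih, ofKind_cons]
    by_cases hk : a.field 3 = k
    · subst hk
      by_cases hj : j = i <;> by_cases hP : P (a.field 3) <;>
        simp [hj, hP, pick_singleton, pick_nil]
    · have hk' : ¬ k = a.field 3 := fun h => hk h.symm
      split_ifs <;> simp [pick_singleton, pick_nil, hk']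

lemma pick_reduced (k i j : ℕ) (l : List Packet) {g : Packet → List Packet}
    (hg : ∀ p, ∀ x ∈ g p, x.field 3 = 0) :
    pick k j (l.flatMap fun p => if p.field 3 = 0 then (g p).map fun x => (i, x) else
      if p.field 3 = 4 then [(i, p)] else []) =
      if j = i then if k = 0 then (ofKind 0 l).flatMap g else if k = 4 then ofKind 4 l else []
      else [] := by
  induction l with
  | nil => simp [pick_nil, ofKind_nil]
  | cons a l ih =>
    have h1 : pick k j ((g a).map fun x => (i, x)) = if j = i ∧ k = 0 then g a else [] := by
      rw [pick, List.filter_map, List.map_map]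
      split_ifs with h
      · obtain ⟨rfl, rfl⟩ := h
        rw [List.filter_eq_self.2 fun x hx => by simp [hg a x hx]]
        simp [Function.comp_def]
      · rw [List.map_eq_nil_iff, List.filter_eq_nil_iff]
        intro x hx
        simp only [Function.comp, decide_eq_true_eq, hg a x hx]
        tauto
    rw [List.flatMap_cons, pick_append, ih, ofKind_cons, ofKind_cons]
    by_cases h0 : a.field 3 = 0
    · rw [if_pos h0, h1, if_pos h0, if_neg (show ¬ a.field 3 = 4 by omega)]
      by_cases hj : j = i <;> by_cases hk : k = 0 <;> simp [hj, hk]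
    · rw [if_neg h0, if_neg h0]
      by_cases h4 : a.field 3 = 4
      · rw [if_pos h4, if_pos h4]
        rw [pick_singleton, h4]
        by_cases hj : j = i
        · by_cases hk : k = 4 <;> simp [hj, hk]
        · simp [hj]
      · rw [if_neg h4, if_neg h4, pick_nil, List.nil_append]

lemma pick_relayed {M : ℕ} (k i : ℕ) (j : Fin M) (l : List Packet) :
    pick k j (l.flatMap fun p =>
      if p.field 3 = 3 then (List.range M).map fun j => (j, p) else [(i, p)]) =
      if k = 3 ∨ j = i then ofKind k l else [] := by
  induction l with
  | nil => simp [pick_nil, ofKind_nil]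
  | cons a l ih =>
    rw [List.flatMap_cons, pick_append, ih, ofKind_cons]
    by_cases h3 : a.field 3 = 3
    · rw [if_pos h3, pick_broadcast, h3]
      by_cases hk : k = 3
      · simp [hk]
      · simp [hk, Ne.symm hk]
    · rw [if_neg h3, pick_singleton]
      by_cases hk : k = a.field 3
      · have hk3 : ¬ k = 3 := by omega
        by_cases hj : (j : ℕ) = i <;> simp [hk, hj, h3]
      · have hk' : ¬ a.field 3 = k := fun h => hk h.symm
        simp [hk, hk']

lemma length_relayed_le (M i : ℕ) (l : List Packet) :
    (l.flatMap fun p => if p.field 3 = 3 then (List.range M).map fun j => (j, p) else [(i, p)]).length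
      ≤ l.length + (ofKind 3 l).length * M := by
  induction l with
  | nil => simp
  | cons a l ih =>
    rw [List.flatMap_cons, List.length_append, ofKind_cons, List.length_cons]
    split_ifs with h
    · simp only [List.length_map, List.length_range, List.length_cons]
      linarith
    · simp only [List.length_cons, List.length_nil]
      linarith

/-- A machine receives at most `n / M + 1` changes of potentials, so relaying them to all machines
needs at most `n + M` packets. -/
lemma length_filter_mod_mul_le (n : ℕ) {M : ℕ} (i : Fin M) :
    ((List.range n).filter fun v => v % M = i).length * M ≤ n + M := by
  have h := Nat.count_modEq_card n i.pos (i : ℕ)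
  rw [Nat.count, List.countP_eq_length_filter] at h
  simp only [Nat.ModEq, Nat.mod_eq_of_lt i.2] at h
  rw [h]
  have := Nat.div_mul_le_self n M
  split_ifs <;> nlinarith

lemma length_flatMap_filter_mod (n : ℕ) {M : ℕ} (hM : 0 < M) :
    ((List.finRange M).flatMap fun i : Fin M => (List.range n).filter fun v => v % M = i).length
      = n := by
  induction n with
  | zero => simp
  | succ n ih =>
    have h : ∀ (l : List (Fin M)) (g g' : Fin M → List ℕ),
        (l.flatMap fun i => g i ++ g' i).length = (l.flatMap g).length + (l.flatMap g').length := by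
      intro l g g'
      induction l with
      | nil => rfl
      | cons a l ih =>
        simp only [List.flatMap_cons, List.length_append, ih]
        omega
    simp only [List.range_succ, List.filter_append, h, ih]
    rw [flatMap_finRange_single (i := ⟨n % M, Nat.mod_lt _ hM⟩)]
    · simp
    · intro j hj
      rw [List.filter_eq_nil_iff]
      intro v hv
      rw [List.mem_singleton.1 hv]
      intro e
      exact hj (Fin.ext (by simpa using e : n % M = j).symm)

end Shuffle

end MapReduce


namespace MapReduce

/-! ### The four rounds of a phase -/

section Phase

variable {L : Limits} {n S M r H : ℕ} {w : Sym2 (Fin n) → ℝ} {φ φ₀ : ℕ → ℝ}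
  {X : Fin M → List (Fin n × Fin n)} {lay : ℕ → List (Fin n × Fin n)}
  {inb : Fin M → List Packet} {R : ℕ} {f : List (ℕ × ℕ) → ℝ≥0∞}

/-- The inboxes if machine `i` stores the edges `X i` with their residual weights and the edges
`lay i` of the stack, and has received the packets `extra i` of kind `k₀` besides. -/
noncomputable def holding (w : Sym2 (Fin n) → ℝ) (φ : ℕ → ℝ) (X : Fin M → List (Fin n × Fin n))
    (lay : ℕ → List (Fin n × Fin n)) (k₀ : ℕ) (extra : Fin M → List Packet) (i : Fin M) (k : ℕ) :
    List Packet :=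
  if k = k₀ then extra i else if k = 0 then (X i).map (arcPacket w φ 0) else
    if k = 4 then (lay i).map (plainPacket 4) else []

lemma Contents.length_le {k₀ : ℕ} {extra : Fin M → List Packet}
    (hc : Contents L (holding w φ X lay k₀ extra) inb) (h0 : k₀ < 4) (i : Fin M) :
    (inb i).length ≤ (extra i).length + (X i).length + (lay i).length := by
  rw [length_eq_sum_ofKind (K := 5)]
  · simp only [Finset.sum_range_succ, Finset.sum_range_zero, hc.ofKind_eq, holding]
    interval_cases k₀ <;> simp <;> omega
  · intro k hk
    rw [hc.ofKind_eq, holding, if_neg (by omega), if_neg (by omega), if_neg (by omega)]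

/-- Stored edges and layers are sent by each machine to itself. Only the packets of the
distinguished kind `k₀` move between machines. -/
lemma holding_of_deliver {k₀ : ℕ} {extra : Fin M → List Packet}
    {o : Fin M → ℕ → Fin M → List Packet}
    (h0 : ∀ j, ((List.finRange M).flatMap fun i => o i k₀ j) = extra j)
    (h : ∀ i k j, k ≠ k₀ → o i k j = if (j : ℕ) = i then holding w φ X lay k₀ extra i k else []) :
    (fun (j : Fin M) k => (List.finRange M).flatMap fun i => o i k j)
      = holding w φ X lay k₀ extra := by
  funext j k
  by_cases hk : k = k₀
  · rw [hk, h0, holding, if_pos rfl]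
  · simp only [fun i => h i k j hk]
    rw [flatMap_finRange_single (i := j), if_pos rfl]
    intro i hi
    exact if_neg fun e => hi (Fin.ext e).symm

lemma reducePacket_arcPacket {ψ : ℕ → ℝ} (hψ : ∀ x, ψ x = φ x - φ₀ x) (a : Fin n × Fin n) :
    reducePacket ψ (arcPacket w φ₀ 0 a) = arcPacket w φ 0 a := by
  simp only [reducePacket, arcPacket, residual, Matrix.cons_val_zero, Matrix.cons_val_one, hψ,
    Packet.mk.injEq, true_and]
  ring

open Classical in
lemma flatMap_reducePacket {ψ : ℕ → ℝ} (hψ : ∀ x, ψ x = φ x - φ₀ x) (l : List (Fin n × Fin n)) :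
    ((l.map (arcPacket w φ₀ 0)).flatMap fun p =>
      if 0 < (reducePacket ψ p).weight then [reducePacket ψ p] else [])
      = (alive w φ l).map (arcPacket w φ 0) := by
  induction l with
  | nil => rfl
  | cons a l ih =>
    rw [List.map_cons, List.flatMap_cons, ih, reducePacket_arcPacket hψ]
    change (if 0 < residual w φ a then _ else _) ++ _ = _
    by_cases h : 0 < residual w φ a <;> simp [h, alive]

open Classical in
lemma countP_reducePacket {ψ : ℕ → ℝ} (hψ : ∀ x, ψ x = φ x - φ₀ x) (l : List (Fin n × Fin n)) :
    (l.map (arcPacket w φ₀ 0)).countP (fun p => 0 < (reducePacket ψ p).weight)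
      = (alive w φ l).length := by
  rw [List.countP_map, List.countP_eq_length_filter, alive]
  congr 1
  refine List.filter_congr fun a _ => ?_
  simp only [Function.comp, reducePacket_arcPacket hψ]
  rfl

lemma alive_length_le (l : List (Fin n × Fin n)) : (alive w φ l).length ≤ l.length :=
  List.length_filter_le ..

/-- A stored residual under `φ₀`, reduced by the two differences in `pot`, is the residual under
`φ`. All machines have the same `pot`, so together they hold exactly the edges alive under `φ`, and
all learn the same counts. -/
lemma loss_run_reduce (hA : Ample L n H) (hM : M ≤ n + 1) (hr : r ≤ 500 * n) (hr4 : r % 4 = 0)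
    {pot : List Packet} (hc : Contents L (holding w φ₀ X lay 3 fun _ => pot) inb)
    (hX : ∀ i, (X i).length ≤ H) (hlay : ∀ i, (lay i).length ≤ n) (hpot : pot.length ≤ n)
    (hpot₁ : ∀ p ∈ pot, ∃ v < n, p = potentialPacket (fun x => φ x - φ₀ x) v)
    (hpot₂ : ∀ v < n, φ v - φ₀ v = 0 ∨ potentialPacket (fun x => φ x - φ₀ x) v ∈ pot)
    (hw : ∀ i, ∀ a ∈ X i, residual w φ a ∈ L.words) {c : ℝ≥0∞}
    (hF : ∀ inb' : Fin M → List Packet, Contents L (holding w φ (fun i => alive w φ (X i)) lay 1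
        fun _ => (List.finRange M).map fun j => countPacket (alive w φ (X j)).length) inb' →
      loss (run L matchingProgram n S R (r + 1) inb') f ≤ c) :
    loss (run L matchingProgram n S (R + 1) r inb) f ≤ c := by
  classical
  have h1 := hA.le
  have h2 := hA.two_le
  have hlen : ∀ i, (inb i).length ≤ 3 * H := fun i => by
    have := hc.length_le (by norm_num) i
    have := hX i
    have := hlay i
    omega
  refine loss_run_succ_le_of_sim_nil hA hM hr (fun i => (hlen i).trans (by omega)) hc.valid
    (fun i k j => if k = 1 then [countPacket (alive w φ (X i)).length] else if (j : ℕ) = i then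
      holding w φ (fun i => alive w φ (X i)) lay 1
        (fun _ => (List.finRange M).map fun j => countPacket (alive w φ (X j)).length) i k else [])
    (fun i hf => ?_) fun inb' h => hF inb' ?_
  · refine sim_matchingProgram hf (by rw [hc.ofKind_eq]; rfl) fun s hs => ?_
    rw [if_pos hr4]
    have h3 : ∀ p, p ∈ inb i ∧ p.field 3 = 3 ↔ p ∈ pot := fun p => by
      rw [← mem_ofKind, hc.ofKind_eq]; rfl
    have h0 : ofKind 0 (inb i) = (X i).map (arcPacket w φ₀ 0) := hc.ofKind_eq i 0
    have h4 : ofKind 4 (inb i) = (lay i).map (plainPacket 4) := hc.ofKind_eq i 4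
    refine (Runs.mono (runs_reduceRound hf hs (ψ := fun x => φ x - φ₀ x) ?_ ?_ ?_) ?_).sim
    · intro p hp hk
      obtain ⟨v, hv, rfl⟩ := hpot₁ p ((h3 p).1 ⟨hp, hk⟩)
      exact ⟨hv, rfl⟩
    · intro v hv
      refine (hpot₂ v hv).imp_right fun h => ⟨_, ((h3 _).2 h).1, ((h3 _).2 h).2, rfl⟩
    · intro p hp hk
      have : p ∈ ofKind 0 (inb i) := mem_ofKind.2 ⟨hp, hk⟩
      rw [h0, List.mem_map] at this
      obtain ⟨a, ha, rfl⟩ := this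
      refine ⟨a.1.2, a.2.2, ?_⟩
      rw [reducePacket_arcPacket fun _ => rfl]
      exact hw i a ha
    · rintro s' ⟨g1, g2, g3⟩
      refine ⟨g1, by simp [g2], ?_, fun k j => ?_⟩
      · rw [g3, List.length_append, List.length_map, List.length_range]
        refine (Nat.add_le_add_right (length_flatMap_le _ _ 1 ?_) _).trans ?_
        · intro p _
          split_ifs <;> simp
        · have h5 : (roundEnv n S r inb i).inbox.length ≤ 3 * H := hlen i
          omega
      · have hg := pick_reduced k i j (inb i) (g := fun p =>
          if 0 < (reducePacket (fun x => φ x - φ₀ x) p).weight then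
            [reducePacket (fun x => φ x - φ₀ x) p] else []) (by
              intro p x hx
              split_ifs at hx
              · rw [List.mem_singleton.1 hx]
                rfl
              · simp at hx)
        simp only [apply_ite (List.map _), List.map_singleton, List.map_nil] at hg
        rw [g3, pick_append, pick_broadcast]
        refine (congrArg (· ++ _) hg).trans ?_
        rw [h0, flatMap_reducePacket fun _ => rfl, countP_reducePacket fun _ => rfl, h4]
        by_cases hk : k = 1
        · subst hk
          simp [countPacket]
        · simp [hk, countPacket, holding]
  · rwa [holding_of_deliver] at h
    · intro j
      simp only [if_true]
      generalize List.finRange M = l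
      induction l with
      | nil => rfl
      | cons a l ih => simp [ih]
    · intro i k j hk
      rw [if_neg hk]

lemma arcs_flatMap {α : Type} (l : List α) (g : α → List (Fin n × Fin n)) :
    arcs (l.flatMap g) = l.flatMap fun x => arcs (g x) := by
  rw [arcs, List.flatMap_assoc]
  rfl

/-- The inboxes before layer `t` of the stack is unwound, if `m` is the matching so far. -/
def unwinding (lay : ℕ → List (Fin n × Fin n)) (t : ℕ) (m : List (Fin n × Fin n)) (i : Fin M)
    (k : ℕ) : List Packet :=
  if k = 4 then (lay i).map (plainPacket 4) else
    if k = 5 then if (i : ℕ) = t then m.map (plainPacket 5) else [] else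
    if k = 6 then [modePacket t] else []

lemma exists_leftInverse_arcPacket (hn : 2 ≤ n) (w : Sym2 (Fin n) → ℝ) (φ : ℕ → ℝ) (k : ℕ) :
    ∃ dec : Packet → Fin n × Fin n, ∀ a, dec (arcPacket w φ k a) = a := by
  have : Nonempty (Fin n × Fin n) := ⟨(⟨0, by omega⟩, ⟨0, by omega⟩)⟩
  exact ⟨Function.invFun (arcPacket w φ k),
    Function.leftInverse_invFun (arcPacket_injective w φ k)⟩

/-- The common part of the cases `0 < N`, where the phase continues, and `N = 0`, where unwinding
starts. The inboxes are left as a concatenation over the senders, because the two cases simplify it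
differently. -/
lemma loss_run_sample_aux (hA : Ample L n H) (hM : M ≤ n + 1) (hr : r ≤ 500 * n) (hr4 : r % 4 = 1)
    (hc : Contents L (holding w φ X lay 1
      fun _ => (List.finRange M).map fun j => countPacket (X j).length) inb)
    (hX : ∀ i, (X i).length ≤ H) (hlay : ∀ i, (lay i).length ≤ n) {N : ℕ}
    (hN : ((List.finRange M).flatMap X).length = N) (hN' : N ≤ L.maxInt)
    {F : List (Fin n × Fin n) → ℝ≥0∞}
    (hF : ∀ (a : Fin M → List (Fin n × Fin n)) (inb' : Fin M → List Packet),
      (∀ i, (a i).Sublist (arcs (X i))) →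
      Contents L (fun j k => (List.finRange M).flatMap fun i : Fin M =>
        if k = 6 then if N = 0 ∧ (j : ℕ) = i then [modePacket (r / 4 - 1)] else []
        else if k = 2 then if (j : ℕ) = 0 then (a i).map (arcPacket w φ 2) else []
        else if (j : ℕ) = i then holding w φ X lay 2 (fun _ => []) i k else []) inb' →
      loss (run L matchingProgram n S R (r + 1) inb') f ≤ F ((List.finRange M).flatMap a)) :
    loss (run L matchingProgram n S (R + 1) r inb) f ≤
      expSub (keepProb N S) (dropProb N S) (arcs ((List.finRange M).flatMap X)) F := by
  have h1 := hA.le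
  have h2 := hA.two_le
  have hlen : ∀ i, (inb i).length ≤ 5 * H := fun i => by
    have := hc.length_le (by norm_num) i
    have := hX i
    have := hlay i
    simp only [List.length_map, List.length_finRange] at *
    omega
  rw [arcs_flatMap]
  refine loss_run_succ_le hA hM hr (fun i => (hlen i).trans (by omega)) hc.valid
    (fun i a k j => if k = 6 then if N = 0 ∧ (j : ℕ) = i then [modePacket (r / 4 - 1)] else []
        else if k = 2 then if (j : ℕ) = 0 then a.map (arcPacket w φ 2) else []
        else if (j : ℕ) = i then holding w φ X lay 2 (fun _ => []) i k else [])
    (fun i hf => ?_) fun a inb' ha h => hF a inb' ha h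
  refine sim_matchingProgram hf (by rw [hc.ofKind_eq]; rfl) fun s hs => ?_
  rw [if_neg (by omega), if_pos hr4]
  obtain ⟨dec, hdec⟩ := exists_leftInverse_arcPacket h2 w φ 0
  refine Sim.mono (sim_sampleRound hf hs (N := N) hdec (hc.ofKind_eq i 0) ?_ hN' ?_) ?_
  · rw [hc.ofKind_eq, ← hN, List.length_flatMap]
    simp [holding, countPacket, Function.comp_def]
  · rw [← hN, List.length_flatMap]
    exact List.single_le_sum (by simp) _ (List.mem_map_of_mem (List.mem_finRange i))
  · rintro a s' ⟨g1, g2, g3, g4⟩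
    refine ⟨g1, by simp [g2], ?_, fun k j => ?_⟩
    · have h5 : (roundEnv n S r inb i).inbox.length ≤ 5 * H := hlen i
      omega
    · rw [g4]
      by_cases h6 : k = 6
      · rw [if_pos h6, if_pos h6]
      · rw [if_neg h6, if_neg h6, sampleContent, hc.ofKind_eq, hc.ofKind_eq]
        by_cases h0 : k = 0
        · simp [h0, holding]
        by_cases h2 : k = 2
        · simp [h2]
        · by_cases h4 : k = 4 <;> simp [h0, h2, h4, holding]

lemma loss_run_sample (hA : Ample L n H) (hM : M ≤ n + 1) (hr : r ≤ 500 * n) (hr4 : r % 4 = 1)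
    (hc : Contents L (holding w φ X lay 1
      fun _ => (List.finRange M).map fun j => countPacket (X j).length) inb)
    (hX : ∀ i, (X i).length ≤ H) (hlay : ∀ i, (lay i).length ≤ n) {N : ℕ}
    (hN : ((List.finRange M).flatMap X).length = N) (hN' : N ≤ L.maxInt) (h0 : 0 < N)
    {F : List (Fin n × Fin n) → ℝ≥0∞}
    (hF : ∀ (a : List (Fin n × Fin n)) (inb' : Fin M → List Packet),
      a.Sublist (arcs ((List.finRange M).flatMap X)) →
      Contents L (holding w φ X lay 2
        fun i => if (i : ℕ) = 0 then a.map (arcPacket w φ 2) else []) inb' →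
      loss (run L matchingProgram n S R (r + 1) inb') f ≤ F a) :
    loss (run L matchingProgram n S (R + 1) r inb) f ≤
      expSub (keepProb N S) (dropProb N S) (arcs ((List.finRange M).flatMap X)) F := by
  refine loss_run_sample_aux hA hM hr hr4 hc hX hlay hN hN' fun a inb' ha h => hF _ _ ?_ ?_
  · rw [arcs_flatMap]
    generalize List.finRange M = l
    induction l with
    | nil => simp
    | cons x l ih => exact (ha x).append ih
  · convert h using 1
    symm
    refine holding_of_deliver (fun j => ?_) fun i k j hk => ?_
    · rw [List.map_flatMap]
      by_cases hj : (j : ℕ) = 0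
      · simp only [hj, if_true]
        rfl
      · simp [hj]
    · simp only [hk, h0.ne', false_and, if_false]
      by_cases h6 : k = 6
      · simp [h6, holding]
      · simp [h6, hk, holding]

lemma loss_run_sample_nil (hA : Ample L n H) (hM : M ≤ n + 1) (hr : r ≤ 500 * n) (hr4 : r % 4 = 1)
    (hc : Contents L (holding w φ X lay 1
      fun _ => (List.finRange M).map fun j => countPacket (X j).length) inb)
    (hX : ∀ i, X i = []) (hlay : ∀ i, (lay i).length ≤ n) {c : ℝ≥0∞}
    (hF : ∀ inb' : Fin M → List Packet, Contents L (unwinding lay (r / 4 - 1) []) inb' →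
      loss (run L matchingProgram n S R (r + 1) inb') f ≤ c) :
    loss (run L matchingProgram n S (R + 1) r inb) f ≤ c := by
  have hE : (List.finRange M).flatMap X = [] := List.flatMap_eq_nil_iff.2 fun i _ => hX i
  have := loss_run_sample_aux (R := R) (S := S) (f := f) hA hM hr hr4 hc (fun i => by simp [hX i])
    hlay (N := 0) (by rw [hE]; rfl) (Nat.zero_le _) (F := fun _ => c) fun a inb' ha h => hF _ ?_
  · rwa [hE] at this
  · convert h using 1
    funext j k
    have ha' : ∀ i, a i = [] := fun i => by
      have := ha i
      rw [hX i] at this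
      exact List.sublist_nil.1 this
    rw [flatMap_finRange_single (i := j)]
    · simp only [ha', unwinding, holding, hX, List.map_nil]
      split_ifs <;> simp_all
    · intro i hi
      have : ¬ (j : ℕ) = i := fun e => hi (Fin.ext e).symm
      simp [this, ha']

/-- Layer `t` was empty before (`hlayt`), so machine `t` afterwards holds exactly the pushes of this
phase in their order. The stack discipline depends on this order. -/
lemma loss_run_push (hA : Ample L n H) (hM : M ≤ n + 1) (hr : r ≤ 500 * n) {t : ℕ}
    (hr4 : r = 4 * t + 2) (ht : t < M) {l : List (Fin n × Fin n)}
    (hc : Contents L (holding w φ X lay 2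
        fun i => if (i : ℕ) = 0 then l.map (arcPacket w φ 2) else []) inb)
    (hX : ∀ i, (X i).length ≤ H) (hlay : ∀ i, (lay i).length ≤ n) (hlayt : lay t = [])
    (hl : l.length ≤ 256 * H) (hne : ∀ a ∈ l, a.1 ≠ a.2)
    (hres : ∀ u, u ≤ n → ∀ a ∈ l, residual w (push w φ (pushed w φ l u)) a ∈ L.words)
    (hP : ∀ u, u ≤ n → ∀ x, push w φ (pushed w φ l u) x - φ x ∈ L.words) {c : ℝ≥0∞}
    (hF : ∀ inb' : Fin M → List Packet, Contents L (holding w φ X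
        (Function.update lay t (pushed w φ l n)) 3
        fun i => ((List.range n).filter fun v => v % M = i).map
          (potentialPacket fun x => push w φ (pushed w φ l n) x - φ x)) inb' →
      loss (run L matchingProgram n S R (r + 1) inb') f ≤ c) :
    loss (run L matchingProgram n S (R + 1) r inb) f ≤ c := by
  have h1 := hA.le
  have h2 := hA.two_le
  have hM0 : 0 < M := by omega
  have hlen : ∀ i, (inb i).length ≤ 258 * H := fun i => by
    have := hc.length_le (by norm_num) i
    have := hX i
    have := hlay i
    split_ifs at * <;> simp only [List.length_map, List.length_nil] at * <;> omega
  refine loss_run_succ_le_of_sim_nil hA hM hr (fun i => (hlen i).trans (by omega)) hc.valid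
    (fun i k j =>
      if k = 3 then if (i : ℕ) = 0 then ((List.range n).filter fun v => v % M = j).map
          (potentialPacket fun x => push w φ (pushed w φ l n) x - φ x) else []
      else (if (j : ℕ) = i ∧ (k = 0 ∨ k = 4) then ofKind k (inb i) else []) ++
        if (i : ℕ) = 0 ∧ (j : ℕ) = t ∧ k = 4 then (pushed w φ l n).map (plainPacket 4) else [])
    (fun i hf => ?_) fun inb' h => hF inb' ?_
  · refine sim_matchingProgram hf (by rw [hc.ofKind_eq]; rfl) fun s hs => ?_
    rw [if_neg (by omega), if_neg (by omega), if_pos (by omega)]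
    by_cases hi : (i : ℕ) = 0
    · have hl' : ofKind 2 (inb i) = l.map (arcPacket w φ 2) := by
        rw [hc.ofKind_eq, holding, if_pos rfl, if_pos hi]
      rw [hi] at hf ⊢
      refine (Runs.mono (runs_pushRound_central hf hs hl' hne hres hP) ?_).sim
      rintro s' ⟨g1, g2, g3⟩
      refine ⟨g1, by simp [g2], ?_, fun k j => ?_⟩
      · rw [g3, List.length_append, List.length_append, List.length_map, List.length_map,
          List.length_range]
        have h6 := length_pushed_le (w := w) φ l n
        refine (Nat.add_le_add_right (Nat.add_le_add_right (length_flatMap_le _ _ 1 ?_) _) _).trans ?_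
        · intro p _
          split_ifs <;> simp
        · have h5 : (roundEnv n S r inb i).inbox.length ≤ 258 * H := hlen i
          omega
      · rw [g3, pick_append, pick_append, pick_forward k 0 j fun k => k = 0 ∨ k = 4,
          pick_map (k₀ := 4) _ _ _ _ _ (fun _ => rfl), pick_map (k₀ := 3) _ _ _ _ _ (fun _ => rfl),
          show r / 4 = t by omega]
        by_cases h3 : k = 3
        · simp [h3]
        by_cases h4 : k = 4
        · by_cases hj : (j : ℕ) = t
          · simp [h4, hj]
          · simp [h4, hj, Ne.symm hj]
        · simp [h3, h4]
    · refine (Runs.mono (runs_pushRound_idle hf hs hi) ?_).sim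
      rintro s' ⟨g1, g2, g3⟩
      refine ⟨g1, by simp [g2], ?_, fun k j => ?_⟩
      · rw [g3]
        refine (length_flatMap_le _ _ 1 ?_).trans ?_
        · intro p _
          split_ifs <;> simp
        · have h5 : (roundEnv n S r inb i).inbox.length ≤ 258 * H := hlen i
          omega
      · rw [g3, pick_forward k i j fun k => k = 0 ∨ k = 4]
        by_cases h3 : k = 3 <;> simp [hi, h3]
  · convert h using 1
    funext j k
    by_cases h3 : k = 3
    · simp only [h3, if_true, holding]
      rw [flatMap_finRange_single (i := ⟨0, hM0⟩), if_pos rfl]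
      intro i hi
      exact if_neg fun e => hi (Fin.ext e)
    simp only [h3, if_false, holding, hc.ofKind_eq]
    -- Packets of the new layer come from machine `0`, all other packets of these kinds from the
    -- receiver itself. Machine `t` has no older layer to forward, also when it is machine `0`.
    by_cases h4 : k = 4 ∧ (j : ℕ) = t
    · obtain ⟨rfl, h4⟩ := h4
      rw [flatMap_finRange_single (i := ⟨0, hM0⟩)]
      · by_cases h0 : t = 0
        · subst h0
          simp [h4, hlayt]
        · simp [h4, h0]
      · intro i hi
        have : ¬ (i : ℕ) = 0 := fun e => hi (Fin.ext e)
        simp only [this, false_and, if_false, List.append_nil]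
        by_cases h0 : t = i
        · simp [← h0, h4, hlayt]
        · simp [h4, h0]
    · rw [flatMap_finRange_single (i := j)]
      · by_cases hk4 : k = 4
        · have : ¬ (j : ℕ) = t := fun e => h4 ⟨hk4, e⟩
          simp [hk4, this]
        · by_cases hk0 : k = 0 <;> simp [hk4, hk0]
      · intro i hi
        have : ¬ (j : ℕ) = i := fun e => hi (Fin.ext e).symm
        have h5 : ¬ ((i : ℕ) = 0 ∧ (j : ℕ) = t ∧ k = 4) := fun e => h4 ⟨e.2.2, e.2.1⟩
        simp [this, h5]

lemma loss_run_relay (hA : Ample L n H) (hM : M ≤ n + 1) (hr : r ≤ 500 * n) (hr4 : r % 4 = 3)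
    {ψ : ℕ → ℝ}
    (hc : Contents L (holding w φ X lay 3
        fun i => ((List.range n).filter fun v => v % M = i).map (potentialPacket ψ)) inb)
    (hX : ∀ i, (X i).length ≤ H) (hlay : ∀ i, (lay i).length ≤ n) {c : ℝ≥0∞}
    (hF : ∀ inb' : Fin M → List Packet, Contents L (holding w φ X lay 3
        fun _ => (List.finRange M).flatMap fun i : Fin M =>
          ((List.range n).filter fun v => v % M = i).map (potentialPacket ψ)) inb' →
      loss (run L matchingProgram n S R (r + 1) inb') f ≤ c) :
    loss (run L matchingProgram n S (R + 1) r inb) f ≤ c := by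
  have h1 := hA.le
  have h2 := hA.two_le
  have hlen : ∀ i, (inb i).length ≤ 3 * H := fun i => by
    have h3 := hc.length_le (by norm_num) i
    have := hX i
    have := hlay i
    have h4 := List.length_filter_le (fun v => decide (v % M = (i : ℕ))) (List.range n)
    rw [List.length_map] at h3
    rw [List.length_range] at h4
    omega
  refine loss_run_succ_le_of_sim_nil hA hM hr (fun i => (hlen i).trans (by omega)) hc.valid
    (fun i k j => if k = 3 ∨ (j : ℕ) = i then ofKind k (inb i) else [])
    (fun i hf => ?_) fun inb' h => hF inb' ?_
  · refine sim_matchingProgram hf (by rw [hc.ofKind_eq]; rfl) fun s hs => ?_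
    rw [if_neg (by omega), if_neg (by omega), if_neg (by omega)]
    refine (Runs.mono (runs_relayRound hf hs) ?_).sim
    rintro s' ⟨g1, g2, g3⟩
    refine ⟨g1, by simp [g2], ?_, fun k j => ?_⟩
    · rw [g3]
      refine (length_relayed_le _ _ _).trans ?_
      have h5 : (roundEnv n S r inb i).inbox.length ≤ 3 * H := hlen i
      have h6 := length_filter_mod_mul_le n i
      rw [hc.ofKind_eq, holding, if_pos rfl, List.length_map]
      omega
    · rw [g3, pick_relayed]
  · rw [holding_of_deliver] at h
    · exact h
    · intro j
      simp [hc.ofKind_eq, holding]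
    · intro i k j hk
      simp [hc.ofKind_eq, holding, hk]

end Phase

end MapReduce


namespace MapReduce

/-! ### Unwinding the stack -/

section Unwinding

variable {L : Limits} {n S M H : ℕ} {f : List (ℕ × ℕ) → ℝ≥0∞}

/-- The first end points of the edges of a matching are distinct vertices. -/
lemma length_unwind_nil_le (l : List (Fin n × Fin n)) : (unwind [] l).length ≤ n := by
  have h : ((unwind [] l).map Prod.fst).Nodup := by
    rw [List.Nodup, List.pairwise_map]
    exact (indepList_unwind l).imp fun h => h.1
  simpa using h.length_le_card

lemma Contents.length_le_of_unwinding {lay : ℕ → List (Fin n × Fin n)} {t : ℕ}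
    {l : List (Fin n × Fin n)} {inb : Fin M → List Packet}
    (hc : Contents L (unwinding lay t (unwind [] l)) inb) (hlay : ∀ i, (lay i).length ≤ n)
    (i : Fin M) : (inb i).length ≤ 2 * n + 1 := by
  have h1 := hlay i
  have h2 := length_unwind_nil_le l
  rw [length_eq_sum_ofKind (K := 7)]
  · simp only [Finset.sum_range_succ, Finset.sum_range_zero, hc.ofKind_eq, unwinding]
    by_cases hi : (i : ℕ) = t
    · rw [hi] at h1
      simp [hi]
      omega
    · simp [hi]
      omega
  · intro k hk
    rw [hc.ofKind_eq, unwinding, if_neg (by omega), if_neg (by omega), if_neg (by omega)]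

/-- Induction on the layer: `l` consists of the layers already unwound, and `unwind_append` lets the
active machine continue from the matching it received. One round is spent per layer. -/
lemma loss_run_unwind (hA : Ample L n H) (hM : M ≤ n + 1) {t : ℕ}
    {lay : ℕ → List (Fin n × Fin n)} {l : List (Fin n × Fin n)} {inb : Fin M → List Packet}
    {R r : ℕ} (hc : Contents L (unwinding lay t (unwind [] l)) inb)
    (hlay : ∀ i, (lay i).length ≤ n) (ht : t < M) (hr : r + t ≤ 500 * n) (hR : t < R) :
    loss (run L matchingProgram n S R r inb) f ≤
      f ((unwind [] ((List.range (t + 1)).flatMap lay ++ l)).map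
        fun a => ((a.1 : ℕ), (a.2 : ℕ))) := by
  have h1 := hA.le
  have h2 := hA.two_le
  have h3 := hA.maxInt
  induction t generalizing lay l inb R r with
  | zero =>
    obtain ⟨R, rfl⟩ : ∃ R', R = R' + 1 := ⟨R - 1, by omega⟩
    have hlen := hc.length_le_of_unwinding hlay
    have key := loss_run_succ_le_of_sim (S := S) (r := r) (R := R) (f := f) (α := Unit) (p := 1)
      (q := 0) (F := fun _ => f ((unwind [] (lay 0 ++ l)).map fun a => ((a.1 : ℕ), (a.2 : ℕ))))
      hA hM (fun i => (hlen i).trans (by omega))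
      (l := fun _ => []) (Q := fun i _ s => (s.halted = true ↔ (i : ℕ) = 0) ∧
        s.result = if (i : ℕ) = 0 then
          (unwind [] (lay 0 ++ l)).map fun a => ((a.1 : ℕ), (a.2 : ℕ)) else [])
      (fun i => Runs.sim ?_) ?_
    · rw [expSub_one_zero] at key
      simpa using key
    · have hf := hA.fits (S := S) hM (by omega : r ≤ 500 * n)
        ((hlen i).trans (by omega : _ ≤ 300 * H)) (hc.valid i)
      refine runs_matchingProgram_unwind hf (hc.ofKind_eq i 6) (by omega) fun s hs => ?_
      by_cases hi : (i : ℕ) = 0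
      · refine Runs.mono (runs_unwindRound_active hf (by rw [hi]; exact hs) (by omega)
          (m := unwind [] l) (l := lay 0) ?_ ?_) ?_
        · rw [hc.ofKind_eq]
          simp [unwinding, hi]
        · rw [hc.ofKind_eq]
          simp [unwinding, hi]
        · rintro s' ⟨g1, g2, g3⟩
          have h5 := length_unwind_nil_le (lay 0 ++ l)
          rw [← unwind_append] at g2 g3
          refine ⟨⟨g1, by rw [g2, if_pos hi]⟩, ?_, ?_⟩
          · rw [g3, List.length_append, List.length_map, List.length_singleton]
            omega
          · rw [g2, List.length_map]
            omega
      · refine Runs.mono (runs_unwindRound_idle hf hs (by omega) hi) ?_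
        rintro s' ⟨g1, g2, g3⟩
        refine ⟨⟨by simp [g1, hi], by rw [g2, if_neg hi]⟩, ?_, by simp [g2]⟩
        rw [g3, List.length_append, List.length_singleton]
        refine (Nat.add_le_add_right (length_flatMap_le _ _ 1 ?_) _).trans ?_
        · intro p _
          split_ifs <;> simp
        · have h5 : (roundEnv n S r inb i).inbox.length ≤ 2 * n + 1 := hlen i
          omega
    · intro a s hs _
      -- Only machine `0` halts, and the other machines output nothing, so the result is its
      -- matching.
      rw [if_pos ⟨⟨0, ht⟩, (hs _).1.2 rfl⟩, loss_pure, flatMap_finRange_single (i := ⟨0, ht⟩),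
        (hs _).2, if_pos rfl]
      intro j hj
      rw [(hs j).2, if_neg fun e => hj (Fin.ext e)]
  | succ t ih =>
    obtain ⟨R, rfl⟩ : ∃ R', R = R' + 1 := ⟨R - 1, by omega⟩
    have hlen := hc.length_le_of_unwinding hlay
    refine loss_run_succ_le_of_sim_nil hA hM (by omega) (fun i => (hlen i).trans (by omega)) hc.valid
      (fun i k j => if k = 6 then if (j : ℕ) = i then [modePacket t] else []
        else if k = 5 then if (i : ℕ) = t + 1 ∧ (j : ℕ) = t then
          (unwind [] (lay (t + 1) ++ l)).map (plainPacket 5) else []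
        else if (j : ℕ) = i ∧ (i : ℕ) ≠ t + 1 ∧ k = 4 then (lay i).map (plainPacket 4) else [])
      (fun i hf => Runs.sim ?_) fun inb' h => ?_
    · refine runs_matchingProgram_unwind hf (hc.ofKind_eq i 6) (by omega) fun s hs => ?_
      by_cases hi : (i : ℕ) = t + 1
      · refine Runs.mono (runs_unwindRound_active hf (by rw [hi]; exact hs) (by omega)
          (m := unwind [] l) (l := lay (t + 1)) ?_ ?_) ?_
        · rw [hc.ofKind_eq]
          simp [unwinding, hi]
        · rw [hc.ofKind_eq]
          simp [unwinding, hi]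
        · rintro s' ⟨g1, g2, g3⟩
          have h5 := length_unwind_nil_le (lay (t + 1) ++ l)
          rw [← unwind_append] at g2 g3
          refine ⟨by simpa [hi] using g1, ?_, ?_, fun k j => ?_⟩
          · rwa [g2, List.length_map]
          · rw [g3, List.length_append, List.length_map, List.length_singleton]
            omega
          · rw [g3, hi, Nat.add_sub_cancel, pick_append, pick_map (k₀ := 5) _ _ _ _ _ fun _ => rfl,
              pick_singleton]
            simp only [modePacket, Matrix.cons_val]
            by_cases h6 : k = 6
            · simp [h6]
            by_cases h5 : k = 5
            · by_cases hj : (j : ℕ) = t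
              · simp [h5, hj]
              · simp [h5, hj, Ne.symm hj]
            · simp [h5, h6]
      · refine Runs.mono (runs_unwindRound_idle hf hs (by omega) hi) ?_
        rintro s' ⟨g1, g2, g3⟩
        refine ⟨g1, by simp [g2], ?_, fun k j => ?_⟩
        · rw [g3, List.length_append, List.length_singleton]
          refine (Nat.add_le_add_right (length_flatMap_le _ _ 1 ?_) _).trans ?_
          · intro p _
            split_ifs <;> simp
          · have h5 : (roundEnv n S r inb i).inbox.length ≤ 2 * n + 1 := hlen i
            omega
        · rw [g3, Nat.add_sub_cancel, pick_append, pick_forward k i j fun k => k = 4, pick_singleton,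
            hc.ofKind_eq]
          simp only [modePacket, Matrix.cons_val]
          by_cases h6 : k = 6
          · simp [h6]
          by_cases h5 : k = 5
          · simp [h5, hi]
          by_cases h4 : k = 4
          · simp [h4, hi, unwinding]
          · simp [h4, h5, h6]
    -- The active machine does not forward its layer, hence layer `t + 1` is replaced by the empty
    -- list.
    · have h' : Contents L (unwinding (Function.update lay (t + 1) []) t
          (unwind [] (lay (t + 1) ++ l))) inb' := by
        convert h using 1
        funext j k
        by_cases h6 : k = 6
        · simp only [h6, if_true, unwinding]
          rw [flatMap_finRange_single (i := j)]
          · simp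
          · intro i hi
            exact if_neg fun e => hi (Fin.ext e).symm
        by_cases h5 : k = 5
        · simp only [h5, if_true, unwinding]
          rw [flatMap_finRange_single (i := ⟨t + 1, ht⟩)]
          · simp
          · intro i hi
            rw [if_neg (by norm_num), if_neg fun e => hi (Fin.ext e.1)]
        · simp only [h5, h6, if_false, unwinding]
          rw [flatMap_finRange_single (i := j)]
          · by_cases h4 : k = 4
            · by_cases hj : (j : ℕ) = t + 1
              · simp [h4, hj]
              · simp [h4, hj]
            · simp [h4]
          · intro i hi
            exact if_neg fun e => hi (Fin.ext e.1).symm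
      refine (ih h' (fun i => ?_) (by omega) (by omega) (by omega)).trans (le_of_eq ?_)
      · by_cases hi : i = t + 1
        · simp [hi]
        · simpa [hi] using hlay i
      · have : (List.range (t + 1)).flatMap (Function.update lay (t + 1) [])
            = (List.range (t + 1)).flatMap lay := by
          refine List.flatMap_congr fun i hi => ?_
          rw [Function.update_of_ne (List.mem_range.1 hi).ne]
        rw [this, List.range_succ (n := t + 1), List.flatMap_append, List.append_assoc,
          List.flatMap_singleton]

end Unwinding

end MapReduce


namespace MapReduce

/-! ### The phases of the algorithm -/

section Phases

variable {L : Limits} {n S M H : ℕ} {G : SimpleGraph (Fin n)} {w : Sym2 (Fin n) → ℝ}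
  {D : Fin M → List (Fin n × Fin n)}

/-- All the edges. -/
abbrev allEdges (D : Fin M → List (Fin n × Fin n)) : List (Fin n × Fin n) :=
  (List.finRange M).flatMap D

/-- The edges of `G` are distributed over `M` machines, and the limits suffice for them. -/
structure Setting (L : Limits) (G : SimpleGraph (Fin n)) (w : Sym2 (Fin n) → ℝ) (S H : ℕ)
    (D : Fin M → List (Fin n × Fin n)) : Prop where
  ample : Ample L n H
  le_capacity : n ≤ S
  min_le : min S (n * n) ≤ H
  machines : M ≤ n + 1
  lt_mul : (allEdges D).length < M * S
  total : (allEdges D).length ≤ n * n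
  sq_le : n * n ≤ L.maxInt
  length_le : ∀ i, (D i).length ≤ H
  mem_edgeSet : ∀ i, ∀ a ∈ D i, s(a.1, a.2) ∈ G.edgeSet
  covers : ∀ u v, s(u, v) ∈ G.edgeSet → (u, v) ∈ allEdges D ∨ (v, u) ∈ allEdges D
  words : weightWords G w (10 * (n * n)) ⊆ L.words

/-- The layers `0, …, t - 1` of the stack have been filled, and `φ` is the potential. -/
structure Stage (G : SimpleGraph (Fin n)) (w : Sym2 (Fin n) → ℝ) (t : ℕ) (φ : ℕ → ℝ)
    (lay : ℕ → List (Fin n × Fin n)) : Prop where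
  empty : ∀ i, t ≤ i → lay i = []
  length_le : ∀ i, (lay i).length ≤ n
  mem_edgeSet : ∀ i, ∀ a ∈ lay i, s(a.1, a.2) ∈ G.edgeSet
  pushable : Pushable w 0 ((List.range t).flatMap lay)
  potential : φ = push w 0 ((List.range t).flatMap lay)

variable {t : ℕ} {φ φ₀ : ℕ → ℝ} {lay : ℕ → List (Fin n × Fin n)}

lemma Stage.zero : Stage G w 0 0 fun _ => [] :=
  ⟨fun _ _ => rfl, fun _ => by simp, fun _ a ha => by simp at ha, by simp [Pushable], by simp [push]⟩

/-- Each phase pushes at most `n` edges and each push adds `1` to the coefficient sum. As there are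
at most `n + 1` phases, coefficients stay of order `n ^ 2`. -/
lemma Stage.mem (h : Stage G w t φ lay) (x : ℕ) : φ x ∈ weightWords G w (n * t) := by
  rw [h.potential]
  refine weightWords_mono ?_ (push_mem_weightWords (W := 0) (fun x => zero_mem_weightWords 0) ?_ x)
  · rw [zero_add]
    refine (length_flatMap_le _ _ n fun i _ => h.length_le i).trans ?_
    rw [List.length_range]
  · intro a ha
    obtain ⟨i, -, hi⟩ := List.mem_flatMap.1 ha
    exact h.mem_edgeSet i a hi

lemma Stage.next (h : Stage G w t φ lay) {s : List (Fin n × Fin n)}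
    (hs : ∀ a ∈ s, s(a.1, a.2) ∈ G.edgeSet) :
    Stage G w (t + 1) (push w φ (pushed w φ s n)) (Function.update lay t (pushed w φ s n)) := by
  have hl : (List.range (t + 1)).flatMap (Function.update lay t (pushed w φ s n))
      = (List.range t).flatMap lay ++ pushed w φ s n := by
    rw [List.range_succ, List.flatMap_append, List.flatMap_singleton, Function.update_self]
    congr 1
    refine List.flatMap_congr fun i hi => ?_
    rw [Function.update_of_ne (List.mem_range.1 hi).ne]
  refine ⟨fun i hi => ?_, fun i => ?_, fun i a ha => ?_, ?_, ?_⟩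
  · rw [Function.update_of_ne (by omega), h.empty i (by omega)]
  · by_cases hi : i = t
    · rw [hi, Function.update_self]
      exact length_pushed_le φ s n
    · rw [Function.update_of_ne hi]
      exact h.length_le i
  · by_cases hi : i = t
    · rw [hi, Function.update_self] at ha
      exact hs a (mem_of_mem_pushed ha)
    · rw [Function.update_of_ne hi] at ha
      exact h.mem_edgeSet i a ha
  · rw [hl, pushable_append, ← h.potential]
    exact ⟨h.pushable, pushable_pushed φ s n⟩
  · rw [hl, push_append, ← h.potential]

lemma Stage.isTwoApprox (h : Stage G w t φ lay) (hS : Setting L G w S H D)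
    (h0 : alive w φ (allEdges D) = []) :
    IsTwoApprox G w ((unwind [] ((List.range t).flatMap lay)).map
      fun a => ((a.1 : ℕ), (a.2 : ℕ))) := by
  refine isTwoApprox_unwind ?_ h.pushable fun u v huv => ?_
  · intro a ha
    obtain ⟨i, -, hi⟩ := List.mem_flatMap.1 ha
    exact h.mem_edgeSet i a hi
  · rw [← h.potential]
    have key : ∀ a ∈ allEdges D, residual w φ a ≤ 0 := by
      intro a ha
      by_contra hpos
      have : a ∈ alive w φ (allEdges D) := by
        rw [alive, List.mem_filter]
        exact ⟨ha, by simpa using hpos⟩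
      rw [h0] at this
      simp at this
    rcases hS.covers u v huv with huv | huv
    · exact key _ huv
    · rw [← residual_swap]
      exact key _ huv

lemma alive_flatMap {α : Type} (l : List α) (g : α → List (Fin n × Fin n)) :
    alive w φ (l.flatMap g) = l.flatMap fun x => alive w φ (g x) := by
  rw [alive, List.filter_flatMap]
  rfl

/-- Residual weights only decrease as potentials grow, so edges discarded in earlier phases would
not be alive later either. -/
lemma alive_alive (h : φ₀ ≤ φ) (l : List (Fin n × Fin n)) :
    alive w φ (alive w φ₀ l) = alive w φ l := by
  rw [alive, alive, List.filter_filter]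
  refine List.filter_congr fun a _ => ?_
  have := residual_anti (w := w) h a
  rw [← Bool.decide_and]
  simp only [decide_eq_decide, and_iff_left_iff_imp]
  intro h
  linarith

/-- The inboxes hold what is needed to replace the potential `φ₀` by `φ`. -/
structure Ready (L : Limits) (G : SimpleGraph (Fin n)) (w : Sym2 (Fin n) → ℝ) (H : ℕ)
    (D X : Fin M → List (Fin n × Fin n)) (φ₀ φ : ℕ → ℝ) (lay : ℕ → List (Fin n × Fin n))
    (pot : List Packet) (inb : Fin M → List Packet) : Prop where
  contents : Contents L (holding w φ₀ X lay 3 fun _ => pot) inb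
  length_le : ∀ i, (X i).length ≤ H
  mem_edgeSet : ∀ i, ∀ a ∈ X i, s(a.1, a.2) ∈ G.edgeSet
  alive_eq : ∀ i, alive w φ (X i) = alive w φ (D i)
  length_pot : pot.length ≤ n
  exists_of_mem : ∀ p ∈ pot, ∃ v < n, p = potentialPacket (fun x => φ x - φ₀ x) v
  mem : ∀ v < n, φ v - φ₀ v = 0 ∨ potentialPacket (fun x => φ x - φ₀ x) v ∈ pot

variable {X : Fin M → List (Fin n × Fin n)} {pot : List Packet} {inb : Fin M → List Packet}
  {R : ℕ} {f : List (ℕ × ℕ) → ℝ≥0∞}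

/-- The first round of a phase. -/
lemma Setting.loss_run_reduce (hS : Setting L G w S H D) (hst : Stage G w t φ lay) (ht : t ≤ M)
    (hr : Ready L G w H D X φ₀ φ lay pot inb) {c : ℝ≥0∞}
    (hF : ∀ inb' : Fin M → List Packet, Contents L (holding w φ (fun i => alive w φ (D i)) lay 1
        fun _ => (List.finRange M).map fun j => countPacket (alive w φ (D j)).length) inb' →
      loss (run L matchingProgram n S R (4 * t + 1) inb') f ≤ c) :
    loss (run L matchingProgram n S (R + 1) (4 * t) inb) f ≤ c := by
  have h1 := hS.machines
  have h2 := hS.ample.two_le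
  refine MapReduce.loss_run_reduce hS.ample h1 (by omega) (by omega) hr.contents hr.length_le
    hst.length_le hr.length_pot hr.exists_of_mem hr.mem ?_ fun inb' h => hF inb' ?_
  · intro i a ha
    refine hS.words (weightWords_mono ?_ (residual_mem_weightWords hst.mem (hr.mem_edgeSet i a ha)))
    have : n * t ≤ n * (n + 1) := Nat.mul_le_mul_left n (by omega)
    nlinarith
  · simpa only [hr.alive_eq] using h

/-- The end of the algorithm, after all edges have been reduced to weight at most `0`. -/
lemma Setting.loss_run_unwind (hS : Setting L G w S H D) (hst : Stage G w t φ lay) (ht : t ≤ M)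
    (hr : Ready L G w H D X φ₀ φ lay pot inb) (h0 : alive w φ (allEdges D) = [])
    (hR : t + 3 ≤ R) (hf : ∀ out, IsTwoApprox G w out → f out = 0) :
    loss (run L matchingProgram n S R (4 * t) inb) f ≤ 0 := by
  have h1 := hS.machines
  have h2 := hS.ample.two_le
  have hM : 0 < M := by
    have := hS.lt_mul
    by_contra h
    have : M = 0 := by omega
    subst this
    omega
  obtain ⟨R, rfl⟩ : ∃ R', R = R' + 1 + 1 := ⟨R - 2, by omega⟩
  refine hS.loss_run_reduce hst ht hr fun inb' h => ?_
  refine loss_run_sample_nil hS.ample h1 (by omega) (by omega) h (fun i => ?_) hst.length_le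
    fun inb'' h' => ?_
  · rw [allEdges, alive_flatMap, List.flatMap_eq_nil_iff] at h0
    exact h0 i (List.mem_finRange i)
  · rw [show (4 * t + 1) / 4 - 1 = t - 1 by omega] at h'
    refine (MapReduce.loss_run_unwind (l := []) hS.ample h1 h' hst.length_le (by omega) (by omega)
      (by omega)).trans ?_
    rw [List.append_nil, hf]
    -- For `t = 0` no layer was filled, and the round that unwinds layer `0` finds it empty.
    have := hst.isTwoApprox hS h0
    rcases t with _ | t
    · simpa [hst.empty 0 le_rfl] using this
    · exact this

end Phases

end MapReduce


namespace MapReduce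

/-! ### The random rounds of a phase and the induction over the phases. -/

section Phases

variable {L : Limits} {n S M H : ℕ} {G : SimpleGraph (Fin n)} {w : Sym2 (Fin n) → ℝ}
  {D : Fin M → List (Fin n × Fin n)} {t : ℕ} {φ φ₀ : ℕ → ℝ} {lay : ℕ → List (Fin n × Fin n)}
  {X : Fin M → List (Fin n × Fin n)} {pot : List Packet} {inb : Fin M → List Packet}
  {R : ℕ} {f : List (ℕ × ℕ) → ℝ≥0∞}

lemma Setting.mem_edgeSet_of_sublist (hS : Setting L G w S H D) {a : List (Fin n × Fin n)}
    (ha : a.Sublist (arcs (alive w φ (allEdges D)))) {x : Fin n × Fin n} (hx : x ∈ a) :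
    s(x.1, x.2) ∈ G.edgeSet := by
  obtain ⟨b, hb, hxb⟩ := List.mem_flatMap.1 (ha.mem hx)
  obtain ⟨i, -, hi⟩ := List.mem_flatMap.1 (List.mem_filter.1 hb).1
  have := hS.mem_edgeSet i b hi
  simp only [List.mem_cons, List.not_mem_nil, or_false] at hxb
  rcases hxb with rfl | rfl
  · exact this
  · rwa [Prod.fst_swap, Prod.snd_swap, Sym2.eq_swap]

/-- A good sample has at most `256 S` arcs, and any sample at most `2 n ^ 2`. The smaller bound
matters because `H` is only required to dominate `min S (n * n)`. -/
lemma Setting.length_sample_le (hS : Setting L G w S H D) {a : List (Fin n × Fin n)}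
    (ha : a.Sublist (arcs (alive w φ (allEdges D)))) (hg : GoodSample w φ (allEdges D) S a) :
    a.length ≤ 256 * H := by
  have h1 := ha.length_le
  have h2 := alive_length_le (w := w) (φ := φ) (allEdges D)
  have h3 := hS.total
  have h4 := hg.1
  have h5 := hS.min_le
  rw [length_arcs] at h1
  rcases min_choice S (n * n) with h | h <;> rw [h] at h5 <;> omega

/-- The last three rounds of a phase with edges. -/
lemma Setting.loss_run_sample (hS : Setting L G w S H D) (hst : Stage G w t φ lay) (ht : t < M)
    (h0 : 0 < (alive w φ (allEdges D)).length)
    (hc : Contents L (holding w φ (fun i => alive w φ (D i)) lay 1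
        fun _ => (List.finRange M).map fun j => countPacket (alive w φ (D j)).length) inb)
    (hf : ∀ out, f out ≤ 1) {c : ℝ≥0∞}
    (hF : ∀ (a : List (Fin n × Fin n)) (pot : List Packet) (inb' : Fin M → List Packet),
      GoodSample w φ (allEdges D) S a →
      Stage G w (t + 1) (push w φ (pushed w φ a n)) (Function.update lay t (pushed w φ a n)) →
      Ready L G w H D (fun i => alive w φ (D i)) φ (push w φ (pushed w φ a n))
        (Function.update lay t (pushed w φ a n)) pot inb' →
      loss (run L matchingProgram n S R (4 * (t + 1)) inb') f ≤ c) :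
    loss (run L matchingProgram n S (R + 1 + 1 + 1) (4 * t + 1) inb) f ≤ 2 * (32 ^ n)⁻¹ + c := by
  classical
  have h1 := hS.machines
  have h2 := hS.ample.two_le
  have hX : ∀ i, (alive w φ (D i)).length ≤ H := fun i =>
    (alive_length_le _).trans (hS.length_le i)
  have hE : (List.finRange M).flatMap (fun i => alive w φ (D i)) = alive w φ (allEdges D) :=
    (alive_flatMap _ _).symm
  have hnt : n * t ≤ n * n := Nat.mul_le_mul_left n (by omega)
  have hnn : n * 2 ≤ n * n := Nat.mul_le_mul_left n h2
  set E := allEdges D with hEdef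
  set N := (alive w φ E).length with hN
  -- A bad sample is charged the full loss `1`; after a good one the rest of the computation costs
  -- at most `c`. The value off the sublists is irrelevant.
  have key := MapReduce.loss_run_sample (R := R + 1 + 1) (r := 4 * t + 1) (S := S) (f := f) hS.ample h1 (by omega)
    (by omega) hc hX hst.length_le (N := N) (by rw [hE])
    ((alive_length_le _).trans (hS.total.trans hS.sq_le)) h0
    (F := fun a => if a.Sublist (arcs (alive w φ E)) then
      (if GoodSample w φ E S a then 0 else 1) + c else 1) fun a inb₁ ha hc₁ => ?_
  · rw [hE] at key
    refine (key.trans (expSub_mono fun a ha => by rw [if_pos ha])).trans ?_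
    rw [expSub_add, expSub_const (keepProb_add_dropProb h0)]
    gcongr
    exact expSub_not_goodSample_le hS.le_capacity h0
  · rw [hE] at ha
    rw [if_pos ha]
    by_cases hg : GoodSample w φ E S a
    swap
    · rw [if_neg hg]
      exact (loss_le_one hf).trans le_self_add
    rw [if_pos hg, zero_add]
    have hedge : ∀ x ∈ a, s(x.1, x.2) ∈ G.edgeSet := fun x hx => hS.mem_edgeSet_of_sublist ha hx
    have hpush : ∀ u, u ≤ n → ∀ x, push w φ (pushed w φ a u) x ∈ weightWords G w (n * t + n) :=
      fun u hu x => weightWords_mono (by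
        have := length_pushed_le (w := w) φ a u
        omega) (push_mem_weightWords hst.mem (fun b hb => hedge b (mem_of_mem_pushed hb)) x)
    set φ' := push w φ (pushed w φ a n) with hφ'
    refine loss_run_push hS.ample h1 (by omega) (t := t) (by omega) ht hc₁ hX hst.length_le
      (hst.empty t le_rfl) (hS.length_sample_le ha hg) (fun x hx => (hedge x hx).ne) ?_ ?_
      fun inb₂ hc₂ => ?_
    · intro u hu b hb
      refine hS.words (weightWords_mono ?_ (residual_mem_weightWords (hpush u hu) (hedge b hb)))
      omega
    · intro u hu x
      refine hS.words (weightWords_mono ?_ (sub_mem_weightWords (hpush u hu x) (hst.mem x)))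
      omega
    have hst' := hst.next hedge
    refine loss_run_relay hS.ample h1 (by omega) (by omega) hc₂ hX hst'.length_le fun inb₃ hc₃ => ?_
    rw [show 4 * t + 1 + 1 + 1 + 1 = 4 * (t + 1) by ring]
    refine hF a _ inb₃ hg hst' ⟨hc₃, hX, ?_, ?_, ?_, ?_, ?_⟩
    · intro i x hx
      exact hS.mem_edgeSet i x (List.mem_filter.1 hx).1
    · intro i
      exact alive_alive (le_push (pushable_pushed φ a n)) _
    · rw [← List.map_flatMap, List.length_map, length_flatMap_filter_mod n (by omega)]
    · intro p hp
      rw [← List.map_flatMap, List.mem_map] at hp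
      obtain ⟨v, hv, rfl⟩ := hp
      obtain ⟨i, -, hv⟩ := List.mem_flatMap.1 hv
      exact ⟨v, List.mem_range.1 (List.mem_filter.1 hv).1, rfl⟩
    · intro v hv
      right
      rw [← List.map_flatMap]
      refine List.mem_map_of_mem (List.mem_flatMap.2 ⟨⟨v % M, Nat.mod_lt _ (by omega)⟩,
        List.mem_finRange _, List.mem_filter.2 ⟨List.mem_range.2 hv, by simp⟩⟩)

/-- Here `d` is the number of machines not yet used for a layer, and each further phase costs `2 /
32 ^ n`. Hypothesis `hb` is the accumulated decay of the number of edges. In `hR`, at most `T + 1`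
phases take four rounds each, and unwinding takes at most one round per layer plus a few. -/
lemma Setting.loss_run_phases (hS : Setting L G w S H D) {T : ℕ}
    (hT : (allEdges D).length * n ^ T ≤ 64 * S * (2 * S) ^ T) (hf : ∀ out, f out ≤ 1)
    (hf0 : ∀ out, IsTwoApprox G w out → f out = 0) {d : ℕ} (hd : t + d = M)
    (hst : Stage G w t φ lay) (hr : Ready L G w H D X φ₀ φ lay pot inb)
    (hb : (alive w φ (allEdges D)).length * (2 * S) ^ t ≤ (allEdges D).length * n ^ t)
    (hcase : (alive w φ (allEdges D)).length = 0 ∧ t ≤ T + 1 ∨ t < M ∧ t ≤ T)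
    (hR : 5 * T + 10 ≤ R + 4 * t) :
    loss (run L matchingProgram n S R (4 * t) inb) f ≤ d * (2 * (32 ^ n)⁻¹) := by
  have h2 := hS.ample.two_le
  have hnS := hS.le_capacity
  induction d generalizing t φ φ₀ lay X pot inb R with
  | zero =>
    rcases hcase with ⟨h0, ht⟩ | ⟨h, -⟩
    · exact (hS.loss_run_unwind hst (by omega) hr (List.length_eq_zero_iff.1 h0) (by omega)
        hf0).trans zero_le
    · omega
  | succ d ih =>
    rcases Nat.eq_zero_or_pos (alive w φ (allEdges D)).length with h0 | h0
    · refine (hS.loss_run_unwind hst (by omega) hr (List.length_eq_zero_iff.1 h0) ?_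
        hf0).trans zero_le
      rcases hcase with ⟨-, ht⟩ | ⟨-, ht⟩ <;> omega
    obtain ⟨htM, htT⟩ : t < M ∧ t ≤ T := by
      rcases hcase with ⟨h, -⟩ | h
      · omega
      · exact h
    obtain ⟨R, rfl⟩ : ∃ R', R = R' + 1 + 1 + 1 + 1 := ⟨R - 4, by omega⟩
    refine hS.loss_run_reduce hst htM.le hr fun inb₁ hc₁ => ?_
    rw [Nat.cast_add, Nat.cast_one, add_mul, one_mul, add_comm ((d : ℝ≥0∞) * _)]
    refine hS.loss_run_sample hst htM h0 hc₁ hf fun a pot' inb' hg hst' hr' => ?_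
    obtain ⟨-, hg2, hg3⟩ := hg
    refine ih (by omega) hst' hr' ?_ ?_ (by omega)
    · calc _ = (alive w (push w φ (pushed w φ a n)) (allEdges D)).length * (2 * S) * (2 * S) ^ t := by
            ring
        _ ≤ (alive w φ (allEdges D)).length * n * (2 * S) ^ t := Nat.mul_le_mul_right _ hg2
        _ = (alive w φ (allEdges D)).length * (2 * S) ^ t * n := by ring
        _ ≤ (allEdges D).length * n ^ t * n := Nat.mul_le_mul_right _ hb
        _ = _ := by ring
    · rcases le_or_gt (alive w φ (allEdges D)).length (64 * S) with h64 | h64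
      · exact Or.inl ⟨hg3 h64, by omega⟩
      · right
        have hpos : 0 < (2 * S) ^ t := Nat.pow_pos (by omega)
        constructor
        -- More than `64 S` edges after `t` phases force `M > 64 * 2 ^ t`, as `|E| < M S` and `n ≤
        -- S`. So there is a machine for the next layer.
        · have hlt : 64 * S * (2 * S) ^ t < M * S * S ^ t := by
            calc _ < (alive w φ (allEdges D)).length * (2 * S) ^ t := Nat.mul_lt_mul_of_pos_right h64 hpos
              _ ≤ _ := hb
              _ ≤ M * S * S ^ t := Nat.mul_le_mul hS.lt_mul.le (Nat.pow_le_pow_left hnS t)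
          have hlt' : 64 * 2 ^ t * (S * S ^ t) < M * (S * S ^ t) := by
            calc _ = 64 * S * (2 * S) ^ t := by rw [mul_pow]; ring
              _ < _ := hlt
              _ = _ := by ring
          have h3 := Nat.lt_of_mul_lt_mul_right hlt'
          have h4 := Nat.lt_two_pow_self (n := t)
          omega
        -- At `t = T` the bounds `hb` and `hT` leave at most `64 S` edges, contrary to the case
        -- assumption.
        · by_contra hlt
          have : t = T := by omega
          subst this
          have := Nat.le_of_mul_le_mul_right (hb.trans hT) hpos
          omega

end Phases

end MapReduce


namespace MapReduce

/-! ### The guarantees of the algorithm -/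

section Guarantee

variable {L : Limits} {n S M H : ℕ} {G : SimpleGraph (Fin n)} {w : Sym2 (Fin n) → ℝ}
  {D : Fin M → List (Fin n × Fin n)}

lemma arcPacket_zero (a : Fin n × Fin n) : arcPacket w 0 0 a = edgePacket w a := by
  simp [arcPacket, edgePacket, residual]

lemma Setting.ready_zero (hS : Setting L G w S H D) :
    Ready L G w H D D 0 0 (fun _ => []) [] fun i => (D i).map (edgePacket w) := by
  have h1 := hS.ample.maxInt
  have h2 := hS.ample.le
  refine ⟨⟨fun i k => ?_, ?_⟩, hS.length_le, hS.mem_edgeSet, fun _ => rfl, by simp, by simp,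
    fun v _ => Or.inl (by simp)⟩
  · have hk : ∀ a : Fin n × Fin n, (edgePacket w a).field 3 = 0 := fun a => rfl
    rw [holding, ofKind, List.filter_map]
    by_cases h0 : k = 0
    · subst h0
      rw [List.filter_eq_self.2 (by simp [hk])]
      simp only [OfNat.zero_ne_ofNat, if_false, if_true]
      exact List.map_congr_left fun a _ => (arcPacket_zero a).symm
    · rw [List.filter_eq_nil_iff.2 (by simp [hk, Ne.symm h0])]
      simp [h0]
  · intro i p hp
    obtain ⟨a, ha, rfl⟩ := List.mem_map.1 hp
    have := hS.ample.two_le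
    refine ⟨fun j => ?_, hS.words (weightWords_mono ?_ (edge_mem_weightWords (hS.mem_edgeSet i a ha)))⟩
    · have h3 := a.1.2
      have h4 := a.2.2
      fin_cases j <;> simp [edgePacket] <;> omega
    · nlinarith

open Classical in
lemma Setting.loss_run_le (hS : Setting L G w S H D) {T R : ℕ}
    (hT : (allEdges D).length * n ^ T ≤ 64 * S * (2 * S) ^ T) (hR : 5 * T + 10 ≤ R) :
    loss (run L matchingProgram n S R 0 fun i => (D i).map (edgePacket w))
      (fun out => if IsTwoApprox G w out then 0 else 1) ≤ M * (2 * (32 ^ n)⁻¹) := by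
  have hM : 0 < M := by
    have := hS.lt_mul
    by_contra h
    have : M = 0 := by omega
    subst this
    omega
  refine hS.loss_run_phases (t := 0) hT (fun out => ?_) (fun out h => if_pos h) (zero_add M)
    Stage.zero hS.ready_zero ?_ (Or.inr ⟨hM, Nat.zero_le T⟩) hR
  · split_ifs <;> simp
  · simpa using alive_length_le (w := w) (φ := 0) (allEdges D)

/-- The union bound over at most `M ≤ n + 1` phases, compared with the allowed failure probability.
-/
lemma mul_inv_pow_le {a : ℕ} (hM : M ≤ n + 1) (h : (n + 1) * 2 * n ^ a ≤ 32 ^ n) :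
    (M : ℝ≥0∞) * (2 * (32 ^ n)⁻¹) ≤ ((n : ℝ≥0∞) ^ a)⁻¹ := by
  rw [ENNReal.le_inv_iff_mul_le]
  have h' : (M : ℝ≥0∞) * 2 * (n : ℝ≥0∞) ^ a ≤ 32 ^ n := by
    have : M * 2 * n ^ a ≤ 32 ^ n :=
      (Nat.mul_le_mul_right _ (Nat.mul_le_mul_right 2 hM)).trans h
    exact_mod_cast this
  calc _ = (M : ℝ≥0∞) * 2 * (n : ℝ≥0∞) ^ a * (32 ^ n)⁻¹ := by ring
    _ ≤ 32 ^ n * (32 ^ n)⁻¹ := by gcongr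
    _ ≤ 1 := ENNReal.mul_inv_le_one _

lemma IsDistribution.length_eq (hD : IsDistribution G S D) :
    (allEdges D).length = G.edgeSet.ncard := by
  classical
  have : G.edgeSet = ↑(((allEdges D).map fun q => s(q.1, q.2)).toFinset) := by
    ext e
    rw [Finset.mem_coe, List.mem_toFinset, hD.mem_iff]
  rw [this, Set.ncard_coe_finset, List.toFinset_card_of_nodup hD.nodup, List.length_map]

lemma le_capacity (n : ℕ) (μ : ℝ) : (n : ℝ) ^ (1 + μ) ≤ capacity n μ := Nat.le_ceil _

lemma self_le_capacity {μ : ℝ} (hn : 1 ≤ n) (hμ : 0 ≤ μ) : n ≤ capacity n μ := by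
  have h : (n : ℝ) ≤ capacity n μ := by
    refine le_trans ?_ (le_capacity n μ)
    exact Real.self_le_rpow_of_one_le (by exact_mod_cast hn) (by linarith)
  exact_mod_cast h

/-- Since `n ≥ 2`, a constant up to `2 ^ j` is absorbed in `n ^ j`. This works for all `n ≥ 2`, as
the second part of the theorem needs. -/
lemma mul_le_pow {c j k m : ℕ} (hn : 2 ≤ n) (hc : c ≤ 2 ^ j) (hk : j + k ≤ m) :
    c * n ^ k ≤ n ^ m :=
  calc c * n ^ k ≤ n ^ j * n ^ k := Nat.mul_le_mul_right _ (hc.trans (Nat.pow_le_pow_left hn j))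
    _ = n ^ (j + k) := (pow_add _ _ _).symm
    _ ≤ n ^ m := Nat.pow_le_pow_right (by omega) hk

/-- The choice `H = min S (n ^ 2)` serves both limits: memory is measured by `S`, but integer words
and steps are bounded by a fixed power of `n`, and `S` is not, because `μ` is arbitrary. -/
lemma setting_of_isDistribution {μ : ℝ} (hn : 2 ≤ n) (hμ : 0 ≤ μ)
    {D : Fin (machineCount n G.edgeSet.ncard μ) → List (Fin n × Fin n)}
    (hD : IsDistribution G (capacity n μ) D) :
    Setting (limits G w 2000 29 μ) G w (capacity n μ) (min (capacity n μ) (n * n)) D := by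
  have hnS := self_le_capacity (by omega : 1 ≤ n) hμ
  have hlen := hD.length_eq
  have hnn : n ≤ n * n := Nat.le_mul_self n
  have htotal : (allEdges D).length ≤ n * n := by
    have := (List.Nodup.of_map _ hD.nodup).length_le_card
    simpa using this
  set S := capacity n μ with hSdef
  have hH : min S (n * n) ≤ n * n := min_le_right _ _
  refine ⟨⟨hn, le_min hnS hnn, ?_, ?_, ?_, zero_mem_weightWords _⟩, hnS, le_rfl, ?_, ?_, htotal,
    ?_, ?_, ?_, ?_, ?_⟩
  -- Rounding up in `S` at most doubles `n ^ (1 + μ) ≥ 1`, hence the constant `2000`.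
  · refine (Nat.mul_le_mul_left 1000 (min_le_left _ _)).trans ?_
    refine Nat.le_floor ?_
    have h1 : (1 : ℝ) ≤ (n : ℝ) ^ (1 + μ) :=
      Real.one_le_rpow (by exact_mod_cast (by omega : 1 ≤ n)) (by linarith)
    have h2 : (S : ℝ) < (n : ℝ) ^ (1 + μ) + 1 := Nat.ceil_lt_add_one (by linarith)
    push_cast
    linarith
  · exact (Nat.mul_le_mul_left 1000 hH).trans (by
      have := mul_le_pow (c := 1000) (j := 10) (k := 2) (m := 29) hn (by norm_num) (by norm_num)
      rwa [sq] at this)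
  -- The step bound fixes the exponent: the constant is below `2 ^ 25` and four powers of `n` come
  -- from `H ^ 2`, giving `29`.
  · have := mul_le_pow (c := 200 * 300 ^ 2) (j := 25) (k := 4) (m := 29) hn (by norm_num) (by norm_num)
    refine le_trans ?_ this
    calc 200 * (300 * min S (n * n)) ^ 2 ≤ 200 * (300 * (n * n)) ^ 2 := by gcongr
      _ = _ := by ring
  -- There are at most `n ^ 2 ≤ S n` edges, so at most `n + 1` machines.
  · refine Nat.succ_le_succ (Nat.div_le_of_le_mul ?_)
    rw [← hlen]
    exact htotal.trans (Nat.mul_le_mul_right n hnS)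
  · rw [hlen, machineCount, mul_comm]
    exact Nat.lt_mul_div_succ _ (by omega)
  · have := mul_le_pow (c := 1) (j := 0) (k := 2) (m := 29) hn (by norm_num) (by norm_num)
    rwa [one_mul, sq] at this
  · intro i
    refine le_min (hD.length_le i) (le_trans ?_ htotal)
    rw [allEdges, List.length_flatMap]
    exact List.single_le_sum (by simp) _ (List.mem_map_of_mem (List.mem_finRange i))
  · intro i a ha
    refine (hD.mem_iff _).1 (List.mem_map.2 ⟨a, List.mem_flatMap.2 ⟨i, List.mem_finRange i, ha⟩, rfl⟩)
  · intro u v huv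
    obtain ⟨q, hq, he⟩ := List.mem_map.1 ((hD.mem_iff _).2 huv)
    rcases Sym2.eq_iff.1 he with ⟨h1, h2⟩ | ⟨h1, h2⟩
    · left
      rwa [← h1, ← h2]
    · right
      rwa [← h1, ← h2]
  · refine weightWords_mono ?_
    have := mul_le_pow (c := 10) (j := 4) (k := 2) (m := 29) hn (by norm_num) (by norm_num)
    rwa [sq] at this

lemma computesTwoApprox_matchingProgram {μ : ℝ} (hn : 2 ≤ n) (hμ : 0 ≤ μ) {T R a : ℕ}
    (hT : G.edgeSet.ncard * n ^ T ≤ 64 * capacity n μ * (2 * capacity n μ) ^ T)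
    (hR : 5 * T + 10 ≤ R) (ha : (n + 1) * 2 * n ^ a ≤ 32 ^ n) :
    ComputesTwoApprox matchingProgram 2000 29 G w μ R ((n : ℝ≥0∞) ^ a)⁻¹ := by
  intro D hD
  have hS := setting_of_isDistribution (w := w) hn hμ hD
  rw [← hD.length_eq] at hT
  exact one_sub_le_of_loss_le ((hS.loss_run_le hT hR).trans (mul_inv_pow_le hS.machines ha))

/-- A phase gains at least a factor `n ^ μ`. From `c ≤ μ T` follows `1 + c + T ≤ (1 + μ) (T + 1)`,
so already `S ^ (T + 1)` dominates the left side. -/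
lemma edges_mul_pow_le {μ c : ℝ} {m T : ℕ} (hn : 2 ≤ n) (hμ : 0 ≤ μ) (hT : c ≤ μ * T)
    (hm : (m : ℝ) ≤ (n : ℝ) ^ (1 + c)) :
    m * n ^ T ≤ 64 * capacity n μ * (2 * capacity n μ) ^ T := by
  have h1 : (1 : ℝ) ≤ n := by exact_mod_cast (by omega : 1 ≤ n)
  have h0 : (0 : ℝ) < n := by linarith
  have h2 : (m : ℝ) * (n : ℝ) ^ T ≤ (capacity n μ : ℝ) ^ (T + 1) := by
    calc (m : ℝ) * (n : ℝ) ^ T ≤ (n : ℝ) ^ (1 + c) * (n : ℝ) ^ (T : ℝ) := by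
          rw [Real.rpow_natCast]
          gcongr
      _ = (n : ℝ) ^ (1 + c + T) := (Real.rpow_add h0 _ _).symm
      _ ≤ (n : ℝ) ^ ((1 + μ) * ((T + 1 : ℕ) : ℝ)) := by
          refine Real.rpow_le_rpow_of_exponent_le h1 ?_
          push_cast
          nlinarith
      _ = ((n : ℝ) ^ (1 + μ)) ^ (T + 1) := by rw [Real.rpow_mul h0.le, Real.rpow_natCast]
      _ ≤ _ := by
          gcongr
          exact le_capacity n μ
  have h3 : m * n ^ T ≤ capacity n μ ^ (T + 1) := by exact_mod_cast h2
  refine h3.trans ?_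
  rw [pow_succ', mul_pow]
  refine Nat.mul_le_mul (by omega) ?_
  exact Nat.le_mul_of_pos_left _ (by positivity)

/-- Here `S = n`, so only the factor `2` in `2 S` makes progress; it has to bring `n ^ 2` edges down
to order `n`, which takes `log₂ n` phases. -/
lemma edges_mul_pow_clog_le (G : SimpleGraph (Fin n)) {T : ℕ} (hT : n ≤ 2 ^ T) :
    G.edgeSet.ncard * n ^ T ≤ 64 * capacity n 0 * (2 * capacity n 0) ^ T := by
  classical
  have hm : G.edgeSet.ncard ≤ n * n := by
    rw [Set.ncard_eq_toFinset_card']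
    refine G.card_edgeFinset_le_card_choose_two.trans ((Nat.choose_le_pow _ 2).trans ?_)
    rw [Fintype.card_fin, sq]
  have hS : capacity n 0 = n := by simp [capacity]
  rw [hS, mul_pow]
  calc _ ≤ n * n * n ^ T := Nat.mul_le_mul_right _ hm
    _ ≤ n * 2 ^ T * n ^ T := by gcongr
    _ ≤ 64 * n * 2 ^ T * n ^ T := by gcongr; omega
    _ = _ := by ring

lemma five_mul_ceil_add_le {x : ℝ} (hx : 1 ≤ x) :
    5 * ⌈x⌉₊ + 10 ≤ ⌊((2000 : ℕ) : ℝ) * x⌋₊ := by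
  refine Nat.le_floor ?_
  have := Nat.ceil_lt_add_one (by linarith : 0 ≤ x)
  push_cast
  linarith

lemma eventually_mul_pow_le (a : ℕ) :
    ∀ᶠ n : ℕ in Filter.atTop, (n + 1) * 2 * n ^ a ≤ 32 ^ n := by
  have h := tendsto_pow_const_div_const_pow_of_one_lt (a + 2) (r := (32 : ℝ)) (by norm_num)
  filter_upwards [h.eventually (gt_mem_nhds zero_lt_one), Filter.eventually_ge_atTop 3] with n h1 h3
  rw [div_lt_one (by positivity)] at h1
  have h2 : n ^ (a + 2) < 32 ^ n := by exact_mod_cast h1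
  refine le_trans ?_ h2.le
  rw [pow_add, mul_comm]
  exact Nat.mul_le_mul_left _ (by nlinarith)

lemma mul_pow_one_le (n : ℕ) : (n + 1) * 2 * n ^ 1 ≤ 32 ^ n := by
  rcases Nat.eq_zero_or_pos n with rfl | hn
  · norm_num
  have h1 := Nat.lt_two_pow_self (n := n)
  calc (n + 1) * 2 * n ^ 1 ≤ 2 ^ n * 2 ^ n * 2 ^ n := by
        have h2 : 2 ≤ 2 ^ n := Nat.le_self_pow hn.ne' 2
        rw [pow_one]
        exact Nat.mul_le_mul (Nat.mul_le_mul h1 h2) h1.le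
    _ = 8 ^ n := by rw [← mul_pow, ← mul_pow]; norm_num
    _ ≤ 32 ^ n := Nat.pow_le_pow_left (by norm_num) n

/-- Once `log n > 1` the denominator `log log n / log n` is positive, so a positive quotient forces
`μ n > 0`. -/
lemma eventually_pos_of_tendsto {μ : ℕ → ℝ}
    (h : Filter.Tendsto
      (fun n : ℕ => μ n / (Real.log (Real.log (n : ℝ)) / Real.log (n : ℝ)))
      Filter.atTop Filter.atTop) : ∀ᶠ n : ℕ in Filter.atTop, 0 < μ n := by
  have hlog := (Real.tendsto_log_atTop.comp tendsto_natCast_atTop_atTop).eventually_gt_atTop 1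
  filter_upwards [h.eventually_gt_atTop 0, hlog] with n h1 h2
  have h2' : 1 < Real.log n := h2
  have h3 : 0 < Real.log (Real.log (n : ℝ)) / Real.log (n : ℝ) :=
    div_pos (Real.log_pos h2') (by linarith)
  by_contra hμ
  exact absurd h1 (not_lt.2 (div_nonpos_of_nonpos_of_nonneg (not_lt.1 hμ) h3.le))

lemma five_mul_clog_add_le {n : ℕ} (hn : 2 ≤ n) :
    5 * Nat.clog 2 n + 10 ≤ ⌊((2000 : ℕ) : ℝ) * Real.log n⌋₊ := by
  refine Nat.le_floor ?_
  have h1 : (2 : ℝ) ≤ n := by exact_mod_cast hn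
  have h2 := Real.log_two_gt_d9
  have h3 : Real.log 2 ≤ Real.log n := Real.log_le_log (by norm_num) h1
  have h4 : (2 : ℕ) ^ (Nat.clog 2 n - 1) < n := Nat.pow_pred_clog_lt_self (by norm_num) (by omega)
  have h5 : ((Nat.clog 2 n - 1 : ℕ) : ℝ) * Real.log 2 ≤ Real.log n := by
    rw [← Real.log_pow]
    refine Real.log_le_log (by positivity) ?_
    exact_mod_cast h4.le
  have h6 : (Nat.clog 2 n : ℝ) ≤ ((Nat.clog 2 n - 1 : ℕ) : ℝ) + 1 := by
    exact_mod_cast (by omega : Nat.clog 2 n ≤ Nat.clog 2 n - 1 + 1)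
  push_cast
  nlinarith

end Guarantee

end MapReduce

theorem mainTheorem1 :
    ∃ (A : MapReduce.Cmd) (C k : ℕ),
      (∀ μ : ℕ → ℝ,
        Filter.Tendsto
          (fun n : ℕ => μ n / (Real.log (Real.log (n : ℝ)) / Real.log (n : ℝ)))
          Filter.atTop Filter.atTop →
        ∀ a : ℕ, ∀ᶠ n : ℕ in Filter.atTop,
          ∀ c : ℝ, μ n < c →
          ∀ (G : SimpleGraph (Fin n)) (w : Sym2 (Fin n) → ℝ),
            (G.edgeSet.ncard : ℝ) ≤ (n : ℝ) ^ (1 + c) →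
            MapReduce.ComputesTwoApprox A C k G w (μ n) ⌊(C : ℝ) * (c / μ n)⌋₊
              ((n : ENNReal) ^ a)⁻¹) ∧
      (∀ n : ℕ, 2 ≤ n → ∀ (G : SimpleGraph (Fin n)) (w : Sym2 (Fin n) → ℝ),
        MapReduce.ComputesTwoApprox A C k G w 0 ⌊(C : ℝ) * Real.log (n : ℝ)⌋₊
          (n : ENNReal)⁻¹) := by
  refine ⟨MapReduce.matchingProgram, 2000, 29, fun μ hμ a => ?_, fun n hn G w => ?_⟩
  · filter_upwards [MapReduce.eventually_pos_of_tendsto hμ, MapReduce.eventually_mul_pow_le a,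
      Filter.eventually_ge_atTop 2] with n h0 ha hn c hc G w hm
    -- The number of phases is governed by `T = ⌈c / μ⌉`; since `c > μ`, the quotient exceeds `1`
    -- and absorbs the additive constants in the number of rounds.
    refine MapReduce.computesTwoApprox_matchingProgram hn h0.le
      (MapReduce.edges_mul_pow_le (T := ⌈c / μ n⌉₊) hn h0.le ?_ hm)
      (MapReduce.five_mul_ceil_add_le ((one_le_div h0).2 hc.le)) ha
    rw [← div_le_iff₀' h0]
    exact Nat.le_ceil _
  -- Here `T` is the binary logarithm rounded up, and the failure bound is used with `a = 1`, where
  -- `2 n (n + 1) ≤ 32 ^ n` holds for every `n`.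
  · have h := MapReduce.computesTwoApprox_matchingProgram (w := w) hn le_rfl
      (MapReduce.edges_mul_pow_clog_le G (Nat.le_pow_clog (by norm_num) n))
      (MapReduce.five_mul_clog_add_le hn) (MapReduce.mul_pow_one_le n)
    rwa [pow_one] at h
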